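/- **Setting.** Let $\mathbb T=[0,2\pi)$ be periodic, let $\|\cdot\|$ and $\langle\cdot,\cdot\rangle$ be the norm and scalar product of the real space $L^2(\mathbb T\times\mathbb R)$, and let $\nu>0$. Consider the linearization of the two-dimensional Navier--Stokes equations around the Poiseuille flow $(y^2,0)$ in vorticity form, $$\partial_t\omega+y^2\partial_x\omega-2\partial_x\psi=\nu\Delta\omega,\qquad \Delta\psi=\omega ,\qquad t\ge 0,\ (x,y)\in\mathbb T\times\mathbb R. \tag{1}$$ Write $\mathcal D=\{f\in H^2(\mathbb T\times\mathbb R): y^2\partial_x f\in L^2\}$. A solution of (1) is a pair with $\omega\in C([0,\infty);L^2)$ and $\psi(t)\in H^2$, $\Delta\psi(t)=\omega(t)$ for all $t\ge 0$, such that for every $t>0$ one has $\omega(t)\in\mathcal D$, $\omega$ is differentiable at $t$ with values in $L^2$, and (1) holds in $L^2$. Let $k\in\mathbb N=\{1,2,\dots\}$. The solution is localized at $x$-frequency $\pm k$ if for all $t\ge0$ $$\omega(t,x,y)=\sum_{|l|=k}a_l(t,y)e^{ilx},\qquad a_l(t,y)=\frac1{2\pi}\int_{\mathbb T}\omega(t,x,y)e^{-ilx}\,dx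 .$$ **Theorem.** There exist $\varepsilon_0\ge\frac1{20}$ and constants $\alpha_0,\beta_0,\gamma_0>0$, independent of $\nu$, $k$ and of the solution, such that for all $\nu>0$, all $k\in\mathbb N$ and every solution $(\omega_k,\psi_k)$ of (1) localized at $x$-frequency $\pm k$, the functional $$\Phi_k=\frac12\left[\|\omega_k\|^2+\frac{\alpha_0\nu^{1/2}}{k^{1/2}}\|\nabla\omega_k\|^2+\frac{4\beta_0}{k}\langle y\partial_x\omega_k,\partial_y\omega_k\rangle+\frac{\gamma_0}{\nu^{1/2}k^{3/2}}\left(\|y\partial_x\omega_k\|^2+2\|\nabla\partial_x\psi_k\|^2\right)\right]$$ has the following properties. 1. For every $t>0$ all the norms in $\Phi_k$ and in (2) are finite, $\Phi_k$ is differentiable at $t$, and $$\frac{d}{dt}\Phi_k+2\varepsilon_0\nu^{1/2}k^{1/2}\Phi_k+\frac{\alpha_0\nu^{3/2}}{2k^{1/2}}\|\Delta\omega_k\|^2+\frac{\gamma_0\nu^{1/2}}{k^{3/2}}\left[\frac78\|y\partial_x\nabla\omega_k\|^2+\|\partial_x\omega_k\|^2\right]\le 0. \tag{2}$$ If $\omega_k(0)\in\mathcal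 D$, the same holds at $t=0$, with the right derivative of $\Phi_k$. 2. If $\nabla\omega_k(0)\in L^2$ and $y\partial_x\omega_k(0)\in L^2$, then $$\Phi_k(t)\le e^{-2\varepsilon_0\nu^{1/2}k^{1/2}t}\,\Phi_k(0)\qquad\text{for all } t\ge 0 .$$ -/

import Mathlib

open MeasureTheory Set


noncomputable section

namespace Poiseuille

/-- Lebesgue measure on `𝕋 × ℝ`, where `𝕋` is represented by the period `(0, 2π]`. -/
def cyl : Measure (ℝ × ℝ) :=
  ((volume : Measure ℝ).restrict (Ioc 0 (2 * Real.pi))).prod (volume : Measure ℝ)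

/-- The real space `L²(𝕋 × ℝ)`. -/
abbrev L2Cyl : Type := Lp ℝ 2 cyl

/-- Test functions on `𝕋 × ℝ`: smooth, `2π`-periodic in `x`, compactly supported in `y`. -/
def IsTest (φ : ℝ × ℝ → ℝ) : Prop :=
  ContDiff ℝ ((⊤ : ℕ∞) : WithTop ℕ∞) φ ∧ (∀ x y : ℝ, φ (x + 2 * Real.pi, y) = φ (x, y)) ∧
    ∃ R : ℝ, ∀ x y : ℝ, R < |y| → φ (x, y) = 0

/-- `g ∈ L²` is the weak derivative of `f` in the direction `v` on `𝕋 × ℝ`. -/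
def IsWeakDeriv (v : ℝ × ℝ) (f g : ℝ × ℝ → ℝ) : Prop :=
  MemLp g 2 cyl ∧
    ∀ φ : ℝ × ℝ → ℝ, IsTest φ →
      ∫ p, f p * fderiv ℝ φ p v ∂cyl = - ∫ p, g p * φ p ∂cyl

/-- `f` has a weak derivative in the direction `v` belonging to `L²`. -/
def HasL2Deriv (v : ℝ × ℝ) (f : ℝ × ℝ → ℝ) : Prop := ∃ g, IsWeakDeriv v f g

open Classical in
/-- The weak derivative in the direction `v`
(unique up to null sets when it exists, and `0` by convention when there is none in `L²`). -/
def weakDeriv (v : ℝ × ℝ) (f : ℝ × ℝ → ℝ) : ℝ × ℝ → ℝ :=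
  if h : HasL2Deriv v f then h.choose else 0

/-- The direction of the variable `x`. -/
abbrev eX : ℝ × ℝ := (1, 0)

/-- The direction of the variable `y`. -/
abbrev eY : ℝ × ℝ := (0, 1)

/-- `∂ₓ f`. -/
def dX (f : ℝ × ℝ → ℝ) : ℝ × ℝ → ℝ := weakDeriv eX f

/-- `∂_y f`. -/
def dY (f : ℝ × ℝ → ℝ) : ℝ × ℝ → ℝ := weakDeriv eY f

/-- `Δ f = ∂ₓₓ f + ∂_yy f`. -/
def lap (f : ℝ × ℝ → ℝ) : ℝ × ℝ → ℝ := fun p => dX (dX f) p + dY (dY f) p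

/-- Multiplication by the coordinate `y`. -/
def mulY (f : ℝ × ℝ → ℝ) : ℝ × ℝ → ℝ := fun p => p.2 * f p

/-- `f ∈ L²` and `∇ f ∈ L²`. -/
def MemH1 (f : ℝ × ℝ → ℝ) : Prop :=
  MemLp f 2 cyl ∧ HasL2Deriv eX f ∧ HasL2Deriv eY f

/-- `f ∈ H²(𝕋 × ℝ)`. -/
def MemH2 (f : ℝ × ℝ → ℝ) : Prop := MemH1 f ∧ MemH1 (dX f) ∧ MemH1 (dY f)

/-- The squared norm `‖f‖²` of `L²(𝕋 × ℝ)`. -/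
def normSq (f : ℝ × ℝ → ℝ) : ℝ := ∫ p, f p ^ 2 ∂cyl

/-- The scalar product `⟨f, g⟩` of `L²(𝕋 × ℝ)`. -/
def scal (f g : ℝ × ℝ → ℝ) : ℝ := ∫ p, f p * g p ∂cyl

/-- `‖∇ f‖²`. -/
def gradSq (f : ℝ × ℝ → ℝ) : ℝ := normSq (dX f) + normSq (dY f)

/-- The `l`-th Fourier coefficient in `x`,
`a_l(y) = (1 / 2π) ∫ f(x, y) exp(- i l x) dx`. -/
def fourierX (f : ℝ × ℝ → ℝ) (l : ℤ) (y : ℝ) : ℂ :=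
  (1 / (2 * Real.pi) : ℂ) *
    ∫ x in Ioc 0 (2 * Real.pi), (f (x, y) : ℂ) * Complex.exp (- (Complex.I * l * x))

/-- The part of `f` at the `x`-frequencies `± k`, that is `∑_{|l| = k} a_l(y) exp(i l x)`. -/
def bandPart (k : ℕ) (f : ℝ × ℝ → ℝ) : ℝ × ℝ → ℂ := fun p =>
  ∑ l ∈ ({(k : ℤ), -(k : ℤ)} : Finset ℤ), fourierX f l p.2 * Complex.exp (Complex.I * l * p.1)

/-- `f` is localized at the `x`-frequencies `± k`. -/
def IsBand (k : ℕ) (f : ℝ × ℝ → ℝ) : Prop := ∀ᵐ p ∂cyl, (f p : ℂ) = bandPart k f p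

/-- The domain of the linear operator `ω ↦ - y² ∂ₓ ω + 2 ∂ₓ Δ⁻¹ ω + ν Δ ω`. -/
def InDomain (f : ℝ × ℝ → ℝ) : Prop := MemH2 f ∧ MemLp (mulY (mulY (dX f))) 2 cyl

/-- `ψ` is the stream function of `ω`: `ψ ∈ H²` and `Δ ψ = ω`. -/
def IsStream (ψ ω : ℝ × ℝ → ℝ) : Prop := MemH2 ψ ∧ lap ψ =ᵐ[cyl] ω

/-- `(ω, ψ)` solves `∂ₜ ω + y² ∂ₓ ω - 2 ∂ₓ ψ = ν Δ ω`, `Δ ψ = ω` on `[0, ∞) × 𝕋 × ℝ`: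
`ω` is continuous in time with values in `L²` up to the initial time, and for `t > 0` it takes
values in the domain of the linear operator, is differentiable in time with values in `L²`, and
the equation holds in `L²`. No regularity beyond `L²` is required of the initial datum `ω 0`. -/
structure IsLinearSolution (ν : ℝ) (ω ψ : ℝ → L2Cyl) : Prop where
  continuousOn : ContinuousOn ω (Ici 0)
  stream : ∀ t, 0 ≤ t → IsStream (ψ t) (ω t)
  domain : ∀ t, 0 < t → InDomain (ω t)
  equation : ∀ t, 0 < t → ∃ w : L2Cyl, HasDerivAt ω w t ∧
    ∀ᵐ p ∂cyl, w p + p.2 ^ 2 * dX (ω t) p - 2 * dX (ψ t) p = ν * lap (ω t) p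

/-- The hypocoercive energy functional `Φ_k`. -/
def Phi (α₀ β₀ γ₀ ν : ℝ) (k : ℕ) (ω ψ : ℝ × ℝ → ℝ) : ℝ :=
  1 / 2 * (normSq ω
    + α₀ * ν ^ (1 / 2 : ℝ) / (k : ℝ) ^ (1 / 2 : ℝ) * gradSq ω
    + 4 * β₀ / (k : ℝ) * scal (mulY (dX ω)) (dY ω)
    + γ₀ / (ν ^ (1 / 2 : ℝ) * (k : ℝ) ^ (3 / 2 : ℝ)) *
        (normSq (mulY (dX ω)) + 2 * gradSq (dX ψ)))

/-- The terms that accompany `d/dt Φ_k` in the differential inequality. -/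
def dissip (ε₀ α₀ β₀ γ₀ ν : ℝ) (k : ℕ) (ω ψ : ℝ × ℝ → ℝ) : ℝ :=
  2 * ε₀ * ν ^ (1 / 2 : ℝ) * (k : ℝ) ^ (1 / 2 : ℝ) * Phi α₀ β₀ γ₀ ν k ω ψ
    + α₀ * ν ^ (3 / 2 : ℝ) / (2 * (k : ℝ) ^ (1 / 2 : ℝ)) * normSq (lap ω)
    + γ₀ * ν ^ (1 / 2 : ℝ) / (k : ℝ) ^ (3 / 2 : ℝ) *
        (7 / 8 * (normSq (mulY (dX (dX ω))) + normSq (mulY (dX (dY ω)))) + normSq (dX ω))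

/-- All the norms in `Φ_k` and in the differential inequality are finite. -/
def FiniteNorms (ω ψ : ℝ × ℝ → ℝ) : Prop :=
  MemH2 ω ∧ MemH2 ψ ∧ MemLp (mulY (dX ω)) 2 cyl ∧
    MemLp (mulY (dX (dX ω))) 2 cyl ∧ MemLp (mulY (dX (dY ω))) 2 cyl

end Poiseuille

end

open Poiseuille

/-!
A solution of frequency `± k` is `ω = Re (a(t, y) exp(i k x))` with `a(t) ∈ L²(ℝ; ℂ)`, and the
vorticity equation becomes `a' = L a := ν (∂² - k²) a - i k y² a + 2 i k φ` with `φ'' - k² φ = a`.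
Up to the factor `π / 2` the functional `Φ_k` is a quadratic form `⟨P a, a⟩` of the amplitude, where
`P` is again a differential operator (`ampP`). Three facts carry the proof.

* **The algebra.** Integration by parts evaluates `⟨P a, L a⟩` for `a` in the domain of `L`
  (`inner_ampP_ampL`). The transport terms cancel in the part `‖y ∂ₓ ω‖² + 2 ‖∇∂ₓ ψ‖²` of the energy,
  and the mixed term produces the missing dissipation `- k (‖y a‖² + 2 ‖φ'‖²)`. The remaining terms
  are absorbed by `‖a‖² ≤ 2 ‖y a‖ ‖a'‖`, by the virial identity
  `2 ⟨y a, φ'⟩ = k² ‖φ‖² - ‖φ'‖²` and by Young's inequality (`amp_differential_inequality`), with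
  `ε₀ = 1/20`, `α₀ = 1/10`, `β₀ = 1/50`, `γ₀ = 32/125`.

* **Differentiability of the form.** No regularity of `t ↦ a(t)` is known beyond `a' = L a` in `L²`.
  Since `P` is symmetric, the difference quotient of `⟨P u, u⟩` at `t` is the pairing of
  `P u(s) + P u(t)` with the difference quotient of `u`; the former converges weakly, because
  `‖P u‖` is bounded by the graph norm of `L`, and `‖L u‖` does not grow, as `L` is dissipative. At the
  initial time one needs moreover that `u` is differentiable there once `u(0)` is in the domain. This
  is carried out for abstract pairs of operators (`IsHypocoercive`).

* **Decay from data of finite energy.** The form is not known to be continuous at `t = 0`. The average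
  `μ⁻¹ ∫_t^∞ e^{(t - r) / μ} u(r) dr` is a solution and equals `(1 - μ L)⁻¹ u(t)`. Dissipation bounds
  the form on such resolvents by its value on `u(t)`, which allows first `t → 0` and then `μ → 0`
  (`form_decay_initial`).

The operators satisfy the abstract assumptions (`isHypocoercive_ampGraph`): a bound of the graph norm
controls `a''` and `y² a` separately, since their cross term is of lower order (`graph_bound`), and
hence also `y a'`. Finally, weak derivatives and norms on the cylinder are expressed through the
amplitude. Weak derivatives are unique because a function in `L²` is determined by its Fourier
coefficients in `x` (`eq_zero_of_coeffMap`), and the stream function inherits the frequency of the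
vorticity because `φ'' = l² φ` has no square integrable solution but zero.
-/

open MeasureTheory Set
noncomputable section

namespace Poiseuille

open Filter Topology
open scoped RealInnerProductSpace

/-! ### Hypocoercive pairs of operators -/

section Abstract

variable {H : Type*} [NormedAddCommGroup H] [InnerProductSpace ℝ H]

/-- The graph `R` of a pair of operators `a ↦ (L a, P a)` on a real Hilbert space for which the
flow of `u' = L u` is a contraction and the symmetric quadratic form `⟨P a, a⟩ ≥ 0` is a Lyapunov
function with rate `κ`. The triples of `R` are `(a, L a, P a)` with `a` in the common domain;
`dense` provides formal adjoints on a dense set, and `regular` says that sets bounded in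
the graph norm of `L` have their closed convex hull inside the domain. -/
structure IsHypocoercive (R : Submodule ℝ (H × H × H)) (κ : ℝ) : Prop where
  dissipative : ∀ a l p, (a, l, p) ∈ R → ⟪a, l⟫ ≤ 0
  symmetric : ∀ a l p a' l' p', (a, l, p) ∈ R → (a', l', p') ∈ R → ⟪p, a'⟫ = ⟪a, p'⟫
  bound : ∃ C : ℝ, 0 ≤ C ∧ ∀ a l p, (a, l, p) ∈ R → ‖p‖ ≤ C * (‖l‖ + ‖a‖)
  decay : ∀ a l p, (a, l, p) ∈ R → 2 * ⟪p, l⟫ ≤ -κ * ⟪p, a⟫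
  nonneg : ∀ a l p, (a, l, p) ∈ R → 0 ≤ ⟪p, a⟫
  dense : Dense {χ : H | ∃ χL χP : H, ∀ a l p, (a, l, p) ∈ R →
    ⟪l, χ⟫ = ⟪a, χL⟫ ∧ ⟪p, χ⟫ = ⟪a, χP⟫}
  regular : ∀ C : ℝ, ∃ K : Set H, IsClosed K ∧ Convex ℝ K ∧
    (∀ a l p, (a, l, p) ∈ R → ‖a‖ ≤ C → ‖l‖ ≤ C → a ∈ K) ∧ ∀ a ∈ K, ∃ l p, (a, l, p) ∈ R

/-- A bounded family that converges weakly against a dense set converges weakly, and its pairing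
with a strongly convergent family converges. -/
lemma tendsto_inner_of_dense {ι : Type*} {F : Filter ι} {T : Set H} (hT : Dense T)
    {q z : ι → H} {q₀ z₀ : H} {C : ℝ} (hC : ∀ᶠ i in F, ‖q i‖ ≤ C)
    (hq : ∀ χ ∈ T, Tendsto (fun i => ⟪q i, χ⟫) F (𝓝 ⟪q₀, χ⟫)) (hz : Tendsto z F (𝓝 z₀)) :
    Tendsto (fun i => ⟪q i, z i⟫) F (𝓝 ⟪q₀, z₀⟫) := by
  rw [Metric.tendsto_nhds]
  intro ε hε
  set M : ℝ := |C| + ‖q₀‖ + 1 with hM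
  have hMpos : 0 < M := by positivity
  obtain ⟨χ, hχT, hχ⟩ := hT.exists_dist_lt z₀ (show 0 < ε / (4 * M) by positivity)
  have hz' := (Metric.tendsto_nhds.1 hz) (ε / (4 * M)) (by positivity)
  have hq' := (Metric.tendsto_nhds.1 (hq χ hχT)) (ε / 4) (by positivity)
  filter_upwards [hC, hz', hq'] with i h1 h2 h3
  rw [dist_eq_norm] at h2 hχ
  rw [Real.dist_eq] at h3 ⊢
  have e : ⟪q i, z i⟫ - ⟪q₀, z₀⟫
      = ⟪q i, z i - z₀⟫ + ⟪q i, z₀ - χ⟫ + (⟪q i, χ⟫ - ⟪q₀, χ⟫) - ⟪q₀, z₀ - χ⟫ := by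
    simp only [inner_sub_right]; ring
  have b1 := abs_real_inner_le_norm (q i) (z i - z₀)
  have b2 := abs_real_inner_le_norm (q i) (z₀ - χ)
  have b3 := abs_real_inner_le_norm q₀ (z₀ - χ)
  have hqi : ‖q i‖ + ‖q₀‖ ≤ M := by linarith [le_abs_self C]
  have hqi' : ‖q i‖ ≤ M := by linarith [norm_nonneg q₀]
  have c1 : ‖q i‖ * ‖z i - z₀‖ ≤ M * (ε / (4 * M)) := by gcongr
  have c2 : (‖q i‖ + ‖q₀‖) * ‖z₀ - χ‖ ≤ M * (ε / (4 * M)) := by gcongr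
  have c3 : M * (ε / (4 * M)) = ε / 4 := by field_simp
  rw [e]
  rw [abs_lt]
  rw [abs_le] at b1 b2 b3
  rw [abs_lt] at h3
  constructor <;> nlinarith

namespace IsHypocoercive

variable {R : Submodule ℝ (H × H × H)} {κ : ℝ}

/-- `u` solves `u' = L u` for positive times. -/
def Solves (R : Submodule ℝ (H × H × H)) (u : ℝ → H) : Prop :=
  ∀ t, 0 < t → ∃ l p, (u t, l, p) ∈ R ∧ HasDerivAt u l t

lemma Solves.continuousOn {u : ℝ → H} (hu : Solves R u) : ContinuousOn u (Ioi 0) := fun t ht => by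
  obtain ⟨l, p, -, h⟩ := hu t ht
  exact h.continuousAt.continuousWithinAt

/-- On a convex set of times meeting `(0, ∞)` up to its boundary, the norm of a solution does not
increase. -/
lemma norm_antitoneOn (hR : IsHypocoercive R κ) {u : ℝ → H} (hu : Solves R u) {S : Set ℝ}
    (hS : Convex ℝ S) (hSi : interior S ⊆ Ioi 0) (hc : ContinuousOn u S) :
    AntitoneOn (fun t => ‖u t‖) S := by
  have key : AntitoneOn (fun t => ‖u t‖ ^ 2) S := by
    refine antitoneOn_of_deriv_nonpos hS (hc.norm.pow 2) ?_ ?_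
    · intro t ht
      obtain ⟨l, p, -, h⟩ := hu t (hSi ht)
      exact h.norm_sq.differentiableAt.differentiableWithinAt
    · intro t ht
      obtain ⟨l, p, hm, h⟩ := hu t (hSi ht)
      rw [h.norm_sq.deriv]
      linarith [hR.dissipative _ _ _ hm]
  intro s hs t ht hst
  exact (abs_le_of_sq_le_sq' (key hs ht hst) (norm_nonneg _)).2

lemma Solves.translate_sub {u : ℝ → H} (hu : Solves R u) {h : ℝ} (hh : 0 ≤ h) :
    Solves R (fun t => u (t + h) - u t) := by
  intro t ht
  obtain ⟨l, p, hm, hd⟩ := hu t ht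
  obtain ⟨l', p', hm', hd'⟩ := hu (t + h) (by linarith)
  refine ⟨l' - l, p' - p, by simpa using R.sub_mem hm' hm, ?_⟩
  exact (hd'.comp_add_const t h).sub hd

/-- The speed of a solution does not increase: compare it with its translates in time. -/
lemma norm_deriv_le (hR : IsHypocoercive R κ) {u : ℝ → H} (hu : Solves R u) {s t : ℝ} (hs : 0 < s)
    (hst : s ≤ t) {l l' : H} (hl : HasDerivAt u l s) (hl' : HasDerivAt u l' t) :
    ‖l'‖ ≤ ‖l‖ := by
  have h1 : ∀ r l, HasDerivAt u l r → Tendsto (fun h : ℝ => ‖h⁻¹ • (u (r + h) - u r)‖) (𝓝[>] 0)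
      (𝓝 ‖l‖) := by
    intro r l hl
    exact (hl.tendsto_slope_zero_right).norm
  refine le_of_tendsto_of_tendsto (h1 t l' hl') (h1 s l hl) ?_
  filter_upwards [self_mem_nhdsWithin] with h hh
  have hv := hu.translate_sub (le_of_lt hh)
  have := hR.norm_antitoneOn hv (convex_Ioi 0) (by simp) hv.continuousOn hs
    (lt_of_lt_of_le hs hst) hst
  rw [norm_smul, norm_smul]
  gcongr

/-- Starting in the domain, a solution leaves its initial value at most at the initial speed. -/
lemma norm_sub_initial_le (hR : IsHypocoercive R κ) {u : ℝ → H} (hu : Solves R u)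
    (hc : ContinuousOn u (Ici 0)) {l p : H} (h0 : (u 0, l, p) ∈ R) {h : ℝ} (hh : 0 ≤ h) :
    ‖u h - u 0‖ ≤ h * ‖l‖ := by
  -- The norm is not differentiable at `0`; regularise it as `√(‖·‖² + η²)`.
  have key : ∀ η : ℝ, 0 < η → ‖u h - u 0‖ ≤ h * ‖l‖ + η := by
    intro η hη
    have hpos : ∀ t, 0 < ‖u t - u 0‖ ^ 2 + η ^ 2 := fun t => by positivity
    have hd : ∀ t, 0 < t → ∃ D, HasDerivAt (fun t => √(‖u t - u 0‖ ^ 2 + η ^ 2)) D t ∧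
        D ≤ ‖l‖ := by
      intro t ht
      obtain ⟨l', p', hm, hd⟩ := hu t ht
      have h2 := (((hd.sub_const (u 0)).norm_sq).add_const (η ^ 2)).sqrt (hpos t).ne'
      refine ⟨_, h2, ?_⟩
      have h3 := hR.dissipative _ _ _ (R.sub_mem hm h0)
      simp only [inner_sub_right] at h3
      have h4 : ⟪u t - u 0, l⟫ ≤ ‖u t - u 0‖ * ‖l‖ := real_inner_le_norm _ _
      have h5 : ‖u t - u 0‖ ≤ √(‖u t - u 0‖ ^ 2 + η ^ 2) :=
        Real.le_sqrt_of_sq_le (by nlinarith)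
      rw [div_le_iff₀ (by have := Real.sqrt_pos.2 (hpos t); positivity)]
      have h6 := mul_le_mul_of_nonneg_right h5 (norm_nonneg l)
      linarith
    have := Convex.image_sub_le_mul_sub_of_deriv_le (convex_Ici (0 : ℝ))
      (f := fun t => √(‖u t - u 0‖ ^ 2 + η ^ 2)) (C := ‖l‖) ?_ ?_ ?_ 0 self_mem_Ici h hh hh
    · simp only [sub_self, norm_zero] at this
      have h5 : ‖u h - u 0‖ ≤ √(‖u h - u 0‖ ^ 2 + η ^ 2) :=
        Real.le_sqrt_of_sq_le (by nlinarith)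
      have h6 : √((0 : ℝ) ^ 2 + η ^ 2) = η := by
        rw [zero_pow two_ne_zero, zero_add, Real.sqrt_sq hη.le]
      rw [h6] at this
      linarith
    · exact ((((hc.sub continuousOn_const).norm.pow 2).add continuousOn_const)).sqrt
    · intro t ht
      rw [interior_Ici] at ht
      obtain ⟨D, hD, -⟩ := hd t ht
      exact hD.differentiableAt.differentiableWithinAt
    · intro t ht
      rw [interior_Ici] at ht
      obtain ⟨D, hD, hD'⟩ := hd t ht
      rwa [hD.deriv]
  exact le_of_forall_pos_le_add key

lemma norm_deriv_le_initial (hR : IsHypocoercive R κ) {u : ℝ → H} (hu : Solves R u)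
    (hc : ContinuousOn u (Ici 0)) {l p : H} (h0 : (u 0, l, p) ∈ R) {t : ℝ} (ht : 0 < t) {l' : H}
    (hl' : HasDerivAt u l' t) : ‖l'‖ ≤ ‖l‖ := by
  refine le_of_tendsto (hl'.tendsto_slope_zero_right).norm ?_
  filter_upwards [self_mem_nhdsWithin] with h hh
  have hh' : (0 : ℝ) < h := hh
  have hv := hu.translate_sub hh'.le
  have hcv : ContinuousOn (fun t => u (t + h) - u t) (Ici 0) := by
    refine ContinuousOn.sub (hc.comp (by fun_prop) ?_) hc
    intro x hx
    simp only [mem_Ici] at hx ⊢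
    linarith
  have h1 := hR.norm_antitoneOn hv (convex_Ici 0) (by simp) hcv self_mem_Ici ht.le ht.le
  have h2 := hR.norm_sub_initial_le hu hc h0 hh'.le
  simp only [zero_add] at h1
  rw [norm_smul, norm_inv, Real.norm_of_nonneg hh'.le, inv_mul_le_iff₀ hh']
  linarith

/-- A solution that starts in the domain is differentiable at time `0`: the difference quotients
converge weakly, and their norms do not exceed the norm of the weak limit. -/
lemma hasDerivWithinAt_zero (hR : IsHypocoercive R κ) {u : ℝ → H} (hu : Solves R u)
    (hc : ContinuousOn u (Ici 0)) {l p : H} (h0 : (u 0, l, p) ∈ R) :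
    HasDerivWithinAt u l (Ici 0) 0 := by
  rw [hasDerivWithinAt_iff_tendsto_slope]
  have hset : Ici (0 : ℝ) \ {0} = Ioi 0 := by ext x; simp [lt_iff_le_and_ne, eq_comm]
  rw [hset]
  have hbd : ∀ᶠ h in 𝓝[>] (0 : ℝ), ‖slope u 0 h‖ ≤ ‖l‖ := by
    filter_upwards [self_mem_nhdsWithin] with h hh
    have hh' : (0 : ℝ) < h := hh
    have h2 := hR.norm_sub_initial_le hu hc h0 hh'.le
    rw [slope_def_module, sub_zero, norm_smul, norm_inv, Real.norm_of_nonneg hh'.le,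
      inv_mul_le_iff₀ hh']
    exact h2
  have hweak : Tendsto (fun h => ⟪slope u 0 h, l⟫) (𝓝[>] 0) (𝓝 ⟪l, l⟫) := by
    refine tendsto_inner_of_dense hR.dense hbd ?_ tendsto_const_nhds
    rintro χ ⟨χL, χP, hχ⟩
    have hder : HasDerivWithinAt (fun t => ⟪u t, χ⟫) ⟪l, χ⟫ (Ici 0) 0 := by
      refine hasDerivWithinAt_Ici_of_tendsto_deriv (s := Ioi 0) ?_ ?_ self_mem_nhdsWithin ?_
      · intro t ht
        obtain ⟨l', p', hm, hd⟩ := hu t ht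
        exact (hd.inner ℝ (hasDerivAt_const t χ)).differentiableAt.differentiableWithinAt
      · exact ((hc 0 self_mem_Ici).mono Ioi_subset_Ici_self).inner continuousWithinAt_const
      · have : Tendsto (fun t => ⟪u t, χL⟫) (𝓝[>] 0) (𝓝 ⟪u 0, χL⟫) :=
          ((hc 0 self_mem_Ici).mono Ioi_subset_Ici_self).inner continuousWithinAt_const
        rw [(hχ _ _ _ h0).1]
        refine this.congr' ?_
        filter_upwards [self_mem_nhdsWithin] with t ht
        obtain ⟨l', p', hm, hd⟩ := hu t ht
        rw [(hd.inner ℝ (hasDerivAt_const t χ)).deriv, inner_zero_right, zero_add, (hχ _ _ _ hm).1]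
    rw [hasDerivWithinAt_iff_tendsto_slope, hset] at hder
    refine hder.congr fun h => ?_
    simp [slope_def_module, inner_smul_left, inner_sub_left]
  rw [tendsto_iff_norm_sub_tendsto_zero]
  have hsq : Tendsto (fun h => ‖slope u 0 h - l‖ ^ 2) (𝓝[>] 0) (𝓝 0) := by
    have hlim : Tendsto (fun h => 2 * ‖l‖ ^ 2 - 2 * ⟪slope u 0 h, l⟫) (𝓝[>] 0) (𝓝 0) := by
      have := (hweak.const_mul 2).const_sub (2 * ‖l‖ ^ 2)
      rwa [real_inner_self_eq_norm_sq, sub_self] at this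
    refine squeeze_zero' (Eventually.of_forall fun _ => by positivity) ?_ hlim
    filter_upwards [hbd] with h hh
    rw [norm_sub_sq_real]
    have := pow_le_pow_left₀ (norm_nonneg _) hh 2
    linarith
  have := hsq.sqrt
  simpa [Real.sqrt_sq] using this

/-- The Lyapunov form is differentiable along a curve in the domain whose images under `P` stay
bounded: by symmetry its increments only involve the sum of two values of `P u`. -/
lemma hasDerivWithinAt_form (hR : IsHypocoercive R κ) {u : ℝ → H} {S : Set ℝ} {t : ℝ} {l lt pt : H}
    (hd : HasDerivWithinAt u l S t) (ht : (u t, lt, pt) ∈ R) {C : ℝ}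
    (hC : ∀ᶠ s in 𝓝[S] t, ∃ l p, (u s, l, p) ∈ R ∧ ‖l‖ ≤ C)
    {Ψ : ℝ → ℝ} (hΨ : ∀ᶠ s in 𝓝[S] t, ∀ l p, (u s, l, p) ∈ R → Ψ s = ⟪p, u s⟫)
    (hΨt : Ψ t = ⟪pt, u t⟫) :
    HasDerivWithinAt Ψ (2 * ⟪pt, l⟫) S t := by
  classical
  obtain ⟨C', hC'0, hC'⟩ := hR.bound
  have hev : ∀ᶠ s in 𝓝[S \ {t}] t, ∃ p, (∃ l, (u s, l, p) ∈ R ∧ ‖l‖ ≤ C) ∧ Ψ s = ⟪p, u s⟫ := by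
    filter_upwards [nhdsWithin_mono t sdiff_subset hC, nhdsWithin_mono t sdiff_subset hΨ] with s h1 h2
    obtain ⟨l, p, hm, hl⟩ := h1
    exact ⟨p, ⟨l, hm, hl⟩, h2 l p hm⟩
  obtain ⟨q, hq⟩ : ∃ q : ℝ → H, ∀ᶠ s in 𝓝[S \ {t}] t,
      (∃ l, (u s, l, q s) ∈ R ∧ ‖l‖ ≤ C) ∧ Ψ s = ⟪q s, u s⟫ := by
    refine ⟨fun s => if h : ∃ p, (∃ l, (u s, l, p) ∈ R ∧ ‖l‖ ≤ C) ∧ Ψ s = ⟪p, u s⟫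
      then h.choose else 0, ?_⟩
    filter_upwards [hev] with s hs
    rw [dif_pos hs]
    exact hs.choose_spec
  have hcont : Tendsto u (𝓝[S \ {t}] t) (𝓝 (u t)) :=
    (hd.continuousWithinAt.mono sdiff_subset)
  have hbu : ∀ᶠ s in 𝓝[S \ {t}] t, ‖u s‖ ≤ ‖u t‖ + 1 := by
    have := hcont.norm
    filter_upwards [this.eventually (Iio_mem_nhds (show ‖u t‖ < ‖u t‖ + 1 by linarith))] with s hs
    exact (mem_Iio.1 hs).le
  rw [hasDerivWithinAt_iff_tendsto_slope] at hd ⊢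
  have h1 : Tendsto (fun s => ⟪q s, slope u t s⟫) (𝓝[S \ {t}] t) (𝓝 ⟪pt, l⟫) := by
    refine tendsto_inner_of_dense hR.dense (C := C' * (C + (‖u t‖ + 1))) ?_ ?_ hd
    · filter_upwards [hq, hbu] with s hs hs'
      obtain ⟨⟨l, hm, hl⟩, -⟩ := hs
      refine (hC' _ _ _ hm).trans ?_
      gcongr
    · rintro χ ⟨χL, χP, hχ⟩
      rw [(hχ _ _ _ ht).2]
      refine (hcont.inner tendsto_const_nhds : Tendsto (fun s => ⟪u s, χP⟫) _ _).congr' ?_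
      filter_upwards [hq] with s hs
      obtain ⟨⟨l, hm, hl⟩, -⟩ := hs
      rw [(hχ _ _ _ hm).2]
  have h2 : Tendsto (fun s => ⟪pt, slope u t s⟫) (𝓝[S \ {t}] t) (𝓝 ⟪pt, l⟫) :=
    tendsto_const_nhds.inner hd
  have h3 := h1.add h2
  rw [← two_mul] at h3
  refine h3.congr' ?_
  filter_upwards [hq] with s hs
  obtain ⟨⟨l', hm, hl⟩, hs2⟩ := hs
  have hsym := hR.symmetric _ _ _ _ _ _ ht hm
  rw [slope_def_module, slope_def_field, hs2, hΨt]
  simp only [inner_smul_right, inner_sub_right]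
  rw [hsym, real_inner_comm (u t) (q s)]
  ring

lemma hasDerivAt_form (hR : IsHypocoercive R κ) {u : ℝ → H} (hu : Solves R u) {t : ℝ} (ht : 0 < t)
    {l p : H} (hm : (u t, l, p) ∈ R) (hl : HasDerivAt u l t) {Ψ : ℝ → ℝ}
    (hΨ : ∀ s, 0 < s → ∀ l p, (u s, l, p) ∈ R → Ψ s = ⟪p, u s⟫) :
    HasDerivAt Ψ (2 * ⟪p, l⟫) t := by
  rw [← hasDerivWithinAt_univ] at hl ⊢
  obtain ⟨l₁, p₁, -, hd₁⟩ := hu (t / 2) (by linarith)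
  refine hR.hasDerivWithinAt_form hl hm (C := ‖l₁‖) ?_ ?_ (hΨ t ht _ _ hm)
  · rw [nhdsWithin_univ]
    filter_upwards [Ioi_mem_nhds (show t / 2 < t by linarith)] with s hs
    obtain ⟨l₂, p₂, hm₂, hd₂⟩ := hu s (lt_trans (by linarith) hs)
    exact ⟨l₂, p₂, hm₂, hR.norm_deriv_le hu (by linarith) (le_of_lt hs) hd₁ hd₂⟩
  · rw [nhdsWithin_univ]
    filter_upwards [Ioi_mem_nhds ht] with s hs
    exact hΨ s hs

lemma hasDerivWithinAt_form_zero (hR : IsHypocoercive R κ) {u : ℝ → H} (hu : Solves R u)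
    (hc : ContinuousOn u (Ici 0)) {l p : H} (h0 : (u 0, l, p) ∈ R) {Ψ : ℝ → ℝ}
    (hΨ : ∀ s, 0 ≤ s → ∀ l p, (u s, l, p) ∈ R → Ψ s = ⟪p, u s⟫) :
    HasDerivWithinAt Ψ (2 * ⟪p, l⟫) (Ici 0) 0 := by
  refine hR.hasDerivWithinAt_form (hR.hasDerivWithinAt_zero hu hc h0) h0 (C := ‖l‖) ?_ ?_
    (hΨ 0 le_rfl _ _ h0)
  · filter_upwards [self_mem_nhdsWithin] with s hs
    rcases (mem_Ici.1 hs).eq_or_lt with rfl | hs'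
    · exact ⟨l, p, h0, le_rfl⟩
    · obtain ⟨l₂, p₂, hm₂, hd₂⟩ := hu s hs'
      exact ⟨l₂, p₂, hm₂, hR.norm_deriv_le_initial hu hc h0 hs' hd₂⟩
  · filter_upwards [self_mem_nhdsWithin] with s hs
    exact hΨ s hs

lemma form_decay (hR : IsHypocoercive R κ) {u : ℝ → H} (hu : Solves R u) {s t : ℝ} (hs : 0 < s)
    (hst : s ≤ t) {ls ps lt pt : H} (hms : (u s, ls, ps) ∈ R) (hmt : (u t, lt, pt) ∈ R) :
    ⟪pt, u t⟫ ≤ Real.exp (-(κ * (t - s))) * ⟪ps, u s⟫ := by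
  choose! l p hm hd using hu
  have huS : Solves R u := fun t ht => ⟨l t, p t, hm t ht, hd t ht⟩
  have hval : ∀ r, 0 < r → ∀ l' p', (u r, l', p') ∈ R → ⟪p r, u r⟫ = ⟪p', u r⟫ := by
    intro r hr l' p' h'
    rw [hR.symmetric _ _ _ _ _ _ (hm r hr) h', real_inner_comm]
  have hder : ∀ r, 0 < r → HasDerivAt (fun r => ⟪p r, u r⟫) (2 * ⟪p r, l r⟫) r := fun r hr =>
    hR.hasDerivAt_form huS hr (hm r hr) (hd r hr) hval
  have hder' : ∀ r, 0 < r → HasDerivAt (fun r => Real.exp (κ * r) * ⟪p r, u r⟫)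
      (Real.exp (κ * r) * (κ * 1) * ⟪p r, u r⟫ + Real.exp (κ * r) * (2 * ⟪p r, l r⟫)) r :=
    fun r hr => ((((hasDerivAt_id r).const_mul κ).exp).mul (hder r hr))
  have hanti : AntitoneOn (fun r => Real.exp (κ * r) * ⟪p r, u r⟫) (Ioi 0) := by
    refine antitoneOn_of_deriv_nonpos (convex_Ioi 0)
      (fun r hr => (hder' r hr).continuousAt.continuousWithinAt) ?_ ?_
    · intro r hr
      rw [interior_Ioi] at hr
      exact (hder' r hr).differentiableAt.differentiableWithinAt
    · intro r hr
      rw [interior_Ioi] at hr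
      rw [(hder' r hr).deriv]
      have h1 := hR.decay _ _ _ (hm r hr)
      have h2 := mul_le_mul_of_nonneg_left h1 (Real.exp_pos (κ * r)).le
      linarith
  have ht : 0 < t := lt_of_lt_of_le hs hst
  have := hanti hs ht hst
  simp only at this
  rw [hval t ht _ _ hmt, hval s hs _ _ hms] at this
  have e : Real.exp (-(κ * (t - s))) = Real.exp (-(κ * t)) * Real.exp (κ * s) := by
    rw [← Real.exp_add]; ring_nf
  rw [e, mul_assoc]
  have h3 := mul_le_mul_of_nonneg_left this (Real.exp_pos (-(κ * t))).le
  rwa [← mul_assoc, ← Real.exp_add, neg_add_cancel, Real.exp_zero, one_mul] at h3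

end IsHypocoercive
end Abstract

/-! ### Resolvents and decay from data of finite energy -/

namespace IsHypocoercive

variable {H : Type*} [NormedAddCommGroup H] [InnerProductSpace ℝ H]

section LaplaceAverage

/-- The exponential average `μ⁻¹ ∫_t^∞ e^{(t - r) / μ} u(r) dr` of a curve. For a solution of
`u' = L u` it is the resolvent `(1 - μ L)⁻¹` applied to `u t`. -/
def laplaceAverage (μ : ℝ) (u : ℝ → H) (t : ℝ) : H :=
  (μ⁻¹ * Real.exp (t / μ)) • ∫ r in Ioi t, Real.exp (-(r / μ)) • u r

variable {μ : ℝ} {u : ℝ → H} {t M : ℝ}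

lemma integrableOn_exp_smul (hμ : 0 < μ) (ht : 0 < t) (hu : ContinuousOn u (Ioi 0))
    (hM : ∀ r, 0 < r → ‖u r‖ ≤ M) :
    IntegrableOn (fun r => Real.exp (-(r / μ)) • u r) (Ioi t) := by
  have h1 : IntegrableOn (fun r => Real.exp (-μ⁻¹ * r)) (Ioi t) :=
    integrableOn_exp_mul_Ioi (by simpa using hμ) t
  refine Integrable.mono' (h1.const_mul M) ?_ ?_
  · refine ContinuousOn.aestronglyMeasurable ?_ measurableSet_Ioi
    exact ContinuousOn.smul (by fun_prop) (hu.mono (Ioi_subset_Ioi ht.le))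
  · refine (ae_restrict_iff' measurableSet_Ioi).2 (Eventually.of_forall fun r hr => ?_)
    rw [norm_smul, Real.norm_of_nonneg (Real.exp_pos _).le, mul_comm]
    have : -(r / μ) = -μ⁻¹ * r := by ring
    rw [this]
    exact mul_le_mul_of_nonneg_right (hM r (lt_trans ht hr)) (Real.exp_pos _).le

lemma integral_exp_Ioi (hμ : 0 < μ) :
    (μ⁻¹ * Real.exp (t / μ)) * ∫ r in Ioi t, Real.exp (-(r / μ)) = 1 := by
  have : ∀ r, Real.exp (-(r / μ)) = Real.exp (-μ⁻¹ * r) := fun r => by ring_nf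
  simp_rw [this]
  rw [integral_exp_mul_Ioi (by simpa using hμ) t]
  have e : -μ⁻¹ * t = -(t / μ) := by ring
  rw [e, Real.exp_neg]
  field_simp

variable [CompleteSpace H]

lemma hasDerivAt_laplaceAverage (hμ : 0 < μ) (ht : 0 < t) (hu : ContinuousOn u (Ioi 0))
    (hM : ∀ r, 0 < r → ‖u r‖ ≤ M) :
    HasDerivAt (laplaceAverage μ u) (μ⁻¹ • (laplaceAverage μ u t - u t)) t := by
  set f : ℝ → H := fun r => Real.exp (-(r / μ)) • u r with hf
  have hfc : ContinuousOn f (Ioi 0) := ContinuousOn.smul (by fun_prop) hu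
  have ht2 : 0 < t / 2 := by linarith
  have hint := integrableOn_exp_smul hμ ht2 hu hM
  have h1 : HasDerivAt (fun s => ∫ r in Ioi s, f r) (-(f t)) t := by
    have h2 : HasDerivAt (fun s => (∫ r in Ioi (t / 2), f r) - ∫ r in (t / 2)..s, f r)
        (0 - f t) t := by
      refine (hasDerivAt_const _ _).sub ?_
      refine intervalIntegral.integral_hasDerivAt_right ?_ ?_ (hfc.continuousAt (Ioi_mem_nhds ht))
      · rw [intervalIntegrable_iff_integrableOn_Ioc_of_le (by linarith)]
        exact hint.mono_set Ioc_subset_Ioi_self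
      · exact hfc.stronglyMeasurableAtFilter isOpen_Ioi t ht
    rw [zero_sub] at h2
    refine h2.congr_of_eventuallyEq ?_
    filter_upwards [Ioi_mem_nhds (show t / 2 < t by linarith)] with s hs
    have hs' : t / 2 ≤ s := le_of_lt hs
    rw [intervalIntegral.integral_of_le hs', eq_sub_iff_add_eq, add_comm,
      ← setIntegral_union (Ioc_disjoint_Ioi le_rfl) measurableSet_Ioi
        (hint.mono_set Ioc_subset_Ioi_self) (hint.mono_set (Ioi_subset_Ioi hs')),
      Ioc_union_Ioi_eq_Ioi hs']
  have h3 : HasDerivAt (fun s => μ⁻¹ * Real.exp (s / μ)) (μ⁻¹ * (Real.exp (t / μ) * (1 / μ))) t :=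
    (((hasDerivAt_id t).div_const μ).exp).const_mul _
  refine (h3.smul h1).congr_deriv ?_
  have e : (μ⁻¹ * Real.exp (t / μ)) • -(f t) = -(μ⁻¹ • u t) := by
    rw [hf]
    simp only [smul_neg, smul_smul]
    rw [mul_assoc, ← Real.exp_add]
    simp
  rw [e, laplaceAverage, smul_sub, smul_smul, ← hf, one_div]
  rw [neg_add_eq_sub]
  congr 2
  ring

lemma laplaceAverage_mem (hμ : 0 < μ) (ht : 0 < t) (hu : ContinuousOn u (Ioi 0))
    (hM : ∀ r, 0 < r → ‖u r‖ ≤ M) {K : Set H} (hK : IsClosed K) (hKc : Convex ℝ K)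
    (huK : ∀ r, t < r → u r ∈ K) : laplaceAverage μ u t ∈ K := by
  set w : ℝ → ℝ := fun r => μ⁻¹ * Real.exp (t / μ) * Real.exp (-(r / μ)) with hw
  have hw0 : ∀ r, 0 ≤ w r := fun r => by positivity
  have hwm : Measurable fun r => (w r).toNNReal := by fun_prop
  have hwi : IntegrableOn w (Ioi t) := by
    have h1 : IntegrableOn (fun r => Real.exp (-μ⁻¹ * r)) (Ioi t) :=
      integrableOn_exp_mul_Ioi (by simpa using hμ) t
    have := h1.const_mul (μ⁻¹ * Real.exp (t / μ))
    refine this.congr (Eventually.of_forall fun r => ?_)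
    simp only [hw]
    congr 2; ring
  let m : Measure ℝ := (volume.restrict (Ioi t)).withDensity fun r => ((w r).toNNReal : ENNReal)
  have hcoe : ∀ r, (w r).toNNReal • u r = (μ⁻¹ * Real.exp (t / μ)) • Real.exp (-(r / μ)) • u r := by
    intro r
    rw [NNReal.smul_def, Real.coe_toNNReal _ (hw0 r), smul_smul]
  have hm : IsProbabilityMeasure m := by
    constructor
    rw [withDensity_apply _ MeasurableSet.univ, Measure.restrict_univ]
    have h2 := ofReal_integral_eq_lintegral_ofReal hwi (Eventually.of_forall hw0)
    have h3 : ∫ r in Ioi t, w r = 1 := by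
      rw [← integral_exp_Ioi (t := t) hμ, ← integral_const_mul]
    rw [h3, ENNReal.ofReal_one] at h2
    exact h2.symm
  have hval : laplaceAverage μ u t = ∫ r, u r ∂m := by
    rw [integral_withDensity_eq_integral_smul hwm, laplaceAverage, ← integral_smul]
    exact integral_congr_ae (Eventually.of_forall fun r => (hcoe r).symm)
  rw [hval]
  refine hKc.integral_mem hK ?_ ?_
  · refine (withDensity_absolutelyContinuous _ _).ae_le ?_
    exact (ae_restrict_iff' measurableSet_Ioi).2 (Eventually.of_forall huK)
  · rw [integrable_withDensity_iff_integrable_smul hwm]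
    refine Integrable.congr ((integrableOn_exp_smul hμ ht hu hM).smul (μ⁻¹ * Real.exp (t / μ))) ?_
    exact Eventually.of_forall fun r => (hcoe r).symm

end LaplaceAverage

variable {R : Submodule ℝ (H × H × H)} {κ : ℝ} [CompleteSpace H]

/-- The exponential average of a solution is a solution, and it is the resolvent of `L`
applied to the original one. -/
lemma laplaceAverage_resolvent (hR : IsHypocoercive R κ) {u : ℝ → H} (hu : Solves R u) {M : ℝ}
    (hM : ∀ r, 0 < r → ‖u r‖ ≤ M) {μ t : ℝ} (hμ : 0 < μ) (ht : 0 < t) {l₀ : H}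
    (hl₀ : HasDerivAt u l₀ t) :
    ∃ p, (laplaceAverage μ u t, μ⁻¹ • (laplaceAverage μ u t - u t), p) ∈ R ∧
      ‖laplaceAverage μ u t‖ ≤ M ∧ ‖laplaceAverage μ u t - u t‖ ≤ μ * ‖l₀‖ := by
  have huc := hu.continuousOn
  obtain ⟨K, hKc, hKv, hK1, hK2⟩ := hR.regular (max M ‖l₀‖)
  have hsp : ∀ r, t < r → ∃ l p, (u r, l, p) ∈ R ∧ HasDerivAt u l r ∧ ‖l‖ ≤ ‖l₀‖ := by
    intro r hr
    obtain ⟨l, p, hm, hd⟩ := hu r (lt_trans ht hr)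
    exact ⟨l, p, hm, hd, hR.norm_deriv_le hu ht hr.le hl₀ hd⟩
  have hUK : laplaceAverage μ u t ∈ K := by
    refine laplaceAverage_mem hμ ht huc hM hKc hKv fun r hr => ?_
    obtain ⟨l, p, hm, hd, hl⟩ := hsp r hr
    exact hK1 _ _ _ hm ((hM r (lt_trans ht hr)).trans (le_max_left _ _))
      (hl.trans (le_max_right _ _))
  obtain ⟨l, p, hm⟩ := hK2 _ hUK
  -- `L` of the average, tested against the dense set.
  have hweak : ∀ χ χL χP : H, (∀ a l p, (a, l, p) ∈ R → ⟪l, χ⟫ = ⟪a, χL⟫ ∧ ⟪p, χ⟫ = ⟪a, χP⟫) →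
      ⟪l, χ⟫ = ⟪μ⁻¹ • (laplaceAverage μ u t - u t), χ⟫ ∧ |⟪l, χ⟫| ≤ ‖l₀‖ * ‖χ‖ := by
    intro χ χL χP hχ
    have hpair : ∀ z : H, ⟪laplaceAverage μ u t, z⟫
        = μ⁻¹ * Real.exp (t / μ) * ∫ r in Ioi t, Real.exp (-(r / μ)) * ⟪u r, z⟫ := by
      intro z
      rw [laplaceAverage, real_inner_smul_left, real_inner_comm,
        ← integral_inner (integrableOn_exp_smul hμ ht huc hM)]
      simp only [inner_smul_right, real_inner_comm z]
    have hintz : ∀ z : H, IntegrableOn (fun r => Real.exp (-(r / μ)) * ⟪u r, z⟫) (Ioi t) := by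
      intro z
      have := (integrableOn_exp_smul hμ ht huc hM).inner_const (𝕜 := ℝ) z
      refine this.congr (Eventually.of_forall fun r => ?_)
      simp only [real_inner_smul_left]
    have hder : ∀ r ∈ Ioi t, HasDerivAt (fun r => Real.exp (-(r / μ)) * ⟪u r, χ⟫)
        (Real.exp (-(r / μ)) * ⟪u r, χL⟫ - μ⁻¹ * (Real.exp (-(r / μ)) * ⟪u r, χ⟫)) r := by
      intro r hr
      obtain ⟨l, p, hm, hd, hl⟩ := hsp r hr
      have h1 : HasDerivAt (fun r => -(r / μ)) (-(1 / μ)) r := ((hasDerivAt_id r).div_const μ).neg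
      refine (h1.exp.mul (hd.inner ℝ (hasDerivAt_const r χ))).congr_deriv ?_
      rw [inner_zero_right, zero_add, (hχ _ _ _ hm).1]
      ring
    have hlim : Tendsto (fun r => Real.exp (-(r / μ)) * ⟪u r, χ⟫) atTop (𝓝 0) := by
      have h1 : Tendsto (fun r : ℝ => Real.exp (-(r / μ)) * (M * ‖χ‖)) atTop (𝓝 0) := by
        have : Tendsto (fun r : ℝ => Real.exp (-(r / μ))) atTop (𝓝 0) :=
          Real.tendsto_exp_neg_atTop_nhds_zero.comp (tendsto_id.atTop_div_const hμ)
        simpa using this.mul_const (M * ‖χ‖)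
      refine squeeze_zero_norm' ?_ h1
      filter_upwards [Ioi_mem_atTop 0] with r hr
      rw [norm_mul, Real.norm_of_nonneg (Real.exp_pos _).le]
      gcongr
      exact (norm_inner_le_norm _ _).trans (by gcongr; exact hM r hr)
    have hut : ContinuousAt u t := hl₀.continuousAt
    have hI := integral_Ioi_of_hasDerivAt_of_tendsto (a := t)
      (ContinuousAt.continuousWithinAt (by
        exact (ContinuousAt.mul (by fun_prop) (hut.inner continuousAt_const))))
      hder ((hintz χL).sub ((hintz χ).const_mul μ⁻¹)) hlim
    rw [integral_sub (hintz χL) ((hintz χ).const_mul μ⁻¹), integral_const_mul] at hI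
    have hlχ : ⟪l, χ⟫ = ⟪laplaceAverage μ u t, χL⟫ := (hχ _ _ _ hm).1
    have e1 : Real.exp (t / μ) * Real.exp (-(t / μ)) = 1 := by rw [← Real.exp_add]; simp
    constructor
    · rw [hlχ, hpair, real_inner_smul_left, inner_sub_left, hpair]
      have : ∫ r in Ioi t, Real.exp (-(r / μ)) * ⟪u r, χL⟫
        = μ⁻¹ * (∫ r in Ioi t, Real.exp (-(r / μ)) * ⟪u r, χ⟫)
          - Real.exp (-(t / μ)) * ⟪u t, χ⟫ := by linarith
      rw [this]
      linear_combination (-μ⁻¹ * ⟪u t, χ⟫) * e1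
    · rw [hlχ, hpair, abs_mul, abs_of_nonneg (by positivity)]
      have hexp : IntegrableOn (fun r => Real.exp (-(r / μ))) (Ioi t) := by
        have h1 : IntegrableOn (fun r => Real.exp (-μ⁻¹ * r)) (Ioi t) :=
          integrableOn_exp_mul_Ioi (by simpa using hμ) t
        refine h1.congr (Eventually.of_forall fun r => ?_)
        simp only
        congr 1; ring
      have h2 : |∫ r in Ioi t, Real.exp (-(r / μ)) * ⟪u r, χL⟫|
          ≤ ∫ r in Ioi t, Real.exp (-(r / μ)) * (‖l₀‖ * ‖χ‖) := by
        rw [← Real.norm_eq_abs]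
        refine norm_integral_le_of_norm_le (hexp.mul_const _) ?_
        refine (ae_restrict_iff' measurableSet_Ioi).2 (Eventually.of_forall fun r hr => ?_)
        obtain ⟨l, p, hm, hd, hl⟩ := hsp r hr
        rw [norm_mul, Real.norm_of_nonneg (Real.exp_pos _).le, ← (hχ _ _ _ hm).1]
        gcongr
        exact (norm_inner_le_norm _ _).trans (by gcongr)
      rw [integral_mul_const] at h2
      calc μ⁻¹ * Real.exp (t / μ) * |∫ r in Ioi t, Real.exp (-(r / μ)) * ⟪u r, χL⟫|
          ≤ μ⁻¹ * Real.exp (t / μ) * ((∫ r in Ioi t, Real.exp (-(r / μ))) * (‖l₀‖ * ‖χ‖)) := by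
            gcongr
        _ = ‖l₀‖ * ‖χ‖ := by rw [← mul_assoc, integral_exp_Ioi hμ, one_mul]
  have hl : l = μ⁻¹ • (laplaceAverage μ u t - u t) := by
    refine hR.dense.eq_of_inner_left (𝕜 := ℝ) ?_
    rintro χ ⟨χL, χP, hχ⟩
    exact (hweak χ χL χP hχ).1
  have hnorm : ‖l‖ ≤ ‖l₀‖ := by
    have hcl : IsClosed {χ : H | |⟪l, χ⟫| ≤ ‖l₀‖ * ‖χ‖} :=
      isClosed_le (by fun_prop) (by fun_prop)
    have := hR.dense.induction (P := fun χ => |⟪l, χ⟫| ≤ ‖l₀‖ * ‖χ‖)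
      (fun χ ⟨χL, χP, hχ⟩ => (hweak χ χL χP hχ).2) hcl l
    rw [real_inner_self_eq_norm_sq, abs_of_nonneg (by positivity), sq] at this
    rcases (norm_nonneg l).eq_or_lt with h0 | h0
    · rw [← h0]; positivity
    · exact le_of_mul_le_mul_right this h0
  refine ⟨p, hl ▸ hm, ?_, ?_⟩
  · have := laplaceAverage_mem hμ ht huc hM (Metric.isClosed_closedBall (x := (0 : H)) (ε := M))
      (convex_closedBall 0 M) (fun r hr => by simpa using hM r (lt_trans ht hr))
    simpa using this
  · have : laplaceAverage μ u t - u t = μ • l := by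
      rw [hl, smul_smul, mul_inv_cancel₀ hμ.ne', one_smul]
    rw [this, norm_smul, Real.norm_of_nonneg hμ.le]
    gcongr

/-- Decay of the Lyapunov form from an initial value `u 0` outside the domain, at which the form
takes the value `Φ₀` in the sense that `⟨P a, u 0⟩ ≤ (⟨P a, a⟩ + Φ₀) / 2` for all `a` in the domain.
The form need not be continuous along the solution at time `0`; the solution is
approximated by its resolvents, on which the form is at most `Φ₀` by dissipation. -/
lemma form_decay_initial (hR : IsHypocoercive R κ) {u : ℝ → H} (hu : Solves R u) (hκ : 0 ≤ κ)
    (hc : ContinuousOn u (Ici 0)) {Φ₀ : ℝ}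
    (hΦ : ∀ a l p, (a, l, p) ∈ R → 2 * ⟪p, u 0⟫ ≤ ⟪p, a⟫ + Φ₀) {t : ℝ} (ht : 0 < t)
    {lt pt : H} (hmt : (u t, lt, pt) ∈ R) : ⟪pt, u t⟫ ≤ Real.exp (-(κ * t)) * Φ₀ := by
  set M := ‖u 0‖ with hMdef
  have hM : ∀ r, 0 < r → ‖u r‖ ≤ M := fun r hr =>
    hR.norm_antitoneOn hu (convex_Ici 0) (by simp) hc self_mem_Ici hr.le hr.le
  have huc := hu.continuousOn
  obtain ⟨C, hC0, hC⟩ := hR.bound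
  have hres : ∀ μ, 0 < μ → ∀ s, 0 < s → ∃ p,
      (laplaceAverage μ u s, μ⁻¹ • (laplaceAverage μ u s - u s), p) ∈ R ∧
      ‖laplaceAverage μ u s‖ ≤ M := by
    intro μ hμ s hs
    obtain ⟨l, p, -, hd⟩ := hu s hs
    obtain ⟨p, h1, h2, -⟩ := hR.laplaceAverage_resolvent hu hM hμ hs hd
    exact ⟨p, h1, h2⟩
  have hsolves : ∀ μ, 0 < μ → Solves R (laplaceAverage μ u) := by
    intro μ hμ s hs
    obtain ⟨p, h1, -⟩ := hres μ hμ s hs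
    exact ⟨_, p, h1, hasDerivAt_laplaceAverage hμ hs huc hM⟩
  -- The resolvent bound: the form of the average at time `δ` is almost bounded by `Φ₀`.
  have hbound : ∀ μ, 0 < μ → ∀ δ, 0 < δ → ∀ p,
      (laplaceAverage μ u δ, μ⁻¹ • (laplaceAverage μ u δ - u δ), p) ∈ R →
      ⟪p, laplaceAverage μ u δ⟫ ≤ Φ₀ + 2 * (C * (μ⁻¹ * (M + M) + M)) * ‖u δ - u 0‖ := by
    intro μ hμ δ hδ p hm
    set U := laplaceAverage μ u δ with hU
    obtain ⟨_, -, hUM⟩ := hres μ hμ δ hδ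
    have hp : ‖p‖ ≤ C * (μ⁻¹ * (M + M) + M) := by
      refine (hC _ _ _ hm).trans ?_
      rw [norm_smul, norm_inv, Real.norm_of_nonneg hμ.le]
      gcongr
      exact (norm_sub_le _ _).trans (add_le_add hUM (hM δ hδ))
    have h1 := hR.decay _ _ _ hm
    have h2 := hR.nonneg _ _ _ hm
    have h3 : ⟪p, U - u δ⟫ ≤ 0 := by
      rw [real_inner_smul_right] at h1
      have h5 : μ⁻¹ * ⟪p, U - u δ⟫ ≤ 0 := by nlinarith
      exact nonpos_of_mul_nonpos_right h5 (by positivity)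
    have h4 := hΦ _ _ _ hm
    have h5 : ⟪p, u δ - u 0⟫ ≤ (C * (μ⁻¹ * (M + M) + M)) * ‖u δ - u 0‖ :=
      (real_inner_le_norm _ _).trans (by gcongr)
    rw [inner_sub_right] at h3 h5
    linarith
  have hδ0 : ∀ μ, 0 < μ → ∀ p,
      (laplaceAverage μ u t, μ⁻¹ • (laplaceAverage μ u t - u t), p) ∈ R →
      ⟪p, laplaceAverage μ u t⟫ ≤ Real.exp (-(κ * t)) * Φ₀ := by
    intro μ hμ p hm
    have hlim : Tendsto (fun δ : ℝ => Real.exp (-(κ * (t - δ))) *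
        (Φ₀ + 2 * (C * (μ⁻¹ * (M + M) + M)) * ‖u δ - u 0‖)) (𝓝[>] 0)
        (𝓝 (Real.exp (-(κ * (t - 0))) *
        (Φ₀ + 2 * (C * (μ⁻¹ * (M + M) + M)) * ‖u 0 - u 0‖))) := by
      have h1 : Tendsto u (𝓝[>] 0) (𝓝 (u 0)) := (hc 0 self_mem_Ici).mono Ioi_subset_Ici_self
      have h2 : Tendsto (fun δ : ℝ => δ) (𝓝[>] 0) (𝓝 0) := nhdsWithin_le_nhds
      refine Tendsto.mul ?_ (((h1.sub_const _).norm.const_mul _).const_add _)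
      exact (Real.continuous_exp.tendsto _).comp (((h2.const_sub t).const_mul κ).neg)
    simp only [sub_zero, sub_self, norm_zero, mul_zero, add_zero] at hlim
    refine ge_of_tendsto hlim ?_
    filter_upwards [Ioo_mem_nhdsGT ht] with δ hδ
    obtain ⟨pδ, hmδ, -⟩ := hres μ hμ δ hδ.1
    have := hR.form_decay (hsolves μ hμ) hδ.1 hδ.2.le hmδ hm
    refine this.trans ?_
    gcongr
    exact hbound μ hμ δ hδ.1 pδ hmδ
  -- Weak lower semicontinuity of the form as `μ → 0`.
  obtain ⟨l, p, -, hd⟩ := hu t ht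
  have hlim : Tendsto (fun μ => laplaceAverage μ u t) (𝓝[>] 0) (𝓝 (u t)) := by
    rw [tendsto_iff_norm_sub_tendsto_zero]
    have h2 : Tendsto (fun μ : ℝ => μ * ‖l‖) (𝓝[>] 0) (𝓝 0) := by
      have : Tendsto (fun μ : ℝ => μ) (𝓝[>] 0) (𝓝 0) := nhdsWithin_le_nhds
      simpa using this.mul_const ‖l‖
    refine squeeze_zero' (Eventually.of_forall fun _ => norm_nonneg _) ?_ h2
    filter_upwards [self_mem_nhdsWithin] with μ hμ
    obtain ⟨p, -, -, h⟩ := hR.laplaceAverage_resolvent hu hM hμ ht hd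
    exact h
  have hlim2 : Tendsto (fun μ => 2 * ⟪pt, laplaceAverage μ u t⟫ - ⟪pt, u t⟫) (𝓝[>] 0)
      (𝓝 (2 * ⟪pt, u t⟫ - ⟪pt, u t⟫)) :=
    ((tendsto_const_nhds.inner hlim).const_mul 2).sub_const _
  have : 2 * ⟪pt, u t⟫ - ⟪pt, u t⟫ ≤ Real.exp (-(κ * t)) * Φ₀ := by
    refine le_of_tendsto hlim2 ?_
    filter_upwards [self_mem_nhdsWithin] with μ hμ
    obtain ⟨p, hm, -⟩ := hres μ hμ t ht
    have h1 := hδ0 μ hμ p hm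
    have h2 := hR.nonneg _ _ _ (R.sub_mem hm hmt)
    have h3 := hR.symmetric _ _ _ _ _ _ hm hmt
    simp only [inner_sub_left, inner_sub_right] at h2
    rw [real_inner_comm pt (laplaceAverage μ u t)] at h3
    linarith
  linarith

end IsHypocoercive

/-! ### Absolutely continuous functions on the line -/

section Primitive

/-- `F` is an antiderivative of the locally integrable function `f`: it is locally absolutely
continuous with `F' = f` almost everywhere. -/
def IsPrim (F f : ℝ → ℝ) : Prop :=
  ∀ x y, IntervalIntegrable f volume x y ∧ F y - F x = ∫ t in x..y, f t

namespace IsPrim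

variable {F f G g : ℝ → ℝ}

lemma absolutelyContinuous (h : IsPrim F f) (x y : ℝ) : AbsolutelyContinuousOnInterval F x y := by
  have h1 := (h x y).1.absolutelyContinuousOnInterval_intervalIntegral (c := x) left_mem_uIcc
  have h2 : AbsolutelyContinuousOnInterval (fun _ : ℝ => F x) x y :=
    contDiff_const.contDiffOn.absolutelyContinuousOnInterval
  have h3 : F = (fun _ : ℝ => F x) + fun z => ∫ v in x..z, f v := by
    ext z
    have := (h x z).2
    simp only [Pi.add_apply]
    linarith
  rw [h3]
  exact h2.add h1

lemma continuous (h : IsPrim F f) : Continuous F := by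
  rw [continuous_iff_continuousAt]
  intro x
  have h1 := (h.absolutelyContinuous (x - 1) (x + 1)).continuousOn
  rw [uIcc_of_le (by linarith)] at h1
  exact h1.continuousAt (Icc_mem_nhds (by linarith) (by linarith))

lemma ae_hasDerivAt (h : IsPrim F f) (x y : ℝ) : ∀ᵐ z, z ∈ uIcc x y → HasDerivAt F (f z) z := by
  filter_upwards [(h x y).1.ae_hasDerivAt_integral] with z hz hzm
  have h1 := (hz hzm x left_mem_uIcc).const_add (F x)
  have h3 : F = fun z => F x + ∫ v in x..z, f v := by
    ext z
    have := (h x z).2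
    linarith
  rwa [← h3] at h1

lemma mul (hF : IsPrim F f) (hG : IsPrim G g) :
    IsPrim (fun y => F y * G y) (fun y => f y * G y + F y * g y) := by
  intro x y
  refine ⟨((hF x y).1.mul_continuousOn hG.continuous.continuousOn).add
    ((hG x y).1.continuousOn_mul hF.continuous.continuousOn), ?_⟩
  rw [← (hF.absolutelyContinuous x y).integral_deriv_mul_eq_sub (hG.absolutelyContinuous x y)]
  refine intervalIntegral.integral_congr_ae ?_
  filter_upwards [hF.ae_hasDerivAt x y, hG.ae_hasDerivAt x y] with z h1 h2 hz
  rw [(h1 (uIoc_subset_uIcc hz)).deriv, (h2 (uIoc_subset_uIcc hz)).deriv]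

lemma add (hF : IsPrim F f) (hG : IsPrim G g) :
    IsPrim (fun y => F y + G y) (fun y => f y + g y) := by
  intro x y
  refine ⟨(hF x y).1.add (hG x y).1, ?_⟩
  rw [intervalIntegral.integral_add (hF x y).1 (hG x y).1, ← (hF x y).2, ← (hG x y).2]
  ring

lemma const_mul (c : ℝ) (hF : IsPrim F f) : IsPrim (fun y => c * F y) (fun y => c * f y) := by
  intro x y
  refine ⟨(hF x y).1.const_mul c, ?_⟩
  rw [intervalIntegral.integral_const_mul, ← (hF x y).2]
  ring

lemma sub (hF : IsPrim F f) (hG : IsPrim G g) :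
    IsPrim (fun y => F y - G y) (fun y => f y - g y) := by
  have := hF.add (hG.const_mul (-1))
  refine (funext fun y => ?_ : (fun y => F y - G y) = fun y => F y + -1 * G y) ▸
    (funext fun y => ?_ : (fun y => f y - g y) = fun y => f y + -1 * g y) ▸ this <;> ring

lemma congr (hF : IsPrim F f) (h : f =ᵐ[volume] g) : IsPrim F g := fun x y =>
  ⟨(hF x y).1.congr_ae (ae_restrict_of_ae h), by
    rw [(hF x y).2]
    exact intervalIntegral.integral_congr_ae (h.mono fun z hz _ => hz)⟩

lemma of_hasDerivAt (h : ∀ y, HasDerivAt F (f y) y) (hf : Continuous f) : IsPrim F f := fun _ _ =>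
  ⟨hf.intervalIntegrable _ _, (intervalIntegral.integral_eq_sub_of_hasDerivAt (fun z _ => h z)
    (hf.intervalIntegrable _ _)).symm⟩

lemma of_locallyIntegrable (hf : LocallyIntegrable f volume) :
    IsPrim (fun y => ∫ t in (0 : ℝ)..y, f t) f := by
  have h : ∀ x y, IntervalIntegrable f volume x y := fun x y =>
    (hf.integrableOn_isCompact isCompact_uIcc).intervalIntegrable
  intro x y
  exact ⟨h x y, intervalIntegral.integral_interval_sub_left (h 0 y) (h 0 x)⟩

/-- An integrable function with integrable derivative vanishes at infinity, so that its derivative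
has integral zero. -/
lemma integral_eq_zero (h : IsPrim F f) (hF : Integrable F) (hf : Integrable f) :
    ∫ y, f y = 0 := by
  have hT : Tendsto F atTop (𝓝 (F 0 + ∫ t in Ioi (0 : ℝ), f t)) := by
    have h1 := (intervalIntegral_tendsto_integral_Ioi 0 hf.integrableOn tendsto_id).const_add (F 0)
    refine h1.congr fun y => ?_
    rw [id, ← (h 0 y).2]; ring
  have hB : Tendsto F atBot (𝓝 (F 0 - ∫ t in Iic (0 : ℝ), f t)) := by
    have h1 := (intervalIntegral_tendsto_integral_Iic 0 hf.integrableOn tendsto_id).const_sub (F 0)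
    refine h1.congr fun y => ?_
    rw [id, ← (h y 0).2]; ring
  have e1 : F 0 + ∫ t in Ioi (0 : ℝ), f t = 0 := by
    refine IntegrableAtFilter.eq_zero_of_tendsto (l := atTop) (μ := volume)
      (hF.integrableAtFilter _) ?_ hT
    intro s hs
    rcases mem_atTop_sets.1 hs with ⟨b, hb⟩
    rw [← top_le_iff, ← Real.volume_Ici (a := b)]
    exact measure_mono hb
  have e2 : F 0 - ∫ t in Iic (0 : ℝ), f t = 0 := by
    refine IntegrableAtFilter.eq_zero_of_tendsto (l := atBot) (μ := volume)
      (hF.integrableAtFilter _) ?_ hB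
    intro s hs
    rcases mem_atBot_sets.1 hs with ⟨b, hb⟩
    rw [← top_le_iff, ← Real.volume_Iic (a := b)]
    exact measure_mono hb
  have e3 := intervalIntegral.integral_Iic_add_Ioi (b := (0 : ℝ)) hf.integrableOn hf.integrableOn
  linarith

/-- The integral of `(y F)' = F + y F'` vanishes as soon as `F`, `F'` and `y F'` are integrable;
integrability of `y F` is not needed. -/
lemma integral_id_mul_eq_zero (h : IsPrim F f) (hF : Integrable F) (hf : Integrable f)
    (hyf : Integrable fun y => y * f y) : ∫ y, (F y + y * f y) = 0 := by
  -- Multiply by `y / (1 + y² / (n + 1))` instead of `y` and let `n → ∞`.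
  set ε : ℕ → ℝ := fun n => 1 / ((n : ℝ) + 1) with hε
  have hε0 : ∀ n, 0 ≤ ε n := fun n => by positivity
  have hpos : ∀ n y, 0 < 1 + ε n * y ^ 2 := fun n y => by
    have := mul_nonneg (hε0 n) (sq_nonneg y); linarith
  set w : ℕ → ℝ → ℝ := fun n y => y / (1 + ε n * y ^ 2) with hw
  set w' : ℕ → ℝ → ℝ := fun n y => (1 - ε n * y ^ 2) / (1 + ε n * y ^ 2) ^ 2 with hw'
  have hwd : ∀ n y, HasDerivAt (w n) (w' n y) y := by
    intro n y
    have h1 : HasDerivAt (fun y : ℝ => 1 + ε n * y ^ 2) (ε n * (2 * y)) y := by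
      have := ((hasDerivAt_pow 2 y).const_mul (ε n)).const_add 1
      simpa using this
    refine ((hasDerivAt_id y).div h1 (hpos n y).ne').congr_deriv ?_
    simp only [id, hw']
    congr 1; ring
  have hwc' : ∀ n, Continuous (w' n) := fun n =>
    Continuous.div (by fun_prop) (by fun_prop) fun y => (pow_pos (hpos n y) 2).ne'
  have hwc : ∀ n, Continuous (w n) := fun n =>
    Continuous.div (by fun_prop) (by fun_prop) fun y => (hpos n y).ne'
  have hwb : ∀ n y, |w n y| ≤ |y| := by
    intro n y
    rw [hw, abs_div, abs_of_pos (hpos n y)]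
    exact div_le_self (abs_nonneg _) (by have := mul_nonneg (hε0 n) (sq_nonneg y); linarith)
  have hwb' : ∀ n y, |w' n y| ≤ 1 := by
    intro n y
    have h0 := mul_nonneg (hε0 n) (sq_nonneg y)
    rw [hw', abs_div, abs_of_pos (pow_pos (hpos n y) 2), div_le_one (pow_pos (hpos n y) 2), abs_le]
    constructor <;> nlinarith
  have hwF : ∀ n, Integrable fun y => w n y * F y := by
    intro n
    have hb : ∀ y, |w n y| ≤ (n : ℝ) + 1 := by
      intro y
      rw [hw, abs_div, abs_of_pos (hpos n y), div_le_iff₀ (hpos n y)]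
      have e : ((n : ℝ) + 1) * (1 + ε n * y ^ 2) = (n : ℝ) + 1 + y ^ 2 := by
        simp only [hε]; field_simp
      rw [e, ← sq_abs y]
      nlinarith [sq_nonneg (|y| - 1), abs_nonneg y, (Nat.cast_nonneg n : (0 : ℝ) ≤ n)]
    exact hF.bdd_mul (hwc n).aestronglyMeasurable (Eventually.of_forall hb)
  have hwF' : ∀ n, Integrable fun y => w' n y * F y := fun n =>
    hF.bdd_mul (hwc' n).aestronglyMeasurable (Eventually.of_forall (hwb' n))
  have hwf : ∀ n, Integrable fun y => w n y * f y := fun n =>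
    hyf.mono ((hwc n).aestronglyMeasurable.mul hf.aestronglyMeasurable)
      (Eventually.of_forall fun y => by
        rw [norm_mul, norm_mul]
        exact mul_le_mul_of_nonneg_right (hwb n y) (norm_nonneg _))
  have hz : ∀ n, ∫ y, (w' n y * F y + w n y * f y) = 0 := fun n =>
    ((of_hasDerivAt (hwd n) (hwc' n)).mul h).integral_eq_zero (hwF n) ((hwF' n).add (hwf n))
  have hεt : Tendsto ε atTop (𝓝 0) := tendsto_one_div_add_atTop_nhds_zero_nat
  have hlim : Tendsto (fun n => ∫ y, (w' n y * F y + w n y * f y)) atTop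
      (𝓝 (∫ y, (F y + y * f y))) := by
    refine tendsto_integral_of_dominated_convergence (fun y => |F y| + |y * f y|)
      (fun n => ((hwF' n).add (hwf n)).aestronglyMeasurable) (hF.abs.add hyf.abs) ?_ ?_
    · refine fun n => Eventually.of_forall fun y => ?_
      refine (norm_add_le _ _).trans (add_le_add ?_ ?_)
      · rw [norm_mul]
        exact mul_le_of_le_one_left (abs_nonneg _) (hwb' n y)
      · rw [norm_mul, abs_mul]
        exact mul_le_mul_of_nonneg_right (hwb n y) (abs_nonneg _)
    · refine Eventually.of_forall fun y => ?_
      have h1 : Tendsto (fun n => 1 + ε n * y ^ 2) atTop (𝓝 1) := by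
        simpa using (hεt.mul_const (y ^ 2)).const_add 1
      have h2 : Tendsto (fun n => 1 - ε n * y ^ 2) atTop (𝓝 1) := by
        simpa using (hεt.mul_const (y ^ 2)).const_sub 1
      have h3 : Tendsto (fun n => w n y) atTop (𝓝 y) := by
        have h5 := (tendsto_const_nhds (x := y)).div h1 one_ne_zero
        rw [div_one] at h5
        exact h5
      have h4 : Tendsto (fun n => w' n y) atTop (𝓝 1) := by
        have h5 := h2.div (h1.pow 2) (by norm_num)
        rw [one_pow, div_one] at h5
        exact h5
      simpa using (h4.mul_const (F y)).add (h3.mul_const (f y))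
  simp_rw [hz] at hlim
  exact tendsto_nhds_unique hlim tendsto_const_nhds

end IsPrim

/-- A locally integrable function whose distributional derivative is locally integrable has an
absolutely continuous representative (du Bois-Reymond). -/
lemma exists_isPrim_of_weak {f g : ℝ → ℝ} (hf : LocallyIntegrable f volume)
    (hg : LocallyIntegrable g volume)
    (h : ∀ η : ℝ → ℝ, ContDiff ℝ ((⊤ : ℕ∞) : WithTop ℕ∞) η → HasCompactSupport η →
      ∫ y, f y * deriv η y = -∫ y, g y * η y) :
    ∃ F, f =ᵐ[volume] F ∧ IsPrim F g := by
  set G : ℝ → ℝ := fun y => ∫ t in (0 : ℝ)..y, g t with hG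
  have hGp : IsPrim G g := IsPrim.of_locallyIntegrable hg
  have hGl : LocallyIntegrable G volume := hGp.continuous.locallyIntegrable
  have hint : ∀ {u : ℝ → ℝ}, LocallyIntegrable u volume → ∀ {η : ℝ → ℝ}, Continuous η →
      HasCompactSupport η → Integrable fun y => u y * η y := by
    intro u hu η hη hc
    have := hu.integrable_smul_left_of_hasCompactSupport hη hc
    exact this.congr (Eventually.of_forall fun y => by simp [mul_comm])
  set u : ℝ → ℝ := fun y => f y - G y with hu
  have hul : LocallyIntegrable u volume := hf.sub hGl
  have hu0 : ∀ η : ℝ → ℝ, ContDiff ℝ ((⊤ : ℕ∞) : WithTop ℕ∞) η → HasCompactSupport η →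
      ∫ y, u y * deriv η y = 0 := by
    intro η hη hc
    have hη1 : ContDiff ℝ 1 η := hη.of_le (by norm_cast)
    have hηd : Continuous (deriv η) := hη1.continuous_deriv le_rfl
    have hp := hGp.mul (IsPrim.of_hasDerivAt
      (fun y => (hη1.differentiable one_ne_zero y).hasDerivAt) hηd)
    have h1 := hint hg hη.continuous hc
    have h2 := hint hGl hηd hc.deriv
    have h3 := hp.integral_eq_zero (hint hGl hη.continuous hc) (h1.add h2)
    rw [integral_add h1 h2] at h3
    simp only [hu, sub_mul]
    rw [integral_sub (hint hf hηd hc.deriv) h2, h η hη hc]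
    linarith
  obtain ⟨χ⟩ : Nonempty (ContDiffBump (0 : ℝ)) := ⟨⟨1, 2, one_pos, one_lt_two⟩⟩
  set χ₀ : ℝ → ℝ := χ.normed volume with hχ₀
  have hχ₀s : ContDiff ℝ ((⊤ : ℕ∞) : WithTop ℕ∞) χ₀ := χ.contDiff_normed
  have hχ₀c : HasCompactSupport χ₀ := χ.hasCompactSupport_normed
  have hχ₀1 : ∫ y, χ₀ y = 1 := χ.integral_normed
  set c : ℝ := ∫ y, u y * χ₀ y with hc
  have hconst : ∀ᵐ y, u y - c = 0 := by
    refine ae_eq_zero_of_integral_contDiff_smul_eq_zero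
      (hul.sub (locallyIntegrable_const c)) ?_
    intro η hη hηc
    set m : ℝ := ∫ y, η y with hm
    -- `θ` has mean zero, hence is the derivative of a test function.
    set θ : ℝ → ℝ := fun y => η y - m * χ₀ y with hθ
    have hθs : ContDiff ℝ ((⊤ : ℕ∞) : WithTop ℕ∞) θ := hη.sub (contDiff_const.mul hχ₀s)
    have hθc : HasCompactSupport θ := hηc.sub hχ₀c.mul_left
    have hηi : Integrable η := hη.continuous.integrable_of_hasCompactSupport hηc
    have hχi : Integrable χ₀ := hχ₀s.continuous.integrable_of_hasCompactSupport hχ₀c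
    have hθi : Integrable θ := hηi.sub (hχi.const_mul m)
    have hθ0 : ∫ y, θ y = 0 := by
      simp only [hθ]
      rw [integral_sub hηi (hχi.const_mul m), integral_const_mul, hχ₀1, mul_one, sub_self]
    obtain ⟨r, hr⟩ := hθc.isCompact.isBounded.subset_closedBall 0
    have hθr : ∀ y, r < |y| → θ y = 0 := by
      intro y hy
      by_contra hne
      have := hr (subset_tsupport _ hne)
      rw [Metric.mem_closedBall, Real.dist_eq, sub_zero] at this
      linarith
    set Θ : ℝ → ℝ := fun y => ∫ t in Iic y, θ t with hΘ
    have hΘd : ∀ y, HasDerivAt Θ (θ y) y := by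
      intro y
      have h1 : HasDerivAt (fun z => (∫ t in Iic (0 : ℝ), θ t) + ∫ t in (0 : ℝ)..z, θ t) (θ y) y :=
        (intervalIntegral.integral_hasDerivAt_right (hθs.continuous.intervalIntegrable _ _)
          (hθs.continuous.stronglyMeasurableAtFilter _ _) hθs.continuous.continuousAt).const_add _
      refine h1.congr_of_eventuallyEq (Eventually.of_forall fun z => ?_)
      have := intervalIntegral.integral_Iic_sub_Iic (a := (0 : ℝ)) (b := z) hθi.integrableOn
        hθi.integrableOn
      simp only [hΘ]
      linarith
    have hΘderiv : deriv Θ = θ := funext fun y => (hΘd y).deriv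
    have hΘs : ContDiff ℝ ((⊤ : ℕ∞) : WithTop ℕ∞) Θ := by
      rw [contDiff_infty_iff_deriv]
      exact ⟨fun y => (hΘd y).differentiableAt, by rwa [hΘderiv]⟩
    have hΘc : HasCompactSupport Θ := by
      refine HasCompactSupport.intro (isCompact_closedBall (0 : ℝ) r) fun y hy => ?_
      rw [Metric.mem_closedBall, Real.dist_eq, sub_zero, not_le] at hy
      rcases lt_abs.1 hy with h1 | h1
      · have h2 : ∫ t in Iic y, θ t = ∫ t, θ t := by
          refine setIntegral_eq_integral_of_forall_compl_eq_zero fun t ht => hθr t ?_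
          rw [mem_Iic, not_le] at ht
          exact lt_of_lt_of_le (h1.trans ht) (le_abs_self t)
        simp only [hΘ, h2, hθ0]
      · refine setIntegral_eq_zero_of_forall_eq_zero fun t ht => hθr t ?_
        have : t ≤ y := ht
        exact lt_of_lt_of_le (by linarith) (neg_le_abs t)
    have h1 := hu0 Θ hΘs hΘc
    rw [hΘderiv] at h1
    have hu1 := hint hul hη.continuous hηc
    have hu2 := hint hul hχ₀s.continuous hχ₀c
    have h2 : ∫ y, u y * θ y = (∫ y, u y * η y) - m * c := by
      rw [hc, ← integral_const_mul, ← integral_sub hu1 (hu2.const_mul m)]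
      refine integral_congr_ae (Eventually.of_forall fun y => ?_)
      simp only [hθ]; ring
    have h3 : ∫ y, η y • (u y - c) = (∫ y, u y * η y) - m * c := by
      rw [hm, ← integral_mul_const, ← integral_sub hu1 (hηi.mul_const c)]
      refine integral_congr_ae (Eventually.of_forall fun y => ?_)
      simp only [smul_eq_mul]; ring
    rw [h3, ← h2, h1]
  refine ⟨fun y => c + G y, ?_, ?_⟩
  · filter_upwards [hconst] with y hy
    simp only [hu] at hy
    linarith
  · intro x y
    refine ⟨(hGp x y).1, ?_⟩
    rw [← (hGp x y).2]; ring

end Primitive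

/-! ### Weak derivatives and multiplication by `y` in `L²(ℝ; ℂ)` -/

/-- The space `L²(ℝ; ℂ)` of `x`-Fourier amplitudes, regarded as a real Hilbert space. -/
abbrev L2Line : Type := Lp ℂ 2 (volume : Measure ℝ)

section Test

/-- Smooth compactly supported functions `ℝ → ℂ`. -/
def testSpace : Submodule ℝ (ℝ → ℂ) where
  carrier := {χ | ContDiff ℝ ((⊤ : ℕ∞) : WithTop ℕ∞) χ ∧ HasCompactSupport χ}
  add_mem' h₁ h₂ := ⟨h₁.1.add h₂.1, h₁.2.add h₂.2⟩
  zero_mem' := ⟨contDiff_const, HasCompactSupport.zero⟩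
  smul_mem' c _ h := ⟨contDiff_const.smul h.1, h.2.smul_left (f := fun _ => c)⟩

lemma testSpace_memLp (χ : testSpace) : MemLp (χ : ℝ → ℂ) 2 volume :=
  χ.2.1.continuous.memLp_of_hasCompactSupport χ.2.2

/-- The class in `L²(ℝ; ℂ)` of a test function. -/
def testToLp : testSpace →ₗ[ℝ] L2Line where
  toFun χ := (testSpace_memLp χ).toLp _
  map_add' _ _ := rfl
  map_smul' _ _ := rfl

lemma coeFn_testToLp (χ : testSpace) : testToLp χ =ᵐ[volume] (χ : ℝ → ℂ) :=
  (testSpace_memLp χ).coeFn_toLp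

lemma denseRange_testToLp : DenseRange testToLp := by
  have h := Lp.dense_hasCompactSupport_contDiff (F := ℂ) (μ := (volume : Measure ℝ)) (p := 2)
    (by norm_num)
  refine h.mono ?_
  rintro f ⟨g, hfg, hgc, hgs⟩
  refine ⟨⟨g, hgs, hgc⟩, ?_⟩
  exact Lp.ext ((coeFn_testToLp _).trans hfg.symm)

lemma testSpace_hasDerivAt (χ : testSpace) (y : ℝ) :
    HasDerivAt (χ : ℝ → ℂ) (deriv (χ : ℝ → ℂ) y) y :=
  ((χ.2.1.differentiable (by norm_num)) y).hasDerivAt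

/-- Differentiation of test functions. -/
def testDeriv : testSpace →ₗ[ℝ] testSpace where
  toFun χ := ⟨deriv χ, (contDiff_infty_iff_deriv.1 χ.2.1).2, χ.2.2.deriv⟩
  map_add' χ η := Subtype.ext <| funext fun y =>
    ((testSpace_hasDerivAt χ y).add (testSpace_hasDerivAt η y)).deriv
  map_smul' c χ := Subtype.ext <| funext fun y => ((testSpace_hasDerivAt χ y).const_smul c).deriv

/-- Multiplication of test functions by the coordinate `y`. -/
def testMulY : testSpace →ₗ[ℝ] testSpace where
  toFun χ := ⟨fun y => y • (χ : ℝ → ℂ) y, contDiff_id.smul χ.2.1,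
    χ.2.2.smul_left (f := fun y : ℝ => y)⟩
  map_add' χ η := Subtype.ext <| funext fun y => smul_add y ((χ : ℝ → ℂ) y) ((η : ℝ → ℂ) y)
  map_smul' c χ := Subtype.ext <| funext fun y => smul_comm y c ((χ : ℝ → ℂ) y)

/-- Multiplication of test functions by the imaginary unit. -/
def testMulI : testSpace →ₗ[ℝ] testSpace where
  toFun χ := ⟨fun y => Complex.I • (χ : ℝ → ℂ) y, χ.2.1.const_smul Complex.I,
    χ.2.2.smul_left (f := fun _ => Complex.I)⟩
  map_add' χ η := Subtype.ext <| funext fun y =>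
    smul_add Complex.I ((χ : ℝ → ℂ) y) ((η : ℝ → ℂ) y)
  map_smul' c χ := Subtype.ext <| funext fun y => smul_comm Complex.I c ((χ : ℝ → ℂ) y)

end Test

lemma complex_inner_eq (z w : ℂ) : ⟪z, w⟫ = z.re * w.re + z.im * w.im := by
  rw [Complex.inner]; simp [Complex.mul_re]; ring

lemma line_inner_def (a b : L2Line) : ⟪a, b⟫ = ∫ y, ⟪a y, b y⟫ := L2.inner_def a b

lemma line_integrable_inner (a b : L2Line) : Integrable fun y => ⟪a y, b y⟫ :=
  L2.integrable_inner a b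

lemma line_inner_I_left (a b : L2Line) : ⟪Complex.I • a, b⟫ = -⟪a, Complex.I • b⟫ := by
  rw [line_inner_def, line_inner_def, ← integral_neg]
  refine integral_congr_ae ?_
  filter_upwards [Lp.coeFn_smul Complex.I a, Lp.coeFn_smul Complex.I b] with y h1 h2
  rw [h1, h2]
  simp
  ring

lemma line_inner_I_self (a : L2Line) : ⟪a, Complex.I • a⟫ = 0 := by
  have h := line_inner_I_left a a
  rw [real_inner_comm] at h
  linarith

lemma line_inner_I_I (a b : L2Line) : ⟪Complex.I • a, Complex.I • b⟫ = ⟪a, b⟫ := by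
  rw [line_inner_I_left, smul_smul, Complex.I_mul_I, neg_smul, one_smul, inner_neg_right, neg_neg]

section WeakDerivative

/-- `b` is the weak derivative of `a` in `L²(ℝ; ℂ)`. -/
def WeakD (a b : L2Line) : Prop :=
  ∀ χ : testSpace, ⟪a, testToLp (testDeriv χ)⟫ = -⟪b, testToLp χ⟫

/-- `m` is the product of `a` with the coordinate `y`. -/
def IsMulY (a m : L2Line) : Prop := ∀ᵐ y : ℝ, m y = y • a y

lemma WeakD.add {a b a' b' : L2Line} (h : WeakD a b) (h' : WeakD a' b') :
    WeakD (a + a') (b + b') := fun χ => by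
  rw [inner_add_left, inner_add_left, h, h']; ring

lemma WeakD.smul {a b : L2Line} (r : ℝ) (h : WeakD a b) : WeakD (r • a) (r • b) := fun χ => by
  rw [real_inner_smul_left, real_inner_smul_left, h]; ring

lemma testToLp_mulI (χ : testSpace) : testToLp (testMulI χ) = Complex.I • testToLp χ := by
  refine Lp.ext ?_
  filter_upwards [coeFn_testToLp (testMulI χ), coeFn_testToLp χ,
    Lp.coeFn_smul Complex.I (testToLp χ)] with y h1 h2 h3
  rw [h1, h3, Pi.smul_apply, h2]
  rfl

lemma testToLp_mulY (χ : testSpace) : IsMulY (testToLp χ) (testToLp (testMulY χ)) := by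
  filter_upwards [coeFn_testToLp (testMulY χ), coeFn_testToLp χ] with y h1 h2
  rw [h1, h2]
  rfl

lemma testDeriv_mulI (χ : testSpace) : testDeriv (testMulI χ) = testMulI (testDeriv χ) :=
  Subtype.ext <| funext fun y => ((testSpace_hasDerivAt χ y).const_smul Complex.I).deriv

lemma WeakD.mulI {a b : L2Line} (h : WeakD a b) : WeakD (Complex.I • a) (Complex.I • b) :=
  fun χ => by
    rw [line_inner_I_left, line_inner_I_left, ← testToLp_mulI, ← testToLp_mulI, ← testDeriv_mulI, h]

lemma IsMulY.add {a m a' m' : L2Line} (h : IsMulY a m) (h' : IsMulY a' m') :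
    IsMulY (a + a') (m + m') := by
  filter_upwards [h, h', Lp.coeFn_add a a', Lp.coeFn_add m m'] with y h1 h2 h3 h4
  rw [h3, h4, Pi.add_apply, Pi.add_apply, h1, h2, smul_add]

lemma IsMulY.smul {a m : L2Line} (r : ℝ) (h : IsMulY a m) : IsMulY (r • a) (r • m) := by
  filter_upwards [h, Lp.coeFn_smul r a, Lp.coeFn_smul r m] with y h1 h3 h4
  rw [h3, h4, Pi.smul_apply, Pi.smul_apply, h1, smul_comm]

lemma IsMulY.mulI {a m : L2Line} (h : IsMulY a m) : IsMulY (Complex.I • a) (Complex.I • m) := by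
  filter_upwards [h, Lp.coeFn_smul Complex.I a, Lp.coeFn_smul Complex.I m] with y h1 h3 h4
  rw [h3, h4, Pi.smul_apply, Pi.smul_apply, h1, smul_comm]

lemma IsMulY.inner_comm {a m b n : L2Line} (h : IsMulY a m) (h' : IsMulY b n) :
    ⟪m, b⟫ = ⟪a, n⟫ := by
  rw [line_inner_def, line_inner_def]
  refine integral_congr_ae ?_
  filter_upwards [h, h'] with y h1 h2
  rw [h1, h2, real_inner_smul_left, real_inner_smul_right]

/-- The complex-valued version of `IsPrim`. -/
def IsCPrim (A B : ℝ → ℂ) : Prop :=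
  IsPrim (fun y => (A y).re) (fun y => (B y).re) ∧ IsPrim (fun y => (A y).im) (fun y => (B y).im)

lemma IsCPrim.inner {A B C D : ℝ → ℂ} (h : IsCPrim A B) (h' : IsCPrim C D) :
    IsPrim (fun y => ⟪A y, C y⟫) (fun y => ⟪B y, C y⟫ + ⟪A y, D y⟫) := by
  have := (h.1.mul h'.1).add (h.2.mul h'.2)
  simp only [complex_inner_eq]
  refine this.congr (Eventually.of_forall fun y => ?_)
  simp only
  ring

lemma line_memLp_re (a : L2Line) : MemLp (fun y => (a y).re) 2 volume := (Lp.memLp a).re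

lemma line_memLp_im (a : L2Line) : MemLp (fun y => (a y).im) 2 volume := (Lp.memLp a).im

/-- A weakly differentiable function has an absolutely continuous representative. -/
lemma WeakD.exists_prim {a b : L2Line} (h : WeakD a b) : ∃ A : ℝ → ℂ, a =ᵐ[volume] A ∧
    IsCPrim A b := by
  have key : ∀ (z : ℂ) (η : ℝ → ℝ), ContDiff ℝ ((⊤ : ℕ∞) : WithTop ℕ∞) η → HasCompactSupport η →
      ∫ y, ⟪a y, z⟫ * deriv η y = -∫ y, ⟪b y, z⟫ * η y := by
    intro z η hη hc
    let χ : testSpace := ⟨fun y => η y • z, hη.smul contDiff_const, hc.smul_right (f' := fun _ => z)⟩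
    have h1 := h χ
    have hd : ∀ y, (testDeriv χ : ℝ → ℂ) y = deriv η y • z := fun y =>
      (((hη.differentiable (by norm_num)) y).hasDerivAt.smul_const z).deriv
    rw [line_inner_def, line_inner_def] at h1
    rw [integral_congr_ae (g := fun y => ⟪a y, testToLp (testDeriv χ) y⟫), h1]
    · congr 1
      refine integral_congr_ae ?_
      filter_upwards [coeFn_testToLp χ] with y hy
      rw [hy]
      change ⟪b y, η y • z⟫ = _
      rw [real_inner_smul_right, mul_comm]
    · filter_upwards [coeFn_testToLp (testDeriv χ)] with y hy
      rw [hy, hd, real_inner_smul_right, mul_comm]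
  have hre := exists_isPrim_of_weak (f := fun y => (a y).re) (g := fun y => (b y).re)
    ((line_memLp_re a).locallyIntegrable (by norm_num))
    ((line_memLp_re b).locallyIntegrable (by norm_num))
    (by simpa [complex_inner_eq] using key 1)
  have him := exists_isPrim_of_weak (f := fun y => (a y).im) (g := fun y => (b y).im)
    ((line_memLp_im a).locallyIntegrable (by norm_num))
    ((line_memLp_im b).locallyIntegrable (by norm_num))
    (by simpa [complex_inner_eq] using key Complex.I)
  obtain ⟨F, hF, hF'⟩ := hre
  obtain ⟨G, hG, hG'⟩ := him
  refine ⟨fun y => ⟨F y, G y⟩, ?_, hF', hG'⟩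
  filter_upwards [hF, hG] with y h1 h2
  exact Complex.ext h1 h2

/-- Integration by parts with a weight `w`. -/
lemma integral_weight_eq_zero {a b u v : L2Line} (hab : WeakD a b) (huv : WeakD u v)
    {w w' : ℝ → ℝ} (hw : ∀ y, HasDerivAt w (w' y) y) (hw' : Continuous w')
    (h1 : Integrable fun y => w y * ⟪a y, u y⟫)
    (h2 : Integrable fun y => w' y * ⟪a y, u y⟫ + w y * (⟪b y, u y⟫ + ⟪a y, v y⟫)) :
    ∫ y, (w' y * ⟪a y, u y⟫ + w y * (⟪b y, u y⟫ + ⟪a y, v y⟫)) = 0 := by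
  obtain ⟨A, hA, hA'⟩ := hab.exists_prim
  obtain ⟨U, hU, hU'⟩ := huv.exists_prim
  have hp := (IsPrim.of_hasDerivAt hw hw').mul (hA'.inner hU')
  have e1 : (fun y => w y * ⟪a y, u y⟫) =ᵐ[volume] fun y => w y * ⟪A y, U y⟫ := by
    filter_upwards [hA, hU] with y h h'
    rw [h, h']
  have e2 : (fun y => w' y * ⟪a y, u y⟫ + w y * (⟪b y, u y⟫ + ⟪a y, v y⟫)) =ᵐ[volume]
      fun y => w' y * ⟪A y, U y⟫ + w y * (⟪b y, U y⟫ + ⟪A y, v y⟫) := by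
    filter_upwards [hA, hU] with y h h'
    rw [h, h']
  rw [integral_congr_ae e2]
  exact hp.integral_eq_zero (h1.congr e1) (h2.congr e2)

/-- Integration by parts with a weight `w`, when all terms are scalar products in `L²`. -/
lemma inner_weight_eq_zero {a b u v : L2Line} (hab : WeakD a b) (huv : WeakD u v)
    {w w' : ℝ → ℝ} (hw : ∀ y, HasDerivAt w (w' y) y) (hw' : Continuous w')
    (x₀ y₀ x₁ y₁ x₂ y₂ x₃ y₃ : L2Line) (c₁ : ℝ)
    (h0 : ∀ᵐ y, w y * ⟪a y, u y⟫ = ⟪x₀ y, y₀ y⟫)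
    (h1 : ∀ᵐ y, w' y * ⟪a y, u y⟫ = c₁ * ⟪x₁ y, y₁ y⟫)
    (h2 : ∀ᵐ y, w y * ⟪b y, u y⟫ = ⟪x₂ y, y₂ y⟫)
    (h3 : ∀ᵐ y, w y * ⟪a y, v y⟫ = ⟪x₃ y, y₃ y⟫) :
    c₁ * ⟪x₁, y₁⟫ + ⟪x₂, y₂⟫ + ⟪x₃, y₃⟫ = 0 := by
  have i1 := (line_integrable_inner x₁ y₁).const_mul c₁
  have i2 := line_integrable_inner x₂ y₂
  have i3 := line_integrable_inner x₃ y₃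
  have e : (fun y => w' y * ⟪a y, u y⟫ + w y * (⟪b y, u y⟫ + ⟪a y, v y⟫)) =ᵐ[volume]
      fun y => c₁ * ⟪x₁ y, y₁ y⟫ + (⟪x₂ y, y₂ y⟫ + ⟪x₃ y, y₃ y⟫) := by
    filter_upwards [h1, h2, h3] with y h1 h2 h3
    rw [h1, mul_add, h2, h3]
  have := integral_weight_eq_zero hab huv hw hw'
    ((line_integrable_inner x₀ y₀).congr (h0.mono fun y hy => hy.symm))
    ((i1.add (i2.add i3)).congr e.symm)
  have i23 : Integrable fun y => ⟪x₂ y, y₂ y⟫ + ⟪x₃ y, y₃ y⟫ := i2.add i3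
  rw [integral_congr_ae e, integral_add i1 i23, integral_add i2 i3, integral_const_mul] at this
  rw [line_inner_def, line_inner_def, line_inner_def]
  linarith

lemma WeakD.inner_eq_neg {a b u v : L2Line} (hab : WeakD a b) (huv : WeakD u v) :
    ⟪b, u⟫ = -⟪a, v⟫ := by
  have := inner_weight_eq_zero hab huv (w := fun _ => 1) (w' := fun _ => 0)
    (fun y => hasDerivAt_const y 1) continuous_const a u a u b u a v 0
    (by simp) (by simp) (by simp) (by simp)
  linarith

/-- `(y ⟨a, u⟩)' = ⟨a, u⟩ + ⟨y a', u⟩ + ⟨y a, u'⟩` has integral zero. -/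
lemma inner_mulY_eq_zero {a b u v m e : L2Line} (hab : WeakD a b) (huv : WeakD u v)
    (hm : IsMulY a m) (he : IsMulY b e) : ⟪a, u⟫ + ⟪e, u⟫ + ⟪m, v⟫ = 0 := by
  have := inner_weight_eq_zero hab huv (w := fun y => y) (w' := fun _ => 1)
    (fun y => hasDerivAt_id y) continuous_const m u a u e u m v 1
    (by filter_upwards [hm] with y h; rw [h, real_inner_smul_left]) (by simp)
    (by filter_upwards [he] with y h; rw [h, real_inner_smul_left])
    (by filter_upwards [hm] with y h; rw [h, real_inner_smul_left])
  linarith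

lemma hasDerivAt_sq (y : ℝ) : HasDerivAt (fun y : ℝ => y ^ 2) (2 * y) y := by
  simpa using hasDerivAt_pow 2 y

/-- Integration by parts for `⟨a'', i y² a⟩`; the term `⟨y a', i y a'⟩` vanishes. -/
lemma inner_mulY_sq_I {a b c m d : L2Line} (hab : WeakD a b) (hbc : WeakD b c)
    (hm : IsMulY a m) (hd : IsMulY m d) :
    ⟪c, Complex.I • d⟫ = -(2 * ⟪b, Complex.I • m⟫) := by
  have hI : ∀ᵐ y, (Complex.I • a : L2Line) y = Complex.I • a y := Lp.coeFn_smul _ _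
  have hId : ∀ᵐ y, (Complex.I • d : L2Line) y = Complex.I • d y := Lp.coeFn_smul _ _
  have hIm : ∀ᵐ y, (Complex.I • m : L2Line) y = Complex.I • m y := Lp.coeFn_smul _ _
  have hIb : ∀ᵐ y, (Complex.I • b : L2Line) y = Complex.I • b y := Lp.coeFn_smul _ _
  have := inner_weight_eq_zero hbc hab.mulI (w := fun y => y ^ 2) (w' := fun y => 2 * y)
    hasDerivAt_sq (by fun_prop) b (Complex.I • d) b (Complex.I • m) c (Complex.I • d) 0 0 2
    (by filter_upwards [hI, hId, hm, hd] with y h1 h2 h3 h4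
        rw [h1, h2, h4, h3, smul_comm, smul_comm Complex.I y (a y)]
        simp only [real_inner_smul_right]; ring)
    (by filter_upwards [hI, hIm, hm] with y h1 h2 h3
        rw [h1, h2, h3, smul_comm]
        simp only [real_inner_smul_right]; ring)
    (by filter_upwards [hI, hId, hm, hd] with y h1 h2 h3 h4
        rw [h1, h2, h4, h3, smul_comm, smul_comm Complex.I y (a y)]
        simp only [real_inner_smul_right]; ring)
    (by filter_upwards [hIb, Lp.coeFn_zero ℂ 2 (volume : Measure ℝ)] with y h1 h2
        rw [h1, h2]
        simp; ring_nf; simp)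
  rw [inner_zero_right] at this
  linarith

/-- The integral of `(y³ |a|²)'` vanishes. -/
lemma inner_mulY_mulY_sq {a b m e d : L2Line} (hab : WeakD a b)
    (hm : IsMulY a m) (he : IsMulY b e) (hd : IsMulY m d) :
    2 * ⟪e, d⟫ = -(3 * ⟪m, m⟫) := by
  have := inner_weight_eq_zero hab hab (w := fun y => y ^ 3) (w' := fun y => 3 * y ^ 2)
    (fun y => by simpa using hasDerivAt_pow 3 y) (by fun_prop) d m m m e d d e 3
    (by filter_upwards [hm, hd] with y h3 h4
        rw [h4, h3]; simp only [real_inner_smul_left, real_inner_smul_right]; ring)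
    (by filter_upwards [hm] with y h3
        rw [h3]; simp only [real_inner_smul_left, real_inner_smul_right]; ring)
    (by filter_upwards [hm, hd, he] with y h3 h4 h5
        rw [h4, h3, h5]; simp only [real_inner_smul_left, real_inner_smul_right]; ring)
    (by filter_upwards [hm, hd, he] with y h3 h4 h5
        rw [h4, h3, h5]; simp only [real_inner_smul_left, real_inner_smul_right]; ring)
  rw [real_inner_comm e d] at this
  linarith

lemma inner_deriv_mulY_sq {a b c m e d : L2Line} (hab : WeakD a b) (hbc : WeakD b c)
    (hm : IsMulY a m) (he : IsMulY b e) (hd : IsMulY m d) :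
    ⟪c, d⟫ = -⟪e, e⟫ - 2 * ⟪e, a⟫ := by
  have := inner_weight_eq_zero hbc hab (w := fun y => y ^ 2) (w' := fun y => 2 * y)
    hasDerivAt_sq (by fun_prop) b d e a c d e e 2
    (by filter_upwards [hm, hd] with y h3 h4
        rw [h4, h3]; simp only [real_inner_smul_right]; ring)
    (by filter_upwards [he] with y h3
        rw [h3]; simp only [real_inner_smul_left]; ring)
    (by filter_upwards [hm, hd] with y h3 h4
        rw [h4, h3]; simp only [real_inner_smul_right]; ring)
    (by filter_upwards [he] with y h3
        rw [h3]; simp only [real_inner_smul_left, real_inner_smul_right]; ring)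
  linarith

lemma two_inner_mulY_deriv {a b m e : L2Line} (hab : WeakD a b)
    (hm : IsMulY a m) (he : IsMulY b e) : 2 * ⟪e, a⟫ = -⟪a, a⟫ := by
  have h1 := inner_mulY_eq_zero hab hab hm he
  have h2 := hm.inner_comm he
  rw [h2, real_inner_comm e a] at h1
  linarith

lemma exists_line_of_memLp {f : ℝ → ℂ} (hf : MemLp f 2 volume) :
    ∃ a : L2Line, a =ᵐ[volume] f := ⟨hf.toLp f, hf.coeFn_toLp⟩

lemma exists_mulY_of_sq {a : L2Line} {d : L2Line} (hd : ∀ᵐ y : ℝ, d y = (y ^ 2) • a y) :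
    ∃ m, IsMulY a m ∧ IsMulY m d := by
  have hmem : MemLp (fun y : ℝ => y • a y) 2 volume := by
    refine MemLp.mono' ((Lp.memLp a).norm.add (Lp.memLp d).norm) ?_ ?_
    · exact continuous_id.aestronglyMeasurable.smul (Lp.aestronglyMeasurable a)
    · filter_upwards [hd] with y hy
      rw [norm_smul, Pi.add_apply, hy, norm_smul, Real.norm_eq_abs, Real.norm_eq_abs, abs_pow]
      nlinarith [norm_nonneg (a y), sq_nonneg (|y| - 1), abs_nonneg y,
        mul_nonneg (norm_nonneg (a y)) (sq_nonneg (|y| - 1)), mul_nonneg (norm_nonneg (a y))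
        (sq_nonneg (|y|))]
  obtain ⟨m, hm⟩ := exists_line_of_memLp hmem
  refine ⟨m, hm, ?_⟩
  filter_upwards [hm, hd] with y h1 h2
  rw [h1, h2, smul_smul, sq]

/-- If `a, a', a'', y² a` are in `L²`, then so is `y a'`. -/
lemma exists_mulY_deriv {a b c m d : L2Line} (hab : WeakD a b) (hbc : WeakD b c)
    (hm : IsMulY a m) (hd : IsMulY m d) : ∃ e, IsMulY b e := by
  set ε : ℕ → ℝ := fun n => 1 / ((n : ℝ) + 1) with hε
  have hε0 : ∀ n, 0 < ε n := fun n => by positivity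
  have hpos : ∀ n y, 0 < 1 + ε n * y ^ 2 := fun n y => by
    have := mul_nonneg (hε0 n).le (sq_nonneg y); linarith
  -- bounded weights increasing to `y²`
  set w : ℕ → ℝ → ℝ := fun n y => y ^ 2 / (1 + ε n * y ^ 2) with hw
  set w' : ℕ → ℝ → ℝ := fun n y => 2 * y / (1 + ε n * y ^ 2) ^ 2 with hw'
  have hwd : ∀ n y, HasDerivAt (w n) (w' n y) y := by
    intro n y
    have h1 : HasDerivAt (fun y : ℝ => 1 + ε n * y ^ 2) (ε n * (2 * y)) y :=
      ((hasDerivAt_sq y).const_mul (ε n)).const_add 1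
    refine ((hasDerivAt_sq y).div h1 (hpos n y).ne').congr_deriv ?_
    simp only [hw']
    congr 1; ring
  have hwc' : ∀ n, Continuous (w' n) := fun n =>
    Continuous.div (by fun_prop) (by fun_prop) fun y => (pow_pos (hpos n y) 2).ne'
  have hwc : ∀ n, Continuous (w n) := fun n =>
    Continuous.div (by fun_prop) (by fun_prop) fun y => (hpos n y).ne'
  have hone : ∀ n y, 1 ≤ 1 + ε n * y ^ 2 := fun n y => by
    have := mul_nonneg (hε0 n).le (sq_nonneg y); linarith
  have hw0 : ∀ n y, 0 ≤ w n y := fun n y => div_nonneg (sq_nonneg y) (hpos n y).le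
  have hwle : ∀ n y, w n y ≤ y ^ 2 := fun n y => div_le_self (sq_nonneg y) (hone n y)
  have hwb : ∀ n y, |w n y| ≤ (n : ℝ) + 1 := by
    intro n y
    rw [abs_of_nonneg (hw0 n y), hw, div_le_iff₀ (hpos n y)]
    have e : ((n : ℝ) + 1) * (1 + ε n * y ^ 2) = (n : ℝ) + 1 + y ^ 2 := by
      simp only [hε]; field_simp
    rw [e]
    have : (0 : ℝ) ≤ n := Nat.cast_nonneg n
    linarith
  have hwb' : ∀ n y, |w' n y| ≤ 2 * |y| := by
    intro n y
    rw [hw', abs_div, abs_mul, abs_two, abs_of_pos (pow_pos (hpos n y) 2)]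
    exact div_le_self (by positivity) (one_le_pow₀ (hone n y))
  have hma : ∀ x : L2Line, AEStronglyMeasurable x volume := fun x => Lp.aestronglyMeasurable x
  have hw'i : ∀ n, Integrable fun y => w' n y * ⟪b y, a y⟫ := by
    intro n
    refine ((line_integrable_inner b m).const_mul 2).mono
      ((hwc' n).aestronglyMeasurable.mul ((hma b).inner (hma a))) ?_
    filter_upwards [hm] with y hy
    rw [hy, real_inner_smul_right, norm_mul, norm_mul, norm_mul, Real.norm_eq_abs 2, abs_two,
      ← mul_assoc]
    exact mul_le_mul_of_nonneg_right (hwb' n y) (norm_nonneg _)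
  have hwi : ∀ n, ∀ x z : L2Line, Integrable fun y => w n y * ⟪x y, z y⟫ := fun n x z =>
    (line_integrable_inner x z).bdd_mul (hwc n).aestronglyMeasurable (Eventually.of_forall (hwb n))
  set C₀ : ℝ := ∫ y, (2 * (‖b y‖ * ‖m y‖) + ‖c y‖ * ‖d y‖) with hC₀
  have hnn : ∀ x z : L2Line, Integrable fun y => ‖x y‖ * ‖z y‖ := fun x z =>
    (Lp.memLp x).norm.integrable_mul (Lp.memLp z).norm
  have hbound : ∀ n, ∫ y, w n y * ‖b y‖ ^ 2 ≤ C₀ := by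
    intro n
    have h1 := integral_weight_eq_zero hbc hab (hwd n) (hwc' n) (hwi n b a) (by
      refine (hw'i n).add ?_
      refine ((hwi n c a).add (hwi n b b)).congr (Eventually.of_forall fun y => ?_)
      simp only [Pi.add_apply]; ring)
    have e1 : (fun y => w' n y * ⟪b y, a y⟫ + w n y * (⟪c y, a y⟫ + ⟪b y, b y⟫))
        = fun y => (w' n y * ⟪b y, a y⟫ + w n y * ⟪c y, a y⟫) + w n y * ‖b y‖ ^ 2 := by
      ext y
      rw [real_inner_self_eq_norm_sq]; ring
    have hi2 : Integrable fun y => w n y * ‖b y‖ ^ 2 :=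
      (hwi n b b).congr (Eventually.of_forall fun y => by
        simp only [real_inner_self_eq_norm_sq])
    have hi1 : Integrable fun y => w' n y * ⟪b y, a y⟫ + w n y * ⟪c y, a y⟫ :=
      (hw'i n).add (hwi n c a)
    rw [e1, integral_add hi1 hi2] at h1
    have h2 : ∫ y, w n y * ‖b y‖ ^ 2 = ∫ y, -(w' n y * ⟪b y, a y⟫ + w n y * ⟪c y, a y⟫) := by
      rw [integral_neg]; linarith
    rw [h2]
    refine integral_mono_ae hi1.neg
      (((hnn b m).const_mul 2).add (hnn c d)) ?_
    filter_upwards [hm, hd] with y h3 h4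
    have b1 := abs_real_inner_le_norm (b y) (a y)
    have b2 := abs_real_inner_le_norm (c y) (a y)
    have e3 : ‖m y‖ = |y| * ‖a y‖ := by rw [h3, norm_smul, Real.norm_eq_abs]
    have e4 : ‖d y‖ = y ^ 2 * ‖a y‖ := by
      rw [h4, h3, smul_smul, norm_smul, Real.norm_eq_abs, abs_mul_self, sq]
    rw [e3, e4]
    have b3 : |w' n y * ⟪b y, a y⟫| ≤ 2 * |y| * (‖b y‖ * ‖a y‖) := by
      rw [abs_mul]; exact mul_le_mul (hwb' n y) b1 (abs_nonneg _) (by positivity)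
    have b4 : |w n y * ⟪c y, a y⟫| ≤ y ^ 2 * (‖c y‖ * ‖a y‖) := by
      rw [abs_mul, abs_of_nonneg (hw0 n y)]
      exact mul_le_mul (hwle n y) b2 (abs_nonneg _) (by positivity)
    have := neg_abs_le (w' n y * ⟪b y, a y⟫)
    have := neg_abs_le (w n y * ⟪c y, a y⟫)
    linarith
  have hεt : Tendsto ε atTop (𝓝 0) := tendsto_one_div_add_atTop_nhds_zero_nat
  have hwt : ∀ y, Tendsto (fun n => w n y) atTop (𝓝 (y ^ 2)) := by
    intro y
    have h1 : Tendsto (fun n => 1 + ε n * y ^ 2) atTop (𝓝 1) := by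
      simpa using (hεt.mul_const (y ^ 2)).const_add 1
    have h5 := (tendsto_const_nhds (x := y ^ 2)).div h1 one_ne_zero
    rw [div_one] at h5
    exact h5
  have hfatou : ∫⁻ y, ENNReal.ofReal (y ^ 2 * ‖b y‖ ^ 2) ≤ ENNReal.ofReal C₀ := by
    calc ∫⁻ y, ENNReal.ofReal (y ^ 2 * ‖b y‖ ^ 2)
        = ∫⁻ y, liminf (fun n => ENNReal.ofReal (w n y * ‖b y‖ ^ 2)) atTop := by
          refine lintegral_congr fun y => ?_
          exact (ENNReal.tendsto_ofReal ((hwt y).mul_const _)).liminf_eq.symm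
      _ ≤ liminf (fun n => ∫⁻ y, ENNReal.ofReal (w n y * ‖b y‖ ^ 2)) atTop := by
          refine lintegral_liminf_le' fun n => ?_
          exact ((hwc n).measurable.aemeasurable.mul
            ((hma b).norm.aemeasurable.pow_const 2)).ennreal_ofReal
      _ ≤ ENNReal.ofReal C₀ := by
          refine liminf_le_of_le (by isBoundedDefault) fun r hr => ?_
          obtain ⟨n, hn⟩ := hr.exists
          refine hn.trans ?_
          rw [← ofReal_integral_eq_lintegral_ofReal]
          · exact ENNReal.ofReal_le_ofReal (hbound n)
          · exact (hwi n b b).congr (Eventually.of_forall fun y => by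
              simp only [real_inner_self_eq_norm_sq])
          · exact Eventually.of_forall fun y => mul_nonneg (hw0 n y) (sq_nonneg _)
  have hmeas : AEStronglyMeasurable (fun y : ℝ => y • b y) volume :=
    continuous_id.aestronglyMeasurable.smul (hma b)
  have hmem : MemLp (fun y : ℝ => y • b y) 2 volume := by
    rw [memLp_two_iff_integrable_sq_norm hmeas]
    refine ⟨hmeas.norm.pow 2, ?_⟩
    rw [hasFiniteIntegral_iff_ofReal (Eventually.of_forall fun y => sq_nonneg _)]
    refine lt_of_le_of_lt ?_ (lt_of_le_of_lt hfatou ENNReal.ofReal_lt_top)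
    refine le_of_eq (lintegral_congr fun y => ?_)
    rw [norm_smul, mul_pow, Real.norm_eq_abs, sq_abs]
  exact exists_line_of_memLp hmem

end WeakDerivative

/-! ### The stream function and weak solvability -/

section Stream

/-- `φ` is the amplitude of the stream function of the vorticity with amplitude `a` at
`x`-frequency `k`: `φ'' - k² φ = a`, with `φ₁ = φ'`. -/
structure IsAmpStream (k : ℝ) (a φ φ₁ : L2Line) : Prop where
  deriv : WeakD φ φ₁
  deriv_deriv : WeakD φ₁ (k ^ 2 • φ + a)

variable {k : ℝ} {a φ φ₁ a' φ' φ₁' : L2Line}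

lemma IsAmpStream.add (h : IsAmpStream k a φ φ₁) (h' : IsAmpStream k a' φ' φ₁') :
    IsAmpStream k (a + a') (φ + φ') (φ₁ + φ₁') := by
  refine ⟨h.1.add h'.1, ?_⟩
  have := h.2.add h'.2
  rwa [show k ^ 2 • φ + a + (k ^ 2 • φ' + a') = k ^ 2 • (φ + φ') + (a + a') by
    rw [smul_add]; abel] at this

lemma IsAmpStream.smul (r : ℝ) (h : IsAmpStream k a φ φ₁) :
    IsAmpStream k (r • a) (r • φ) (r • φ₁) := by
  refine ⟨h.1.smul r, ?_⟩
  have := h.2.smul r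
  rwa [smul_add, smul_comm] at this

lemma IsAmpStream.inner_eq (h : IsAmpStream k a φ φ₁) (h' : IsAmpStream k a' φ' φ₁') :
    ⟪a, φ'⟫ = -⟪φ₁, φ₁'⟫ - k ^ 2 * ⟪φ, φ'⟫ := by
  have := h.2.inner_eq_neg h'.1
  rw [inner_add_left, real_inner_smul_left] at this
  linarith

lemma IsAmpStream.inner_comm (h : IsAmpStream k a φ φ₁) (h' : IsAmpStream k a' φ' φ₁') :
    ⟪φ, a'⟫ = ⟪a, φ'⟫ := by
  rw [real_inner_comm, h'.inner_eq h, h.inner_eq h', real_inner_comm φ₁, real_inner_comm φ]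

lemma IsAmpStream.inner_I (h : IsAmpStream k a φ φ₁) : ⟪a, Complex.I • φ⟫ = 0 := by
  have := h.2.inner_eq_neg h.1.mulI
  rw [inner_add_left, real_inner_smul_left, line_inner_I_self, line_inner_I_self] at this
  linarith

lemma IsAmpStream.norm_le (h : IsAmpStream k a φ φ₁) : k ^ 2 * ‖φ‖ ≤ ‖a‖ := by
  have h1 := h.inner_eq h
  rw [real_inner_self_eq_norm_sq, real_inner_self_eq_norm_sq] at h1
  have h2 := abs_real_inner_le_norm a φ
  have h3 := neg_abs_le ⟪a, φ⟫
  rcases (norm_nonneg φ).eq_or_lt with h0 | h0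
  · rw [← h0]; simp
  · have : (k ^ 2 * ‖φ‖) * ‖φ‖ ≤ ‖a‖ * ‖φ‖ := by nlinarith [sq_nonneg ‖φ₁‖]
    exact le_of_mul_le_mul_right this h0

/-- A virial identity: multiply `φ'' - k² φ = a` by `y φ'`. -/
lemma IsAmpStream.inner_mulY {m : L2Line} (h : IsAmpStream k a φ φ₁) (hm : IsMulY a m) :
    2 * ⟪m, φ₁⟫ = k ^ 2 * ⟪φ, φ⟫ - ⟪φ₁, φ₁⟫ := by
  obtain ⟨U, hU, hU'⟩ := h.1.exists_prim
  obtain ⟨V, hV, hV'⟩ := h.2.exists_prim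
  have hp := (hV'.inner hV').sub ((hU'.inner hU').const_mul (k ^ 2))
  have hsum : ∀ᵐ y, (k ^ 2 • φ + a : L2Line) y = k ^ 2 • φ y + a y := by
    filter_upwards [Lp.coeFn_add (k ^ 2 • φ) a, Lp.coeFn_smul (k ^ 2) φ] with y h1 h2
    rw [h1, Pi.add_apply, h2, Pi.smul_apply]
  -- the derivative of `|φ'|² - k² |φ|²` is `2 ⟨a, φ'⟩`
  have e1 : (fun y => ⟪(k ^ 2 • φ + a : L2Line) y, V y⟫ + ⟪V y, (k ^ 2 • φ + a : L2Line) y⟫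
      - k ^ 2 * (⟪φ₁ y, U y⟫ + ⟪U y, φ₁ y⟫)) =ᵐ[volume] fun y => 2 * ⟪a y, φ₁ y⟫ := by
    filter_upwards [hU, hV, hsum] with y h1 h2 h3
    rw [h3, ← h1, ← h2]
    simp only [inner_add_left, inner_add_right, real_inner_smul_left, real_inner_smul_right]
    rw [real_inner_comm (φ y) (φ₁ y), real_inner_comm (a y) (φ₁ y)]
    ring
  have hp' := hp.congr e1
  have e0 : (fun y => ⟪φ₁ y, φ₁ y⟫ - k ^ 2 * ⟪φ y, φ y⟫) =ᵐ[volume]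
      fun y => ⟪V y, V y⟫ - k ^ 2 * ⟪U y, U y⟫ := by
    filter_upwards [hU, hV] with y h1 h2
    rw [h1, h2]
  have i0 : Integrable fun y => ⟪φ₁ y, φ₁ y⟫ - k ^ 2 * ⟪φ y, φ y⟫ :=
    (line_integrable_inner φ₁ φ₁).sub ((line_integrable_inner φ φ).const_mul _)
  have e2 : (fun y => 2 * ⟪m y, φ₁ y⟫) =ᵐ[volume] fun y => y * (2 * ⟪a y, φ₁ y⟫) := by
    filter_upwards [hm] with y h1
    rw [h1, real_inner_smul_left]; ring
  have i2 := (line_integrable_inner m φ₁).const_mul 2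
  have hz := hp'.integral_id_mul_eq_zero (i0.congr e0)
    ((line_integrable_inner a φ₁).const_mul 2) (i2.congr e2)
  have e3 : (fun y => ⟪V y, V y⟫ - k ^ 2 * ⟪U y, U y⟫ + y * (2 * ⟪a y, φ₁ y⟫)) =ᵐ[volume]
      fun y => (⟪φ₁ y, φ₁ y⟫ - k ^ 2 * ⟪φ y, φ y⟫) + 2 * ⟪m y, φ₁ y⟫ := by
    filter_upwards [e0, e2] with y h1 h2
    rw [← h1, ← h2]
  rw [integral_congr_ae e3, integral_add i0 i2,
    integral_sub (line_integrable_inner φ₁ φ₁) ((line_integrable_inner φ φ).const_mul _),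
    integral_const_mul, integral_const_mul] at hz
  rw [line_inner_def, line_inner_def, line_inner_def]
  linarith

lemma isClosed_weakD (r : ℝ) : IsClosed {p : WithLp 2 (L2Line × L2Line) | WeakD p.fst (r • p.snd)} := by
  simp only [WeakD, ofPred_forall]
  refine isClosed_iInter fun χ => isClosed_eq ?_ ?_
  · exact (WithLp.fstL 2 ℝ L2Line L2Line).continuous.inner continuous_const
  · exact (((WithLp.sndL 2 ℝ L2Line L2Line).continuous.const_smul r).inner continuous_const).neg

/-- Every vorticity amplitude has a stream function, by the Riesz representation theorem in the
space `H¹` with the scalar product `k² ⟨φ, χ⟩ + ⟨φ', χ'⟩`. -/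
lemma exists_ampStream (hk : 0 < k) (a : L2Line) : ∃ φ φ₁, IsAmpStream k a φ φ₁ := by
  -- `H¹` is realised as the closed space of pairs `(k φ, φ')`
  let G : Submodule ℝ (WithLp 2 (L2Line × L2Line)) :=
    { carrier := {p | WeakD p.fst (k • p.snd)}
      add_mem' := fun {p q} hp hq => by
        have := WeakD.add hp hq
        rwa [← smul_add] at this
      zero_mem' := fun χ => by simp
      smul_mem' := fun r p hp => by
        have := WeakD.smul r hp
        rwa [smul_comm] at this }
  have hGc : IsClosed (G : Set (WithLp 2 (L2Line × L2Line))) := isClosed_weakD k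
  have : CompleteSpace G := hGc.completeSpace_coe
  let z : WithLp 2 (L2Line × L2Line) := WithLp.toLp 2 (-(k⁻¹ • a), 0)
  let T : G →L[ℝ] ℝ := (innerSL ℝ z).comp G.subtypeL
  let q : G := (InnerProductSpace.toDual ℝ G).symm T
  have hq : ∀ p : G, ⟪(q : WithLp 2 (L2Line × L2Line)), p⟫ = ⟪z, (p : WithLp 2 (L2Line × L2Line))⟫ := by
    intro p
    have : ⟪q, p⟫ = T p := InnerProductSpace.toDual_symm_apply
    rw [← Submodule.coe_inner, this]
    rfl
  refine ⟨k⁻¹ • (q : WithLp 2 (L2Line × L2Line)).fst, (q : WithLp 2 (L2Line × L2Line)).snd, ?_, ?_⟩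
  · have h1 : WeakD (q : WithLp 2 (L2Line × L2Line)).fst
      (k • (q : WithLp 2 (L2Line × L2Line)).snd) := q.2
    have := h1.smul k⁻¹
    rwa [smul_smul, inv_mul_cancel₀ hk.ne', one_smul] at this
  · intro χ
    have hp : WeakD (k • testToLp χ) (k • testToLp (testDeriv χ)) := by
      refine WeakD.smul k fun η => ?_
      have e : ∀ χ η : testSpace, ⟪testToLp χ, testToLp η⟫ = ∫ y, ⟪(χ : ℝ → ℂ) y, (η : ℝ → ℂ) y⟫ := by
        intro χ η
        rw [line_inner_def]
        refine integral_congr_ae ?_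
        filter_upwards [coeFn_testToLp χ, coeFn_testToLp η] with y h1 h2
        rw [h1, h2]
      rw [e, e]
      have hd : ∀ y, HasDerivAt (fun y => ⟪(χ : ℝ → ℂ) y, (η : ℝ → ℂ) y⟫)
          (⟪(χ : ℝ → ℂ) y, (testDeriv η : ℝ → ℂ) y⟫ + ⟪(testDeriv χ : ℝ → ℂ) y, (η : ℝ → ℂ) y⟫) y :=
        fun y => (testSpace_hasDerivAt χ y).inner ℝ (testSpace_hasDerivAt η y)
      have hi : ∀ χ η : testSpace, Integrable fun y => ⟪(χ : ℝ → ℂ) y, (η : ℝ → ℂ) y⟫ := by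
        intro χ η
        refine (line_integrable_inner (testToLp χ) (testToLp η)).congr ?_
        filter_upwards [coeFn_testToLp χ, coeFn_testToLp η] with y h1 h2
        rw [h1, h2]
      have := integral_eq_zero_of_hasDerivAt_of_integrable hd
        ((hi χ (testDeriv η)).add (hi (testDeriv χ) η)) (hi χ η)
      rw [integral_add (hi χ (testDeriv η)) (hi (testDeriv χ) η)] at this
      linarith
    let p : G := ⟨WithLp.toLp 2 (k • testToLp χ, testToLp (testDeriv χ)), hp⟩
    have h1 := hq p
    simp only [WithLp.prod_inner_apply] at h1
    change ⟪(q : WithLp 2 (L2Line × L2Line)).fst, k • testToLp χ⟫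
      + ⟪(q : WithLp 2 (L2Line × L2Line)).snd, testToLp (testDeriv χ)⟫
      = ⟪-(k⁻¹ • a), k • testToLp χ⟫ + ⟪(0 : L2Line), testToLp (testDeriv χ)⟫ at h1
    rw [inner_zero_left, inner_neg_left, real_inner_smul_left, real_inner_smul_right,
      real_inner_smul_right] at h1
    rw [inner_add_left, smul_smul, real_inner_smul_left]
    have e : k ^ 2 * k⁻¹ = k := by field_simp
    have e' : k⁻¹ * (k * ⟪a, testToLp χ⟫) = ⟪a, testToLp χ⟫ := by field_simp
    rw [e]
    linarith

end Stream

/-- A linear functional `f` on `V` that is bounded in terms of a linear map `J` into a Hilbert space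
is represented through `J`. -/
lemma exists_inner_of_bound {V H : Type*} [AddCommGroup V] [Module ℝ V] [NormedAddCommGroup H]
    [InnerProductSpace ℝ H] [CompleteSpace H] (J : V →ₗ[ℝ] H) (f : V →ₗ[ℝ] ℝ) {C : ℝ}
    (hf : ∀ χ, |f χ| ≤ C * ‖J χ‖) : ∃ b : H, ∀ χ, f χ = ⟪b, J χ⟫ := by
  obtain ⟨s, hs⟩ := LinearMap.exists_rightInverse_of_surjective J.rangeRestrict
    (LinearMap.range_rangeRestrict J)
  have hs' : ∀ r, J (s r) = r := fun r => congrArg Subtype.val (LinearMap.congr_fun hs r)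
  let g : LinearMap.range J →L[ℝ] ℝ := (f.comp s).mkContinuous C fun r => by
    have := hf (s r)
    rw [hs'] at this
    exact this
  obtain ⟨G, hG, -⟩ := exists_extension_norm_eq (𝕜 := ℝ) (LinearMap.range J) g
  refine ⟨(InnerProductSpace.toDual ℝ H).symm G, fun χ => ?_⟩
  rw [InnerProductSpace.toDual_symm_apply]
  have h1 : G (J χ) = f (s (J.rangeRestrict χ)) := hG (J.rangeRestrict χ)
  have h2 : f (χ - s (J.rangeRestrict χ)) = 0 := by
    have h3 := hf (χ - s (J.rangeRestrict χ))
    have h4 : J (χ - s (J.rangeRestrict χ)) = 0 := by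
      rw [map_sub, hs', sub_eq_zero]; rfl
    rw [h4, norm_zero, mul_zero] at h3
    exact abs_nonpos_iff.1 h3
  rw [map_sub] at h2
  rw [h1]
  linarith

/-- Multiplication by `y²` is determined by testing. -/
lemma mulY_sq_of_test {a d : L2Line}
    (h : ∀ χ, ⟪d, testToLp χ⟫ = ⟪a, testToLp (testMulY (testMulY χ))⟫) :
    ∀ᵐ y : ℝ, d y = (y ^ 2) • a y := by
  have key : ∀ (z : ℂ) (η : ℝ → ℝ), ContDiff ℝ ((⊤ : ℕ∞) : WithTop ℕ∞) η → HasCompactSupport η →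
      ∫ y, η y • ⟪d y, z⟫ = ∫ y, η y • (y ^ 2 * ⟪a y, z⟫) := by
    intro z η hη hc
    let χ : testSpace := ⟨fun y => η y • z, hη.smul contDiff_const, hc.smul_right (f' := fun _ => z)⟩
    have h1 := h χ
    rw [line_inner_def, line_inner_def] at h1
    rw [integral_congr_ae (g := fun y => ⟪d y, testToLp χ y⟫), h1]
    · refine integral_congr_ae ?_
      filter_upwards [coeFn_testToLp (testMulY (testMulY χ))] with y hy
      rw [hy]
      change ⟪a y, y • y • η y • z⟫ = _
      simp only [real_inner_smul_right, smul_eq_mul]; ring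
    · filter_upwards [coeFn_testToLp χ] with y hy
      rw [hy]
      change _ = ⟪d y, η y • z⟫
      rw [real_inner_smul_right, smul_eq_mul]
  have hloc : ∀ f : ℝ → ℝ, LocallyIntegrable f volume →
      LocallyIntegrable (fun y => y ^ 2 * f y) volume := by
    intro f hf
    exact (locallyIntegrableOn_univ.1 ((locallyIntegrableOn_univ.2 hf).continuousOn_mul
      (g := fun y : ℝ => y ^ 2) (by fun_prop) isOpen_univ.isLocallyClosed))
  have hre := ae_eq_of_integral_contDiff_smul_eq (f := fun y => (d y).re)
    (f' := fun y => y ^ 2 * (a y).re) ((line_memLp_re d).locallyIntegrable (by norm_num))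
    (hloc _ ((line_memLp_re a).locallyIntegrable (by norm_num)))
    (by simpa [complex_inner_eq] using key 1)
  have him := ae_eq_of_integral_contDiff_smul_eq (f := fun y => (d y).im)
    (f' := fun y => y ^ 2 * (a y).im) ((line_memLp_im d).locallyIntegrable (by norm_num))
    (hloc _ ((line_memLp_im a).locallyIntegrable (by norm_num)))
    (by simpa [complex_inner_eq] using key Complex.I)
  filter_upwards [hre, him] with y h1 h2
  refine Complex.ext ?_ ?_
  · rw [h1, Complex.smul_re, smul_eq_mul]
  · rw [h2, Complex.smul_im, smul_eq_mul]

/-! ### The energy form and its dissipation -/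

/-- The amplitude `a` lies in the domain of the linear operator at `x`-frequency `k`: with
`b = a'`, `c = a''`, `m = y a`, `e = y a'`, `d = y² a` all in `L²`, and `φ` the stream function of
`a`. -/
structure IsAmpDomain (k : ℝ) (a b c m e d φ φ₁ : L2Line) : Prop where
  deriv : WeakD a b
  deriv_deriv : WeakD b c
  mulY : IsMulY a m
  mulY_deriv : IsMulY b e
  mulY_mulY : IsMulY m d
  stream : IsAmpStream k a φ φ₁

/-- The amplitude `a` has finite energy: `b = a'` and `m = y a` are in `L²`, and `φ` is the stream
function of `a`. -/
structure IsAmpEnergy (k : ℝ) (a b m φ φ₁ : L2Line) : Prop where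
  deriv : WeakD a b
  mulY : IsMulY a m
  stream : IsAmpStream k a φ φ₁

lemma IsAmpDomain.energy {k : ℝ} {a b c m e d φ φ₁ : L2Line}
    (h : IsAmpDomain k a b c m e d φ φ₁) : IsAmpEnergy k a b m φ φ₁ := ⟨h.deriv, h.mulY, h.stream⟩

lemma IsAmpDomain.add {k : ℝ} {a b c m e d φ φ₁ a' b' c' m' e' d' φ' φ₁' : L2Line}
    (h : IsAmpDomain k a b c m e d φ φ₁) (h' : IsAmpDomain k a' b' c' m' e' d' φ' φ₁') :
    IsAmpDomain k (a + a') (b + b') (c + c') (m + m') (e + e') (d + d') (φ + φ') (φ₁ + φ₁') :=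
  ⟨h.1.add h'.1, h.2.add h'.2, h.3.add h'.3, h.4.add h'.4, h.5.add h'.5, h.6.add h'.6⟩

lemma IsAmpDomain.smul {k : ℝ} {a b c m e d φ φ₁ : L2Line} (r : ℝ)
    (h : IsAmpDomain k a b c m e d φ φ₁) :
    IsAmpDomain k (r • a) (r • b) (r • c) (r • m) (r • e) (r • d) (r • φ) (r • φ₁) :=
  ⟨h.1.smul r, h.2.smul r, h.3.smul r, h.4.smul r, h.5.smul r, h.6.smul r⟩

/-- The linearized Navier--Stokes operator `ν (∂² - k²) a - i k y² a + 2 i k φ` on amplitudes. -/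
def ampL (ν k : ℝ) (a c d φ : L2Line) : L2Line :=
  ν • (c - k ^ 2 • a) - k • (Complex.I • d) + (2 * k) • (Complex.I • φ)

/-- The operator of the quadratic form
`‖a‖² + A (‖a'‖² + k² ‖a‖²) + B ⟨i y a, a'⟩ + G (‖y a‖² + 2 ‖φ'‖² + 2 k² ‖φ‖²)`. -/
def ampP (A B G k : ℝ) (a c e d φ : L2Line) : L2Line :=
  a + A • (k ^ 2 • a - c) - B • ((1 / 2 : ℝ) • (Complex.I • a) + Complex.I • e) + G • (d - (2 : ℝ) • φ)

/-- The polarization of the quadratic form of `ampP`, in terms of `b = a'`, `m = y a` and the stream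
function `φ` with derivative `φ₁`. -/
def energyForm (A B G k : ℝ) (a b m φ φ₁ a' b' m' φ' φ₁' : L2Line) : ℝ :=
  ⟪a, a'⟫ + A * (⟪b, b'⟫ + k ^ 2 * ⟪a, a'⟫) + B / 2 * (⟪Complex.I • m, b'⟫ + ⟪Complex.I • m', b⟫)
    + G * (⟪m, m'⟫ + 2 * (⟪φ₁, φ₁'⟫ + k ^ 2 * ⟪φ, φ'⟫))

section Form

variable {A B G k : ℝ} {a b c m e d φ φ₁ a' b' m' φ' φ₁' : L2Line}

lemma energyForm_comm : energyForm A B G k a b m φ φ₁ a' b' m' φ' φ₁'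
    = energyForm A B G k a' b' m' φ' φ₁' a b m φ φ₁ := by
  simp only [energyForm]
  rw [real_inner_comm a a', real_inner_comm b b', real_inner_comm m m', real_inner_comm φ φ',
    real_inner_comm φ₁ φ₁']
  ring

/-- `ampP` represents the energy form; its second argument only needs to have finite energy. -/
lemma inner_ampP (h : IsAmpDomain k a b c m e d φ φ₁) (h' : IsAmpEnergy k a' b' m' φ' φ₁') :
    ⟪ampP A B G k a c e d φ, a'⟫ = energyForm A B G k a b m φ φ₁ a' b' m' φ' φ₁' := by
  have h1 := h.deriv_deriv.inner_eq_neg h'.deriv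
  have h2 := h.mulY_mulY.inner_comm h'.mulY
  have h3 := h.stream.inner_comm h'.stream
  rw [h.stream.inner_eq h'.stream] at h3
  have h4 := inner_mulY_eq_zero h.deriv.mulI h'.deriv h.mulY.mulI h.mulY_deriv.mulI
  have h5 : ⟪Complex.I • m', b⟫ = -⟪Complex.I • e, a'⟫ := by
    rw [line_inner_I_left, ← line_inner_I_left, h'.mulY.mulI.inner_comm h.mulY_deriv,
      real_inner_comm, ← neg_neg ⟪e, Complex.I • a'⟫, ← line_inner_I_left]
  simp only [ampP, energyForm, inner_add_left, inner_sub_left, real_inner_smul_left]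
  rw [h1, h2, h3, h5]
  linear_combination (-B / 2) * h4

lemma energyForm_self : energyForm A B G k a b m φ φ₁ a b m φ φ₁
    = ‖a‖ ^ 2 + A * (‖b‖ ^ 2 + k ^ 2 * ‖a‖ ^ 2) + B * ⟪Complex.I • m, b⟫
      + G * (‖m‖ ^ 2 + 2 * (‖φ₁‖ ^ 2 + k ^ 2 * ‖φ‖ ^ 2)) := by
  simp only [energyForm, real_inner_self_eq_norm_sq]; ring

lemma norm_I_smul (m : L2Line) : ‖Complex.I • m‖ = ‖m‖ := by
  rw [norm_smul, Complex.norm_I, one_mul]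

lemma energyForm_self_nonneg (hA : 0 ≤ A) (hG : 0 ≤ G) (hB : B ^ 2 ≤ 4 * A * G) :
    0 ≤ energyForm A B G k a b m φ φ₁ a b m φ φ₁ := by
  rw [energyForm_self]
  have h1 := abs_real_inner_le_norm (Complex.I • m) b
  rw [norm_I_smul] at h1
  have h2 : |B| * (‖m‖ * ‖b‖) ≤ A * ‖b‖ ^ 2 + G * ‖m‖ ^ 2 := by
    refine abs_le_of_sq_le_sq' ?_ (by positivity) |>.2
    rw [mul_pow, sq_abs]
    have h3 : B ^ 2 * (‖m‖ * ‖b‖) ^ 2 ≤ 4 * A * G * (‖m‖ * ‖b‖) ^ 2 := by gcongr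
    nlinarith [sq_nonneg (A * ‖b‖ ^ 2 - G * ‖m‖ ^ 2)]
  have h4 : -(|B| * (‖m‖ * ‖b‖)) ≤ B * ⟪Complex.I • m, b⟫ := by
    have h5 : |B * ⟪Complex.I • m, b⟫| ≤ |B| * (‖m‖ * ‖b‖) := by
      rw [abs_mul]; gcongr
    linarith [neg_abs_le (B * ⟪Complex.I • m, b⟫)]
  have h6 : 0 ≤ A * (k ^ 2 * ‖a‖ ^ 2) := by positivity
  have h7 : 0 ≤ G * (2 * (‖φ₁‖ ^ 2 + k ^ 2 * ‖φ‖ ^ 2)) := by positivity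
  nlinarith [sq_nonneg ‖a‖]

/-- Cauchy--Schwarz for the energy form, in additive form. -/
lemma two_energyForm_le (hA : 0 ≤ A) (hG : 0 ≤ G) (hB : B ^ 2 ≤ 4 * A * G) :
    2 * energyForm A B G k a b m φ φ₁ a' b' m' φ' φ₁' ≤
      energyForm A B G k a b m φ φ₁ a b m φ φ₁
        + energyForm A B G k a' b' m' φ' φ₁' a' b' m' φ' φ₁' := by
  have h := energyForm_self_nonneg (k := k) (a := a - a') (b := b - b') (m := m - m') (φ := φ - φ')
    (φ₁ := φ₁ - φ₁') hA hG hB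
  simp only [energyForm, smul_sub, inner_sub_left, inner_sub_right] at h ⊢
  rw [real_inner_comm a a', real_inner_comm b b', real_inner_comm m m', real_inner_comm φ φ',
    real_inner_comm φ₁ φ₁'] at h
  linarith

end Form

section Dissipation

variable {ν k : ℝ} {a b c m e d φ φ₁ : L2Line}

lemma line_inner_I_right (a b : L2Line) : ⟪a, Complex.I • b⟫ = -⟪b, Complex.I • a⟫ := by
  rw [← line_inner_I_left, real_inner_comm]

lemma inner_ampL (h : IsAmpDomain k a b c m e d φ φ₁) :
    ⟪a, ampL ν k a c d φ⟫ = -ν * (‖b‖ ^ 2 + k ^ 2 * ‖a‖ ^ 2) := by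
  have h1 := h.deriv_deriv.inner_eq_neg h.deriv
  have h2 := h.stream.inner_I
  have h3 := h.mulY_mulY.inner_comm h.mulY.mulI
  rw [line_inner_I_self] at h3
  rw [real_inner_self_eq_norm_sq] at h1
  simp only [ampL, inner_add_right, inner_sub_right, real_inner_smul_right,
    real_inner_self_eq_norm_sq]
  rw [real_inner_comm, h1, line_inner_I_right a d, h3, h2]
  ring

lemma inner_deriv_deriv_stream (h : IsAmpDomain k a b c m e d φ φ₁) :
    ⟪c, φ⟫ = ‖a‖ ^ 2 + k ^ 2 * ⟪a, φ⟫ ∧ ⟪c, Complex.I • φ⟫ = 0 := by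
  have h1 := h.deriv_deriv.inner_eq_neg h.stream.deriv
  have h2 := h.deriv.inner_eq_neg h.stream.deriv_deriv
  have h3 := h.deriv_deriv.inner_eq_neg h.stream.deriv.mulI
  have h4 := h.deriv.inner_eq_neg h.stream.deriv_deriv.mulI
  have h5 := h.stream.inner_I
  rw [inner_add_right, real_inner_smul_right, real_inner_self_eq_norm_sq] at h2
  rw [smul_add, inner_add_right, line_inner_I_self, smul_comm, real_inner_smul_right, h5] at h4
  constructor
  · rw [h1, h2]; ring
  · rw [h3, h4]; ring

/-- Contribution of `‖∇ω‖²` to the derivative of the energy. -/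
lemma inner_laplacian_ampL (h : IsAmpDomain k a b c m e d φ φ₁) :
    ⟪k ^ 2 • a - c, ampL ν k a c d φ⟫
      = -ν * ‖c - k ^ 2 • a‖ ^ 2 - 2 * k * ⟪Complex.I • m, b⟫ := by
  have h1 := inner_mulY_sq_I h.deriv h.deriv_deriv h.mulY h.mulY_mulY
  have h2 := h.stream.inner_I
  have h3 := h.mulY_mulY.inner_comm h.mulY.mulI
  rw [line_inner_I_self, line_inner_I_right] at h3
  have h4 := (inner_deriv_deriv_stream h).2
  have e : k ^ 2 • a - c = -(c - k ^ 2 • a) := by abel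
  have e1 : ⟪c - k ^ 2 • a, Complex.I • d⟫ = -(2 * ⟪b, Complex.I • m⟫) := by
    rw [inner_sub_left, real_inner_smul_left, h1]
    linear_combination (k ^ 2) * h3
  have e2 : ⟪c - k ^ 2 • a, Complex.I • φ⟫ = 0 := by
    rw [inner_sub_left, real_inner_smul_left, h4, h2]; ring
  rw [e, inner_neg_left, ampL, inner_add_right, inner_sub_right]
  simp only [real_inner_smul_right]
  rw [e1, e2, real_inner_self_eq_norm_sq, real_inner_comm b]
  ring

/-- Contribution of the mixed term `⟨y ∂ₓ ω, ∂_y ω⟩` to the derivative of the energy. -/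
lemma inner_mixed_ampL (h : IsAmpDomain k a b c m e d φ φ₁) :
    ⟪(1 / 2 : ℝ) • (Complex.I • a) + Complex.I • e, ampL ν k a c d φ⟫
      = k * ‖m‖ ^ 2 + 2 * k * ‖φ₁‖ ^ 2 + ν * ⟪Complex.I • e, c - k ^ 2 • a⟫ := by
  have h1 := inner_mulY_mulY_sq h.deriv h.mulY h.mulY_deriv h.mulY_mulY
  have h2 := inner_mulY_eq_zero h.deriv h.stream.deriv h.mulY h.mulY_deriv
  have h3 := h.stream.inner_mulY h.mulY
  have h4 := h.stream.inner_eq h.stream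
  have h5 := h.mulY_mulY.inner_comm h.mulY
  rw [real_inner_comm] at h5
  have h6 : ⟪Complex.I • a, c - k ^ 2 • a⟫ = 0 := by
    rw [real_inner_comm, inner_sub_left, real_inner_smul_left, line_inner_I_self,
      h.deriv_deriv.inner_eq_neg h.deriv.mulI, line_inner_I_self]
    ring
  rw [real_inner_self_eq_norm_sq] at h1 h5
  rw [real_inner_self_eq_norm_sq, real_inner_self_eq_norm_sq] at h3 h4
  simp only [ampL, inner_add_left, inner_add_right, inner_sub_right, real_inner_smul_right,
    real_inner_smul_left, line_inner_I_I] at h6 ⊢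
  linear_combination (ν / 2) * h6 - (k / 2) * h5 - (k / 2) * h1 + 2 * k * h2 - k * h3 - k * h4

/-- Contribution of `‖y ∂ₓ ω‖² + 2 ‖∇∂ₓ ψ‖²` to the derivative of the energy: the transport terms
cancel. -/
lemma inner_potential_ampL (h : IsAmpDomain k a b c m e d φ φ₁) :
    ⟪d - (2 : ℝ) • φ, ampL ν k a c d φ⟫ = -ν * (‖e‖ ^ 2 + k ^ 2 * ‖m‖ ^ 2 + ‖a‖ ^ 2) := by
  have h1 := inner_deriv_mulY_sq h.deriv h.deriv_deriv h.mulY h.mulY_deriv h.mulY_mulY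
  have h2 := two_inner_mulY_deriv h.deriv h.mulY h.mulY_deriv
  have h3 := (inner_deriv_deriv_stream h).1
  have h4 := h.mulY_mulY.inner_comm h.mulY
  have h5 := line_inner_I_right φ d
  have h6 := line_inner_I_self φ
  have h7 := line_inner_I_self d
  rw [real_inner_comm] at h1 h3
  rw [real_inner_self_eq_norm_sq] at h1 h2 h4
  have h8 := real_inner_comm a φ
  simp only [ampL, inner_sub_left, inner_add_right, inner_sub_right, real_inner_smul_right,
    real_inner_smul_left]
  linear_combination ν * h1 - ν * k ^ 2 * h4 - ν * h2 - 2 * ν * h3 + 2 * k * h5 - 4 * k * h6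
    - k * h7 + 2 * ν * k ^ 2 * h8

lemma inner_ampP_ampL {A B G : ℝ} (h : IsAmpDomain k a b c m e d φ φ₁) :
    ⟪ampP A B G k a c e d φ, ampL ν k a c d φ⟫ =
      -ν * (‖b‖ ^ 2 + k ^ 2 * ‖a‖ ^ 2)
      + A * (-ν * ‖c - k ^ 2 • a‖ ^ 2 - 2 * k * ⟪Complex.I • m, b⟫)
      - B * (k * ‖m‖ ^ 2 + 2 * k * ‖φ₁‖ ^ 2 + ν * ⟪Complex.I • e, c - k ^ 2 • a⟫)
      - G * ν * (‖e‖ ^ 2 + k ^ 2 * ‖m‖ ^ 2 + ‖a‖ ^ 2) := by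
  rw [ampP, inner_add_left, inner_sub_left, inner_add_left, real_inner_smul_left,
    real_inner_smul_left, real_inner_smul_left, inner_ampL h, inner_laplacian_ampL h,
    inner_mixed_ampL h, inner_potential_ampL h]
  ring

/-- The elementary inequality behind the choice of the constants `ε₀ = 1/20`, `α₀ = 1/10`,
`β₀ = 1/50`, `γ₀ = 32/125`, with `n = ν^{1/2}`, `q = k^{1/2}`. All products are balanced according
to the scaling `y ∼ (n / q)^{1/2}`. -/
lemma hypocoercive_inequality {n q a b m f₁ f e D x z t : ℝ} (hn : 0 < n) (hq : 0 < q)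
    (hx : |x| ≤ m * b) (hz : |z| ≤ e * D) (ht : |t| ≤ m * f₁) (hab : a ^ 2 ≤ 2 * (m * b))
    (hft : 2 * t = (q ^ 2) ^ 2 * f ^ 2 - f₁ ^ 2) :
    -n ^ 2 * (b ^ 2 + (q ^ 2) ^ 2 * a ^ 2)
      + 1 / 10 * (n / q) * (-n ^ 2 * D ^ 2 - 2 * q ^ 2 * x)
      - 4 / 50 * (q ^ 2 * m ^ 2 + 2 * q ^ 2 * f₁ ^ 2 + n ^ 2 * z)
      - 32 / 125 * (q / n) * n ^ 2 * (e ^ 2 + (q ^ 2) ^ 2 * m ^ 2 + a ^ 2)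
      + 1 / 20 * n * q * (a ^ 2 + 1 / 10 * (n / q) * (b ^ 2 + (q ^ 2) ^ 2 * a ^ 2) + 4 / 50 * x
        + 32 / 125 * (q / n) * (m ^ 2 + 2 * (f₁ ^ 2 + (q ^ 2) ^ 2 * f ^ 2)))
      + 1 / 10 * n ^ 3 / (2 * q) * D ^ 2
      + 32 / 125 * n * q * (7 / 8 * ((q ^ 2) ^ 2 * m ^ 2 + e ^ 2) + a ^ 2) ≤ 0 := by
  -- balanced products
  have p1 : n * q * (m * b) ≤ 5 / 2 * (n ^ 2 * b ^ 2) + 1 / 10 * (q ^ 2 * m ^ 2) := by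
    nlinarith [sq_nonneg (5 * n * b - q * m)]
  have p2 : 8 / 100 * (n ^ 2 * (e * D)) ≤ 1 / 20 * (n ^ 3 / q * D ^ 2) + 4 / 125 * (n * q * e ^ 2) := by
    have h1 : n ^ 3 / q * D ^ 2 = n / q * (n * D) ^ 2 := by ring
    have h2 : n * q * e ^ 2 = n / q * (q * e) ^ 2 := by field_simp
    have h3 : n ^ 2 * (e * D) = n / q * (n * D * (q * e)) := by field_simp
    rw [h1, h2, h3]
    have h4 : 0 ≤ n / q := by positivity
    nlinarith [mul_nonneg h4 (sq_nonneg (5 * (n * D) - 4 * (q * e)))]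
  have p3 : q ^ 2 * (m * f₁) ≤ 1 / 2 * (q ^ 2 * m ^ 2) + 1 / 2 * (q ^ 2 * f₁ ^ 2) := by
    nlinarith [mul_nonneg (sq_nonneg q) (sq_nonneg (m - f₁))]
  have hnq : 0 < n * q := mul_pos hn hq
  have x1 : -(n * q * (m * b)) ≤ n * q * x := by
    nlinarith [mul_le_mul_of_nonneg_left (neg_le_of_abs_le hx) hnq.le]
  have x2 : n * q * x ≤ n * q * (m * b) :=
    mul_le_mul_of_nonneg_left (le_of_abs_le hx) hnq.le
  have z1 : -(n ^ 2 * (e * D)) ≤ n ^ 2 * z := by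
    nlinarith [mul_le_mul_of_nonneg_left (neg_le_of_abs_le hz) (sq_nonneg n)]
  have t1 : q ^ 2 * t ≤ q ^ 2 * (m * f₁) :=
    mul_le_mul_of_nonneg_left (le_of_abs_le ht) (sq_nonneg q)
  have a1 : n * q * a ^ 2 ≤ n * q * (2 * (m * b)) := mul_le_mul_of_nonneg_left hab hnq.le
  have e1 : (q ^ 2) ^ 2 * f ^ 2 = f₁ ^ 2 + 2 * t := by linarith
  rw [e1]
  have s1 : n / q * (-n ^ 2 * D ^ 2 - 2 * q ^ 2 * x) = -(n ^ 3 / q * D ^ 2) - 2 * (n * q * x) := by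
    field_simp
  have s2 : q / n * n ^ 2 = n * q := by field_simp
  have s3 : n * q * (n / q) = n ^ 2 := by field_simp
  have s4 : n * q * (q / n) = q ^ 2 := by field_simp
  have s5 : 1 / 10 * n ^ 3 / (2 * q) * D ^ 2 = 1 / 20 * (n ^ 3 / q * D ^ 2) := by
    field_simp; ring
  have g1 : 0 ≤ n * q * ((q ^ 2) ^ 2 * m ^ 2) := by positivity
  have g2 : 0 ≤ n ^ 2 * ((q ^ 2) ^ 2 * a ^ 2) := by positivity
  have g3 : 0 ≤ n ^ 2 * b ^ 2 := by positivity
  have g4 : 0 ≤ q ^ 2 * m ^ 2 := by positivity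
  have g5 : 0 ≤ q ^ 2 * f₁ ^ 2 := by positivity
  have main : -n ^ 2 * (b ^ 2 + (q ^ 2) ^ 2 * a ^ 2)
      + 1 / 10 * (-(n ^ 3 / q * D ^ 2) - 2 * (n * q * x))
      - 4 / 50 * (q ^ 2 * m ^ 2 + 2 * q ^ 2 * f₁ ^ 2 + n ^ 2 * z)
      - 32 / 125 * (n * q) * (e ^ 2 + (q ^ 2) ^ 2 * m ^ 2 + a ^ 2)
      + 1 / 20 * (n * q * a ^ 2 + 1 / 10 * n ^ 2 * (b ^ 2 + (q ^ 2) ^ 2 * a ^ 2)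
        + 4 / 50 * (n * q * x) + 32 / 125 * q ^ 2 * (m ^ 2 + 2 * (f₁ ^ 2 + (f₁ ^ 2 + 2 * t))))
      + 1 / 20 * (n ^ 3 / q * D ^ 2)
      + 32 / 125 * n * q * (7 / 8 * ((q ^ 2) ^ 2 * m ^ 2 + e ^ 2) + a ^ 2) ≤ 0 := by
    linarith
  refine le_of_eq_of_le ?_ main
  rw [s5, mul_assoc (1 / 10) (n / q), s1, mul_assoc (32 / 125) (q / n), s2]
  linear_combination (1 / 20 * (1 / 10) * (b ^ 2 + (q ^ 2) ^ 2 * a ^ 2)) * s3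
    + (1 / 20 * (32 / 125) * (m ^ 2 + 2 * (f₁ ^ 2 + (f₁ ^ 2 + 2 * t)))) * s4

/-- The dissipation of the energy form along the linearized flow. -/
lemma amp_differential_inequality {n q : ℝ} (hn : 0 < n) (hq : 0 < q)
    (h : IsAmpDomain (q ^ 2) a b c m e d φ φ₁) :
    ⟪ampP (1 / 10 * (n / q)) (4 / 50) (32 / 125 * (q / n)) (q ^ 2) a c e d φ,
        ampL (n ^ 2) (q ^ 2) a c d φ⟫
      + 1 / 20 * n * q * energyForm (1 / 10 * (n / q)) (4 / 50) (32 / 125 * (q / n)) (q ^ 2)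
          a b m φ φ₁ a b m φ φ₁
      + 1 / 10 * n ^ 3 / (2 * q) * ‖c - (q ^ 2) ^ 2 • a‖ ^ 2
      + 32 / 125 * n * q * (7 / 8 * ((q ^ 2) ^ 2 * ‖m‖ ^ 2 + ‖e‖ ^ 2) + ‖a‖ ^ 2) ≤ 0 := by
  have hx : |⟪Complex.I • m, b⟫| ≤ ‖m‖ * ‖b‖ := by
    have := abs_real_inner_le_norm (Complex.I • m) b
    rwa [norm_I_smul] at this
  have hz : |⟪Complex.I • e, c - (q ^ 2) ^ 2 • a⟫| ≤ ‖e‖ * ‖c - (q ^ 2) ^ 2 • a‖ := by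
    have := abs_real_inner_le_norm (Complex.I • e) (c - (q ^ 2) ^ 2 • a)
    rwa [norm_I_smul] at this
  have ht := abs_real_inner_le_norm m φ₁
  have h3 := h.stream.inner_mulY h.mulY
  have h2 := two_inner_mulY_deriv h.deriv h.mulY h.mulY_deriv
  have h4 := h.mulY.inner_comm h.mulY_deriv
  have h5 := abs_real_inner_le_norm m b
  rw [real_inner_self_eq_norm_sq] at h2
  rw [real_inner_self_eq_norm_sq, real_inner_self_eq_norm_sq] at h3
  have hab : ‖a‖ ^ 2 ≤ 2 * (‖m‖ * ‖b‖) := by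
    rw [h4, real_inner_comm] at h5
    linarith [neg_le_of_abs_le h5]
  have key := hypocoercive_inequality hn hq hx hz ht hab h3
  rw [inner_ampP_ampL h, energyForm_self]
  linarith

end Dissipation

/-! ### The amplitude operators are hypocoercive -/

/-- The graph of the pair of operators `(ampL, ampP)`. -/
def ampGraph (ν k A B G : ℝ) : Submodule ℝ (L2Line × L2Line × L2Line) where
  carrier := {x | ∃ b c m e d φ φ₁, IsAmpDomain k x.1 b c m e d φ φ₁ ∧
    x.2.1 = ampL ν k x.1 c d φ ∧ x.2.2 = ampP A B G k x.1 c e d φ}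
  add_mem' := by
    rintro ⟨a, l, p⟩ ⟨a', l', p'⟩ ⟨b, c, m, e, d, φ, φ₁, h, hl, hp⟩
      ⟨b', c', m', e', d', φ', φ₁', h', hl', hp'⟩
    dsimp only at hl hp hl' hp'
    subst hl hp hl' hp'
    refine ⟨_, _, _, _, _, _, _, h.add h', ?_, ?_⟩
    · change ampL ν k a c d φ + ampL ν k a' c' d' φ' = ampL ν k (a + a') (c + c') (d + d') (φ + φ')
      simp only [ampL, smul_add, smul_sub]
      abel
    · change ampP A B G k a c e d φ + ampP A B G k a' c' e' d' φ'
        = ampP A B G k (a + a') (c + c') (e + e') (d + d') (φ + φ')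
      simp only [ampP, smul_add, smul_sub]
      abel
  zero_mem' := by
    refine ⟨0, 0, 0, 0, 0, 0, 0, ⟨fun χ => by simp, fun χ => by simp, ?_, ?_, ?_,
      ⟨fun χ => by simp, fun χ => by simp⟩⟩, by simp [ampL], by simp [ampP]⟩ <;>
    · filter_upwards [Lp.coeFn_zero ℂ 2 (volume : Measure ℝ)] with y hy
      simp
  smul_mem' := by
    rintro r ⟨a, l, p⟩ ⟨b, c, m, e, d, φ, φ₁, h, hl, hp⟩
    dsimp only at hl hp
    subst hl hp
    refine ⟨_, _, _, _, _, _, _, h.smul r, ?_, ?_⟩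
    · change r • ampL ν k a c d φ = ampL ν k (r • a) (r • c) (r • d) (r • φ)
      simp only [ampL, smul_add, smul_sub, smul_comm Complex.I r, smul_comm _ r]
    · change r • ampP A B G k a c e d φ = ampP A B G k (r • a) (r • c) (r • e) (r • d) (r • φ)
      simp only [ampP, smul_add, smul_sub, smul_comm Complex.I r, smul_comm _ r]

section GraphNorm

variable {n q : ℝ} {a b c m e d φ φ₁ : L2Line}

lemma norm_sq_sub_I (h : IsAmpDomain (q ^ 2) a b c m e d φ φ₁) :
    ‖n ^ 2 • c - q ^ 2 • (Complex.I • d)‖ ^ 2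
      = (n ^ 2 * ‖c‖) ^ 2 + (q ^ 2 * ‖d‖) ^ 2 + 4 * (n * q) ^ 2 * ⟪b, Complex.I • m⟫ := by
  rw [norm_sub_sq_real, norm_smul, norm_smul, norm_I_smul, real_inner_smul_left,
    real_inner_smul_right, inner_mulY_sq_I h.deriv h.deriv_deriv h.mulY h.mulY_mulY,
    Real.norm_of_nonneg (sq_nonneg n), Real.norm_of_nonneg (sq_nonneg q)]
  ring

/-- The second derivative and `y² a` are separately controlled by the graph norm of the operator:
their cross term is of lower order. -/
lemma graph_bound (hn : 0 < n) (hq : 0 < q) (h : IsAmpDomain (q ^ 2) a b c m e d φ φ₁) :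
    (n ^ 2 * ‖c‖) ^ 2 + (q ^ 2 * ‖d‖) ^ 2 ≤
      2 * ‖n ^ 2 • c - q ^ 2 • (Complex.I • d)‖ ^ 2 + 16 * (n * q) ^ 2 * ‖a‖ ^ 2 := by
  rw [norm_sq_sub_I h]
  have h1 : ‖b‖ ^ 2 ≤ ‖c‖ * ‖a‖ := by
    have := h.deriv_deriv.inner_eq_neg h.deriv
    rw [real_inner_self_eq_norm_sq] at this
    linarith [neg_le_of_abs_le (abs_real_inner_le_norm c a)]
  have h2 : ‖m‖ ^ 2 ≤ ‖d‖ * ‖a‖ := by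
    have := h.mulY_mulY.inner_comm h.mulY
    rw [real_inner_self_eq_norm_sq] at this
    linarith [le_of_abs_le (abs_real_inner_le_norm d a)]
  have h3 := neg_le_of_abs_le (abs_real_inner_le_norm b (Complex.I • m))
  rw [norm_I_smul] at h3
  set C := n ^ 2 * ‖c‖ with hC
  set Z := q ^ 2 * ‖d‖ with hZ
  have hC0 : 0 ≤ C := by positivity
  have hZ0 : 0 ≤ Z := by positivity
  -- `(n q ‖b‖ ‖m‖)² ≤ C Z ‖a‖²` from `‖b‖² ≤ ‖c‖ ‖a‖` and `‖m‖² ≤ ‖d‖ ‖a‖`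
  have h4 : (n * q * (‖b‖ * ‖m‖)) ^ 2 ≤ ((C + Z) / 2 * ‖a‖) ^ 2 := by
    have e1 : (n * q * (‖b‖ * ‖m‖)) ^ 2 = (n * q) ^ 2 * (‖b‖ ^ 2 * ‖m‖ ^ 2) := by ring
    have e2 : ‖b‖ ^ 2 * ‖m‖ ^ 2 ≤ (‖c‖ * ‖a‖) * (‖d‖ * ‖a‖) := by gcongr
    have e3 : (n * q) ^ 2 * ((‖c‖ * ‖a‖) * (‖d‖ * ‖a‖)) = C * Z * ‖a‖ ^ 2 := by
      rw [hC, hZ]; ring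
    have e4 : C * Z * ‖a‖ ^ 2 ≤ ((C + Z) / 2) ^ 2 * ‖a‖ ^ 2 := by
      gcongr; nlinarith [sq_nonneg (C - Z)]
    rw [e1, mul_pow ((C + Z) / 2)]
    calc _ ≤ (n * q) ^ 2 * ((‖c‖ * ‖a‖) * (‖d‖ * ‖a‖)) := by gcongr
      _ ≤ _ := by rw [e3]; exact e4
  have h5 : n * q * (‖b‖ * ‖m‖) ≤ (C + Z) / 2 * ‖a‖ :=
    (abs_le_of_sq_le_sq' h4 (by positivity)).2
  have h6 : (n * q) ^ 2 * (‖b‖ * ‖m‖) ≤ n * q * ((C + Z) / 2 * ‖a‖) := by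
    have := mul_le_mul_of_nonneg_left h5 (mul_pos hn hq).le
    linarith
  have h7 : (n * q) ^ 2 * -(‖b‖ * ‖m‖) ≤ (n * q) ^ 2 * ⟪b, Complex.I • m⟫ := by gcongr
  nlinarith [sq_nonneg (C - 2 * (n * q * ‖a‖)), sq_nonneg (Z - 2 * (n * q * ‖a‖))]

/-- All constituents of the operators are bounded in terms of the graph norm. -/
lemma exists_graph_bound (hn : 0 < n) (hq : 0 < q) : ∃ C : ℝ, 0 ≤ C ∧
    ∀ a b c m e d φ φ₁, IsAmpDomain (q ^ 2) a b c m e d φ φ₁ → ∀ N : ℝ,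
      ‖ampL (n ^ 2) (q ^ 2) a c d φ‖ ≤ N → ‖a‖ ≤ N →
      ‖b‖ ≤ C * N ∧ ‖c‖ ≤ C * N ∧ ‖d‖ ≤ C * N ∧ ‖e‖ ≤ C * N ∧ ‖φ‖ ≤ C * N := by
  set K : ℝ := 1 + n ^ 2 * (q ^ 2) ^ 2 + 2 / q ^ 2 with hK
  set K' : ℝ := 2 * K + 4 * (n * q) with hK'
  have hK0 : 0 ≤ K := by positivity
  have hK'0 : 0 ≤ K' := by positivity
  set C₁ : ℝ := K' / n ^ 2 with hC₁
  set C₂ : ℝ := K' / q ^ 2 with hC₂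
  set C₃ : ℝ := 1 / (q ^ 2) ^ 2 with hC₃
  have h10 : 0 ≤ C₁ := by positivity
  have h20 : 0 ≤ C₂ := by positivity
  have h30 : 0 ≤ C₃ := by positivity
  refine ⟨C₁ + C₂ + C₃ + 1, by positivity, ?_⟩
  intro a b c m e d φ φ₁ h N hlN haN
  have hN : 0 ≤ N := (norm_nonneg _).trans haN
  have hφ : ‖φ‖ ≤ C₃ * N := by
    have := h.stream.norm_le
    rw [hC₃, div_mul_eq_mul_div, one_mul, le_div_iff₀ (by positivity)]
    linarith
  have hx : ‖n ^ 2 • c - q ^ 2 • (Complex.I • d)‖ ≤ K * N := by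
    have e1 : n ^ 2 • c - q ^ 2 • (Complex.I • d)
        = ampL (n ^ 2) (q ^ 2) a c d φ + (n ^ 2 * (q ^ 2) ^ 2) • a
          - (2 * q ^ 2) • (Complex.I • φ) := by
      rw [ampL]; module
    rw [e1]
    refine (norm_sub_le _ _).trans ((add_le_add_left (norm_add_le _ _) _).trans ?_)
    rw [norm_smul, norm_smul, norm_I_smul, Real.norm_of_nonneg (by positivity),
      Real.norm_of_nonneg (by positivity)]
    have e2 : 2 * q ^ 2 * ‖φ‖ ≤ 2 / q ^ 2 * N := by
      have := mul_le_mul_of_nonneg_left hφ (show 0 ≤ 2 * q ^ 2 by positivity)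
      refine this.trans (le_of_eq ?_)
      rw [hC₃]; field_simp
    have e3 : n ^ 2 * (q ^ 2) ^ 2 * ‖a‖ ≤ n ^ 2 * (q ^ 2) ^ 2 * N := by gcongr
    rw [hK]; linarith
  have hg := graph_bound hn hq h
  have hnq : 0 < n * q := mul_pos hn hq
  have hg' : (n ^ 2 * ‖c‖) ^ 2 + (q ^ 2 * ‖d‖) ^ 2 ≤ (K' * N) ^ 2 := by
    have e1 : ‖n ^ 2 • c - q ^ 2 • (Complex.I • d)‖ ^ 2 ≤ (K * N) ^ 2 := by gcongr
    have e2 : 16 * (n * q) ^ 2 * ‖a‖ ^ 2 ≤ 16 * (n * q) ^ 2 * N ^ 2 := by gcongr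
    have e3 : (K' * N) ^ 2 = 4 * (K * N) ^ 2 + 16 * (n * q) ^ 2 * N ^ 2
      + 16 * (K * N) * (n * q * N) := by rw [hK']; ring
    have e4 : 0 ≤ 16 * (K * N) * (n * q * N) := by positivity
    nlinarith [sq_nonneg (K * N)]
  have hKN : 0 ≤ K' * N := by positivity
  have hc : ‖c‖ ≤ C₁ * N := by
    have : n ^ 2 * ‖c‖ ≤ K' * N :=
      (abs_le_of_sq_le_sq' (by nlinarith [sq_nonneg (q ^ 2 * ‖d‖)]) hKN).2
    rw [hC₁, div_mul_eq_mul_div, le_div_iff₀ (by positivity)]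
    linarith
  have hd : ‖d‖ ≤ C₂ * N := by
    have : q ^ 2 * ‖d‖ ≤ K' * N :=
      (abs_le_of_sq_le_sq' (by nlinarith [sq_nonneg (n ^ 2 * ‖c‖)]) hKN).2
    rw [hC₂, div_mul_eq_mul_div, le_div_iff₀ (by positivity)]
    linarith
  have hb : ‖b‖ ^ 2 ≤ ‖c‖ * ‖a‖ := by
    have := h.deriv_deriv.inner_eq_neg h.deriv
    rw [real_inner_self_eq_norm_sq] at this
    linarith [neg_le_of_abs_le (abs_real_inner_le_norm c a)]
  have he : ‖e‖ ^ 2 ≤ ‖c‖ * ‖d‖ + ‖a‖ ^ 2 := by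
    have h1 := inner_deriv_mulY_sq h.deriv h.deriv_deriv h.mulY h.mulY_deriv h.mulY_mulY
    have h2 := two_inner_mulY_deriv h.deriv h.mulY h.mulY_deriv
    rw [real_inner_self_eq_norm_sq] at h1 h2
    linarith [neg_le_of_abs_le (abs_real_inner_le_norm c d)]
  have c1 : 0 ≤ C₁ * N := by positivity
  have c2 : 0 ≤ C₂ * N := by positivity
  have c3 : 0 ≤ C₃ * N := by positivity
  have hsum : (C₁ + C₂ + C₃ + 1) * N = C₁ * N + C₂ * N + C₃ * N + N := by ring
  rw [hsum]
  refine ⟨?_, by linarith, by linarith, ?_, by linarith⟩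
  · refine (abs_le_of_sq_le_sq' (hb.trans ?_) (by positivity)).2
    calc ‖c‖ * ‖a‖ ≤ (C₁ * N) * N := by gcongr
      _ ≤ (C₁ * N + C₂ * N + C₃ * N + N) * (C₁ * N + C₂ * N + C₃ * N + N) := by
          apply mul_le_mul <;> linarith
      _ = _ := (sq _).symm
  · refine (abs_le_of_sq_le_sq' (he.trans ?_) (by positivity)).2
    calc ‖c‖ * ‖d‖ + ‖a‖ ^ 2 ≤ (C₁ * N) * (C₂ * N) + N ^ 2 := by gcongr
      _ ≤ (C₁ * N + C₂ * N + N) ^ 2 := by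
          linarith [mul_nonneg c1 hN, mul_nonneg c2 hN, mul_nonneg c1 c2, sq_nonneg (C₁ * N),
            sq_nonneg (C₂ * N), (by ring : (C₁ * N + C₂ * N + N) ^ 2 = (C₁ * N) ^ 2
              + (C₂ * N) ^ 2 + N ^ 2 + 2 * ((C₁ * N) * (C₂ * N)) + 2 * ((C₁ * N) * N)
              + 2 * ((C₂ * N) * N))]
      _ ≤ _ := pow_le_pow_left₀ (by positivity) (by linarith) 2

end GraphNorm

/-- Amplitudes whose first and second derivative and whose product with `y²` have norm at most
`C`, expressed by testing. -/
def testBoundedSet (C : ℝ) : Set L2Line :=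
  {a | ∀ χ : testSpace, |⟪a, testToLp (testDeriv χ)⟫| ≤ C * ‖testToLp χ‖ ∧
    |⟪a, testToLp (testDeriv (testDeriv χ))⟫| ≤ C * ‖testToLp χ‖ ∧
    |⟪a, testToLp (testMulY (testMulY χ))⟫| ≤ C * ‖testToLp χ‖}

lemma isClosed_testBoundedSet (C : ℝ) : IsClosed (testBoundedSet C) := by
  simp only [testBoundedSet, ofPred_forall, ofPred_and]
  refine isClosed_iInter fun χ => IsClosed.inter ?_ (IsClosed.inter ?_ ?_) <;>
  exact isClosed_le (by fun_prop) (by fun_prop)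

lemma convex_testBoundedSet (C : ℝ) : Convex ℝ (testBoundedSet C) := by
  have key : ∀ (z : L2Line) (r : ℝ), Convex ℝ {a : L2Line | |⟪a, z⟫| ≤ r} := by
    intro z r x hx y hy s t hs ht hst
    simp only [mem_ofPred_eq, inner_add_left, real_inner_smul_left] at hx hy ⊢
    rw [abs_le] at hx hy ⊢
    have e : r = s * r + t * r := by rw [← add_mul, hst, one_mul]
    constructor <;> nlinarith
  simp only [testBoundedSet, ofPred_forall, ofPred_and]
  exact convex_iInter fun χ => (key _ _).inter ((key _ _).inter (key _ _))

lemma exists_ampDomain_of_mem {k C : ℝ} (hk : 0 < k) {a : L2Line} (ha : a ∈ testBoundedSet C) :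
    ∃ b c m e d φ φ₁, IsAmpDomain k a b c m e d φ φ₁ := by
  obtain ⟨b, hb⟩ := exists_inner_of_bound testToLp
    (-((innerₗ L2Line a).comp (testToLp.comp testDeriv))) (C := C)
    (fun χ => by simpa using (ha χ).1)
  obtain ⟨c, hc⟩ := exists_inner_of_bound testToLp
    ((innerₗ L2Line a).comp (testToLp.comp (testDeriv.comp testDeriv))) (C := C)
    (fun χ => by simpa using (ha χ).2.1)
  obtain ⟨d, hd⟩ := exists_inner_of_bound testToLp
    ((innerₗ L2Line a).comp (testToLp.comp (testMulY.comp testMulY))) (C := C)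
    (fun χ => by simpa using (ha χ).2.2)
  have hab : WeakD a b := fun χ => by
    have := hb χ
    simp only [LinearMap.neg_apply, LinearMap.comp_apply, innerₗ_apply_apply] at this
    linarith
  have hbc : WeakD b c := fun χ => by
    have h1 := hab (testDeriv χ)
    have h2 := hc χ
    simp only [LinearMap.comp_apply, innerₗ_apply_apply] at h2
    linarith
  obtain ⟨m, hm, hmd⟩ := exists_mulY_of_sq (mulY_sq_of_test (fun χ => (hd χ).symm))
  obtain ⟨e, he⟩ := exists_mulY_deriv hab hbc hm hmd
  obtain ⟨φ, φ₁, hφ⟩ := exists_ampStream hk a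
  exact ⟨b, c, m, e, d, φ, φ₁, hab, hbc, hm, he, hmd, hφ⟩

lemma mem_testBoundedSet {k C : ℝ} {a b c m e d φ φ₁ : L2Line}
    (h : IsAmpDomain k a b c m e d φ φ₁) (hb : ‖b‖ ≤ C) (hc : ‖c‖ ≤ C) (hd : ‖d‖ ≤ C) :
    a ∈ testBoundedSet C := by
  have key : ∀ (z : L2Line) (χ : testSpace), ‖z‖ ≤ C → |⟪z, testToLp χ⟫| ≤ C * ‖testToLp χ‖ :=
    fun z χ hz => (abs_real_inner_le_norm _ _).trans (by gcongr)
  intro χ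
  refine ⟨?_, ?_, ?_⟩
  · rw [h.deriv χ, abs_neg]; exact key _ _ hb
  · rw [h.deriv, h.deriv_deriv, neg_neg]; exact key _ _ hc
  · rw [← h.mulY.inner_comm (testToLp_mulY (testMulY χ)),
      ← h.mulY_mulY.inner_comm (testToLp_mulY χ)]
    exact key _ _ hd

/-- The linearized operator at `x`-frequency `k = q²` with viscosity `ν = n²`, together with the
energy with coefficients `α₀ = 1/10`, `β₀ = 1/50`, `γ₀ = 32/125`, is hypocoercive with rate
`2 ε₀ n q`, `ε₀ = 1/20`. -/
theorem isHypocoercive_ampGraph {n q : ℝ} (hn : 0 < n) (hq : 0 < q) :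
    IsHypocoercive (ampGraph (n ^ 2) (q ^ 2) (1 / 10 * (n / q)) (4 / 50) (32 / 125 * (q / n)))
      (2 * (1 / 20) * n * q) := by
  have hA : 0 ≤ 1 / 10 * (n / q) := by positivity
  have hG : 0 ≤ 32 / 125 * (q / n) := by positivity
  have hB : (4 / 50 : ℝ) ^ 2 ≤ 4 * (1 / 10 * (n / q)) * (32 / 125 * (q / n)) := by
    have : 4 * (1 / 10 * (n / q)) * (32 / 125 * (q / n)) = 4 * (1 / 10) * (32 / 125) := by
      field_simp
    rw [this]; norm_num
  have hk : 0 < q ^ 2 := by positivity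
  obtain ⟨C, hC0, hC⟩ := exists_graph_bound hn hq
  refine ⟨?_, ?_, ?_, ?_, ?_, ?_, ?_⟩
  · rintro a l p ⟨b, c, m, e, d, φ, φ₁, h, hl, hp⟩
    simp only at hl hp h
    rw [hl, inner_ampL h]
    have : 0 ≤ n ^ 2 * (‖b‖ ^ 2 + (q ^ 2) ^ 2 * ‖a‖ ^ 2) := by positivity
    linarith
  · rintro a l p a' l' p' ⟨b, c, m, e, d, φ, φ₁, h, hl, hp⟩ ⟨b', c', m', e', d', φ', φ₁', h', hl', hp'⟩
    simp only at hl hp h hl' hp' h'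
    rw [real_inner_comm p', hp, hp', inner_ampP h h'.energy, inner_ampP h' h.energy,
      energyForm_comm]
  · set A := 1 / 10 * (n / q)
    set G := 32 / 125 * (q / n)
    refine ⟨1 + A * ((q ^ 2) ^ 2 + C) + 4 / 50 * (1 / 2 + C) + G * (C + 2 * C), by positivity, ?_⟩
    rintro a l p ⟨b, c, m, e, d, φ, φ₁, h, hl, hp⟩
    simp only at hl hp h
    obtain ⟨-, hc, hd, he, hφ⟩ := hC a b c m e d φ φ₁ h (‖l‖ + ‖a‖)
      (by rw [← hl]; linarith [norm_nonneg a]) (by linarith [norm_nonneg l])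
    have ha : ‖a‖ ≤ ‖l‖ + ‖a‖ := by linarith [norm_nonneg l]
    set N := ‖l‖ + ‖a‖
    rw [hp, ampP]
    have e1 : ‖(q ^ 2) ^ 2 • a - c‖ ≤ (q ^ 2) ^ 2 * N + C * N := by
      refine (norm_sub_le _ _).trans (add_le_add ?_ hc)
      rw [norm_smul, Real.norm_of_nonneg (by positivity)]
      gcongr
    have e2 : ‖(1 / 2 : ℝ) • (Complex.I • a) + Complex.I • e‖ ≤ 1 / 2 * N + C * N := by
      refine (norm_add_le _ _).trans ?_
      rw [norm_smul, norm_I_smul, norm_I_smul, Real.norm_of_nonneg (by positivity)]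
      gcongr
    have e3 : ‖d - (2 : ℝ) • φ‖ ≤ C * N + 2 * (C * N) := by
      refine (norm_sub_le _ _).trans (add_le_add hd ?_)
      rw [norm_smul, Real.norm_of_nonneg (by positivity)]
      gcongr
    refine (norm_add_le _ _).trans ?_
    refine (add_le_add_left ((norm_sub_le _ _).trans (add_le_add_left (norm_add_le _ _) _)) _).trans ?_
    rw [norm_smul, norm_smul, norm_smul, Real.norm_of_nonneg hA, Real.norm_of_nonneg hG,
      Real.norm_of_nonneg (by positivity : (0 : ℝ) ≤ 4 / 50)]
    calc ‖a‖ + A * ‖(q ^ 2) ^ 2 • a - c‖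
          + 4 / 50 * ‖(1 / 2 : ℝ) • (Complex.I • a) + Complex.I • e‖ + G * ‖d - (2 : ℝ) • φ‖
        ≤ N + A * ((q ^ 2) ^ 2 * N + C * N) + 4 / 50 * (1 / 2 * N + C * N)
          + G * (C * N + 2 * (C * N)) := by gcongr
      _ = _ := by ring
  · rintro a l p ⟨b, c, m, e, d, φ, φ₁, h, hl, hp⟩
    simp only at hl hp h
    have key := amp_differential_inequality hn hq h
    rw [hl, hp, inner_ampP h h.energy]
    have g1 : 0 ≤ 1 / 10 * n ^ 3 / (2 * q) * ‖c - (q ^ 2) ^ 2 • a‖ ^ 2 := by positivity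
    have g2 : 0 ≤ 32 / 125 * n * q * (7 / 8 * ((q ^ 2) ^ 2 * ‖m‖ ^ 2 + ‖e‖ ^ 2) + ‖a‖ ^ 2) := by
      positivity
    linarith
  · rintro a l p ⟨b, c, m, e, d, φ, φ₁, h, hl, hp⟩
    simp only at hl hp h
    rw [hp, inner_ampP h h.energy]
    exact energyForm_self_nonneg hA hG hB
  · refine denseRange_testToLp.mono ?_
    rintro _ ⟨χ, rfl⟩
    obtain ⟨S, S₁, hS⟩ := exists_ampStream hk (Complex.I • testToLp χ)
    obtain ⟨T, T₁, hT⟩ := exists_ampStream hk (testToLp χ)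
    refine ⟨n ^ 2 • (testToLp (testDeriv (testDeriv χ)) - (q ^ 2) ^ 2 • testToLp χ)
        + q ^ 2 • testToLp (testMulY (testMulY (testMulI χ))) - (2 * q ^ 2) • S,
      testToLp χ + (1 / 10 * (n / q)) • ((q ^ 2) ^ 2 • testToLp χ
        - testToLp (testDeriv (testDeriv χ)))
        + (4 / 50 : ℝ) • ((1 / 2 : ℝ) • testToLp (testMulI χ)
          - testToLp (testDeriv (testMulY (testMulI χ))))
        + (32 / 125 * (q / n)) • (testToLp (testMulY (testMulY χ)) - (2 : ℝ) • T), ?_⟩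
    rintro a l p ⟨b, c, m, e, d, φ, φ₁, h, hl, hp⟩
    simp only at hl hp h
    have h1 : ⟪c, testToLp χ⟫ = ⟪a, testToLp (testDeriv (testDeriv χ))⟫ := by
      rw [h.deriv, h.deriv_deriv, neg_neg]
    have h2 : ∀ χ, ⟪d, testToLp χ⟫ = ⟪a, testToLp (testMulY (testMulY χ))⟫ := fun χ => by
      rw [← h.mulY.inner_comm (testToLp_mulY (testMulY χ)),
        ← h.mulY_mulY.inner_comm (testToLp_mulY χ)]
    have h3 : ⟪Complex.I • φ, testToLp χ⟫ = -⟪a, S⟫ := by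
      rw [line_inner_I_left, h.stream.inner_comm hS]
    have h4 : ⟪φ, testToLp χ⟫ = ⟪a, T⟫ := h.stream.inner_comm hT
    have h5 : ⟪Complex.I • e, testToLp χ⟫ = ⟪a, testToLp (testDeriv (testMulY (testMulI χ)))⟫ := by
      rw [line_inner_I_left, ← testToLp_mulI, h.mulY_deriv.inner_comm (testToLp_mulY (testMulI χ)),
        h.deriv]
    have h6 : ⟪Complex.I • d, testToLp χ⟫ = -⟪a, testToLp (testMulY (testMulY (testMulI χ)))⟫ := by
      rw [line_inner_I_left, ← testToLp_mulI, h2]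
    have h7 : ⟪Complex.I • a, testToLp χ⟫ = -⟪a, testToLp (testMulI χ)⟫ := by
      rw [line_inner_I_left, ← testToLp_mulI]
    rw [hl, hp]
    constructor
    · simp only [ampL, inner_add_left, inner_sub_left, inner_add_right, inner_sub_right,
        real_inner_smul_left, real_inner_smul_right, h1, h3, h6]
      ring
    · simp only [ampP, inner_add_left, inner_sub_left, inner_add_right, inner_sub_right,
        real_inner_smul_left, real_inner_smul_right, h1, h2 χ, h4, h5, h7]
      ring
  · intro M
    refine ⟨testBoundedSet (C * M), isClosed_testBoundedSet _, convex_testBoundedSet _, ?_, ?_⟩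
    · rintro a l p ⟨b, c, m, e, d, φ, φ₁, h, hl, hp⟩ ha hlM
      simp only at hl hp h
      rw [hl] at hlM
      obtain ⟨hb, hc, hd, -⟩ := hC a b c m e d φ φ₁ h M hlM ha
      exact mem_testBoundedSet h hb hc hd
    · intro a ha
      obtain ⟨b, c, m, e, d, φ, φ₁, h⟩ := exists_ampDomain_of_mem hk ha
      exact ⟨ampL (n ^ 2) (q ^ 2) a c d φ,
        ampP (1 / 10 * (n / q)) (4 / 50) (32 / 125 * (q / n)) (q ^ 2) a c e d φ,
        b, c, m, e, d, φ, φ₁, h, rfl, rfl⟩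

/-! ### Functions on the cylinder with a single frequency -/

/-- The real function `Re (a(y) exp(i l x))` on the cylinder, for any function `a`, so that it
applies to test functions as well as to classes in `L²`. -/
def lift (l : ℕ) (a : ℝ → ℂ) (p : ℝ × ℝ) : ℝ :=
  Real.cos (l * p.1) * (a p.2).re - Real.sin (l * p.1) * (a p.2).im

lemma abs_cos_mul_sub_sin_mul_le (t : ℝ) (z : ℂ) :
    |Real.cos t * z.re - Real.sin t * z.im| ≤ ‖z‖ := by
  refine abs_le_of_sq_le_sq ?_ (norm_nonneg z)
  rw [← Complex.normSq_eq_norm_sq, Complex.normSq_apply]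
  have h1 : (Real.cos t * z.re - Real.sin t * z.im) ^ 2
      = (Real.cos t ^ 2 + Real.sin t ^ 2) * (z.re * z.re + z.im * z.im)
        - (Real.sin t * z.re + Real.cos t * z.im) ^ 2 := by ring
  rw [h1, Real.cos_sq_add_sin_sq, one_mul]
  linarith [sq_nonneg (Real.sin t * z.re + Real.cos t * z.im)]

lemma abs_lift_le (l : ℕ) (a : ℝ → ℂ) (p : ℝ × ℝ) : |lift l a p| ≤ ‖a p.2‖ :=
  abs_cos_mul_sub_sin_mul_le _ _

lemma two_pi_pos : (0 : ℝ) < 2 * Real.pi := by positivity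

lemma ae_cyl_of_ae {P : ℝ → Prop} (h : ∀ᵐ y : ℝ, P y) : ∀ᵐ p ∂cyl, P p.2 :=
  Measure.quasiMeasurePreserving_snd.ae h

lemma integral_cyl {f : ℝ × ℝ → ℝ} (hf : Integrable f cyl) :
    ∫ p, f p ∂cyl = ∫ y, ∫ x in Ioc 0 (2 * Real.pi), f (x, y) := integral_prod_symm f hf

lemma aestronglyMeasurable_lift (l : ℕ) {a : ℝ → ℂ} (ha : AEStronglyMeasurable a volume) :
    AEStronglyMeasurable (lift l a) cyl := by
  have h1 : AEStronglyMeasurable (fun p : ℝ × ℝ => a p.2) cyl := ha.comp_snd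
  have h2 : AEStronglyMeasurable (fun p : ℝ × ℝ => (a p.2).re) cyl :=
    Complex.continuous_re.comp_aestronglyMeasurable h1
  have h3 : AEStronglyMeasurable (fun p : ℝ × ℝ => (a p.2).im) cyl :=
    Complex.continuous_im.comp_aestronglyMeasurable h1
  have h4 : Continuous fun p : ℝ × ℝ => Real.cos (l * p.1) := by fun_prop
  have h5 : Continuous fun p : ℝ × ℝ => Real.sin (l * p.1) := by fun_prop
  exact (h4.aestronglyMeasurable.mul h2).sub (h5.aestronglyMeasurable.mul h3)

lemma memLp_lift (l : ℕ) {a : ℝ → ℂ} (ha : MemLp a 2 volume) : MemLp (lift l a) 2 cyl := by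
  have h : MemLp (fun p : ℝ × ℝ => a p.2) 2 cyl := ha.comp_snd _
  refine h.mono (aestronglyMeasurable_lift l ha.1) (Eventually.of_forall fun p => ?_)
  exact abs_lift_le l a p

lemma lift_congr (l : ℕ) {a b : ℝ → ℂ} (h : a =ᵐ[volume] b) : lift l a =ᵐ[cyl] lift l b := by
  filter_upwards [ae_cyl_of_ae h] with p hp
  rw [lift, lift, hp]

lemma integral_cos_sub_sin (n : ℤ) (u v : ℝ) :
    ∫ x in Ioc 0 (2 * Real.pi), (Real.cos (n * x) * u - Real.sin (n * x) * v)
      = if n = 0 then 2 * Real.pi * u else 0 := by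
  rw [← intervalIntegral.integral_of_le two_pi_pos.le]
  split_ifs with hn
  · simp [hn]
  · have hn' : (n : ℝ) ≠ 0 := by exact_mod_cast hn
    have hc : Continuous fun x : ℝ => Real.cos (n * x) := by fun_prop
    have hs : Continuous fun x : ℝ => Real.sin (n * x) := by fun_prop
    have h1 : Real.sin (n * (2 * Real.pi)) = 0 := by
      have := Real.sin_int_mul_pi (n * 2)
      push_cast at this
      rwa [mul_assoc] at this
    have hci : IntervalIntegrable (fun x => Real.cos (n * x) * u) volume 0 (2 * Real.pi) :=
      (hc.mul continuous_const).intervalIntegrable _ _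
    have hsi : IntervalIntegrable (fun x => Real.sin (n * x) * v) volume 0 (2 * Real.pi) :=
      (hs.mul continuous_const).intervalIntegrable _ _
    rw [intervalIntegral.integral_sub hci hsi, intervalIntegral.integral_mul_const,
      intervalIntegral.integral_mul_const,
      intervalIntegral.integral_comp_mul_left (fun x => Real.cos x) hn',
      intervalIntegral.integral_comp_mul_left (fun x => Real.sin x) hn', integral_cos, integral_sin,
      h1, Real.cos_int_mul_two_pi]
    simp

/-- Orthogonality of different frequencies on one period. -/
lemma integral_wave_mul_wave (l : ℕ) {k : ℕ} (hk : 1 ≤ k) (z w : ℂ) :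
    ∫ x in Ioc 0 (2 * Real.pi), (Real.cos (l * x) * z.re - Real.sin (l * x) * z.im)
        * (Real.cos (k * x) * w.re - Real.sin (k * x) * w.im)
      = if l = k then Real.pi * ⟪z, w⟫ else 0 := by
  have e : ∀ x : ℝ, (Real.cos (l * x) * z.re - Real.sin (l * x) * z.im)
        * (Real.cos (k * x) * w.re - Real.sin (k * x) * w.im)
      = (Real.cos (((l + k : ℤ) : ℝ) * x) * ((z.re * w.re - z.im * w.im) / 2)
          - Real.sin (((l + k : ℤ) : ℝ) * x) * ((z.re * w.im + z.im * w.re) / 2))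
        + (Real.cos (((l - k : ℤ) : ℝ) * x) * ((z.re * w.re + z.im * w.im) / 2)
          - Real.sin (((l - k : ℤ) : ℝ) * x) * ((z.im * w.re - z.re * w.im) / 2)) := by
    intro x
    push_cast
    rw [add_mul (l : ℝ), sub_mul (l : ℝ), Real.cos_add, Real.cos_sub, Real.sin_add, Real.sin_sub]
    ring
  simp_rw [e]
  have hi : ∀ (n : ℤ) (u v : ℝ), Integrable
      (fun x : ℝ => Real.cos (n * x) * u - Real.sin (n * x) * v)
      (volume.restrict (Ioc 0 (2 * Real.pi))) := fun n u v =>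
    (Continuous.integrableOn_Icc (by fun_prop)).mono_set Ioc_subset_Icc_self
  rw [integral_add (hi _ _ _) (hi _ _ _), integral_cos_sub_sin, integral_cos_sub_sin,
    if_neg (by omega : ¬((l : ℤ) + k = 0)), zero_add, complex_inner_eq]
  by_cases h : l = k
  · rw [if_pos (by omega), if_pos h]; ring
  · rw [if_neg (by omega), if_neg h]

lemma integral_lift_mul_lift (l : ℕ) {k : ℕ} (hk : 1 ≤ k) {a b : ℝ → ℂ} (ha : MemLp a 2 volume)
    (hb : MemLp b 2 volume) :
    ∫ p, lift l a p * lift k b p ∂cyl = if l = k then Real.pi * ∫ y, ⟪a y, b y⟫ else 0 := by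
  have hi : Integrable (fun p => lift l a p * lift k b p) cyl :=
    (memLp_lift l ha).integrable_mul (memLp_lift k hb)
  rw [integral_cyl hi]
  simp only [lift, integral_wave_mul_wave l hk]
  split_ifs
  · rw [integral_const_mul]
  · simp

/-- The mean over a period recovers `|a|²`, so that square integrability passes to the amplitude. -/
lemma memLp_of_memLp_lift {k : ℕ} (hk : 1 ≤ k) {a : ℝ → ℂ} (ha : AEStronglyMeasurable a volume)
    (h : MemLp (lift k a) 2 cyl) : MemLp a 2 volume := by
  have h1 := ((memLp_two_iff_integrable_sq h.1).1 h).integral_prod_right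
  rw [memLp_two_iff_integrable_sq_norm ha]
  have h2 : ∀ y, ∫ x in Ioc 0 (2 * Real.pi), lift k a (x, y) ^ 2 = Real.pi * ‖a y‖ ^ 2 := by
    intro y
    have := integral_wave_mul_wave k hk (a y) (a y)
    rw [if_pos rfl, real_inner_self_eq_norm_sq] at this
    rw [← this]
    simp only [lift, sq]
  simp only [h2] at h1
  have h3 := h1.const_mul Real.pi⁻¹
  simpa [← mul_assoc, inv_mul_cancel₀ Real.pi_ne_zero] using h3

/-- The map `a ↦ Re (a(y) exp(i l x))` from `L²(ℝ; ℂ)` to `L²(𝕋 × ℝ)`. -/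
def liftMap (l : ℕ) : L2Line →L[ℝ] L2Cyl :=
  LinearMap.mkContinuous
    { toFun := fun a => (memLp_lift l (Lp.memLp a)).toLp _
      map_add' := fun a b => by
        rw [← MemLp.toLp_add]
        refine MemLp.toLp_congr _ _ ?_
        filter_upwards [ae_cyl_of_ae (Lp.coeFn_add a b)] with p hp
        simp only [lift, hp, Pi.add_apply, Complex.add_re, Complex.add_im]
        ring
      map_smul' := fun r a => by
        rw [RingHom.id_apply, ← MemLp.toLp_const_smul]
        refine MemLp.toLp_congr _ _ ?_
        filter_upwards [ae_cyl_of_ae (Lp.coeFn_smul r a)] with p hp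
        simp only [lift, hp, Pi.smul_apply, Complex.smul_re, Complex.smul_im, smul_eq_mul]
        ring }
    (√(2 * Real.pi)) fun a => by
      have hsq : ∀ f : L2Cyl, ‖f‖ ^ 2 = ∫ p, f p ^ 2 ∂cyl := fun f => by
        rw [← real_inner_self_eq_norm_sq, L2.inner_def]
        simp [sq]
      have hm : MemLp (fun p : ℝ × ℝ => a p.2) 2 cyl := (Lp.memLp a).comp_snd _
      have hi := (memLp_two_iff_integrable_sq_norm hm.1).1 hm
      refine abs_le_of_sq_le_sq' ?_ (by positivity) |>.2
      rw [mul_pow, Real.sq_sqrt two_pi_pos.le, hsq, ← real_inner_self_eq_norm_sq a, line_inner_def]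
      simp only [real_inner_self_eq_norm_sq]
      calc ∫ p, ((memLp_lift l (Lp.memLp a)).toLp _ : L2Cyl) p ^ 2 ∂cyl
          = ∫ p, lift l a p ^ 2 ∂cyl := by
            refine integral_congr_ae ?_
            filter_upwards [(memLp_lift l (Lp.memLp a)).coeFn_toLp] with p hp
            rw [hp]
        _ ≤ ∫ p, ‖a p.2‖ ^ 2 ∂cyl := by
            refine integral_mono_of_nonneg (Eventually.of_forall fun p => sq_nonneg _) hi
              (Eventually.of_forall fun p => ?_)
            exact sq_le_sq' (neg_le_of_abs_le (abs_lift_le l a p))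
              (le_of_abs_le (abs_lift_le l a p))
        _ = 2 * Real.pi * ∫ y, ‖a y‖ ^ 2 := by
            rw [integral_cyl hi]
            simp [integral_const_mul, two_pi_pos.le]

lemma coeFn_liftMap (l : ℕ) (a : L2Line) : liftMap l a =ᵐ[cyl] lift l a :=
  (memLp_lift l (Lp.memLp a)).coeFn_toLp

lemma cyl_inner_def (f g : L2Cyl) : ⟪f, g⟫ = ∫ p, f p * g p ∂cyl := by
  rw [L2.inner_def]
  simp [mul_comm]

lemma inner_liftMap (l : ℕ) {k : ℕ} (hk : 1 ≤ k) (a b : L2Line) :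
    ⟪liftMap l a, liftMap k b⟫ = if l = k then Real.pi * ⟪a, b⟫ else 0 := by
  rw [cyl_inner_def, line_inner_def, ← integral_lift_mul_lift l hk (Lp.memLp a) (Lp.memLp b)]
  refine integral_congr_ae ?_
  filter_upwards [coeFn_liftMap l a, coeFn_liftMap k b] with p h1 h2
  rw [h1, h2]

/-- The adjoint of `liftMap l`; up to the factor `2π` it is the `l`-th Fourier coefficient. -/
def coeffMap (l : ℕ) : L2Cyl →L[ℝ] L2Line := ContinuousLinearMap.adjoint (liftMap l)

lemma inner_coeffMap (l : ℕ) (f : L2Cyl) (a : L2Line) : ⟪coeffMap l f, a⟫ = ⟪f, liftMap l a⟫ :=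
  ContinuousLinearMap.adjoint_inner_left _ _ _

lemma coeffMap_liftMap (l : ℕ) {k : ℕ} (hk : 1 ≤ k) (a : L2Line) :
    coeffMap l (liftMap k a) = if l = k then Real.pi • a else 0 := by
  refine ext_inner_right ℝ fun b => ?_
  rw [inner_coeffMap, real_inner_comm, inner_liftMap l hk]
  split_ifs
  · rw [real_inner_smul_left, real_inner_comm]
  · rw [inner_zero_left]

lemma coeffMap_liftMap_self {k : ℕ} (hk : 1 ≤ k) (a : L2Line) :
    Real.pi⁻¹ • coeffMap k (liftMap k a) = a := by
  rw [coeffMap_liftMap k hk, if_pos rfl, smul_smul, inv_mul_cancel₀ Real.pi_ne_zero, one_smul]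

/-- Vanishing of the coefficient of frequency `l`, expressed on almost every slice: test with
`lift l` of the indicator functions of sets of finite measure. -/
lemma ae_integral_wave_eq_zero {g : L2Cyl} {l : ℕ} (h : coeffMap l g = 0) (z : ℂ) :
    ∀ᵐ y : ℝ, ∫ x in Ioc 0 (2 * Real.pi),
      g (x, y) * (Real.cos (l * x) * z.re - Real.sin (l * x) * z.im) = 0 := by
  have hlift : ∀ (s : Set ℝ) (x y : ℝ), lift l (s.indicator fun _ => z) (x, y)
      = s.indicator (fun _ => Real.cos (l * x) * z.re - Real.sin (l * x) * z.im) y := by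
    intro s x y
    by_cases hy : y ∈ s <;> simp [lift, hy]
  have hmem : ∀ s : Set ℝ, MeasurableSet s → volume s < ⊤ →
      MemLp (s.indicator fun _ => z) 2 volume := fun s hs hv =>
    memLp_indicator_const 2 hs z (Or.inr hv.ne)
  have hint : ∀ s : Set ℝ, MeasurableSet s → volume s < ⊤ →
      Integrable (fun p => g p * lift l (s.indicator fun _ => z) p) cyl := fun s hs hv =>
    (Lp.memLp g).integrable_mul (memLp_lift l (hmem s hs hv))
  have hslice : ∀ s : Set ℝ, (fun y => ∫ x in Ioc 0 (2 * Real.pi),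
      g (x, y) * lift l (s.indicator fun _ => z) (x, y))
      = s.indicator fun y => ∫ x in Ioc 0 (2 * Real.pi),
        g (x, y) * (Real.cos (l * x) * z.re - Real.sin (l * x) * z.im) := by
    intro s
    funext y
    by_cases hy : y ∈ s <;> simp [hlift, hy]
  refine ae_eq_zero_of_forall_setIntegral_eq_of_sigmaFinite (fun s hs hv => ?_) fun s hs hv => ?_
  · rw [← integrable_indicator_iff hs, ← hslice]
    exact (hint s hs hv).integral_prod_right
  · rw [← integral_indicator hs, ← hslice, ← integral_cyl (hint s hs hv)]
    have h1 := inner_coeffMap l g ((hmem s hs hv).toLp _)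
    rw [h, inner_zero_left, cyl_inner_def] at h1
    rw [h1]
    refine integral_congr_ae ?_
    filter_upwards [coeFn_liftMap l ((hmem s hs hv).toLp _),
      lift_congr l (hmem s hs hv).coeFn_toLp] with p h2 h3
    rw [h2, h3]

/-- A square integrable function on the period whose real Fourier coefficients vanish is zero. -/
lemma integral_sq_eq_zero_of_fourier {f : ℝ → ℝ}
    (hf : MemLp f 2 (volume.restrict (Ioc 0 (2 * Real.pi))))
    (hc : ∀ l : ℕ, ∫ x in Ioc 0 (2 * Real.pi), f x * Real.cos (l * x) = 0)
    (hs : ∀ l : ℕ, ∫ x in Ioc 0 (2 * Real.pi), f x * Real.sin (l * x) = 0) :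
    ∫ x in Ioc 0 (2 * Real.pi), f x ^ 2 = 0 := by
  have hc' : ∀ n : ℤ, ∫ x in Ioc 0 (2 * Real.pi), f x * Real.cos (n * x) = 0 := by
    intro n
    obtain ⟨l, rfl | rfl⟩ := n.eq_nat_or_neg
    · exact_mod_cast hc l
    · simpa using hc l
  have hs' : ∀ n : ℤ, ∫ x in Ioc 0 (2 * Real.pi), f x * Real.sin (n * x) = 0 := by
    intro n
    obtain ⟨l, rfl | rfl⟩ := n.eq_nat_or_neg
    · exact_mod_cast hs l
    · simpa [integral_neg] using hs l
  have hfi : Integrable f (volume.restrict (Ioc 0 (2 * Real.pi))) := hf.integrable (by norm_num)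
  have hbd : ∀ t : ℝ → ℝ, Continuous t → (∀ x, |t x| ≤ 1) →
      Integrable (fun x => f x * t x) (volume.restrict (Ioc 0 (2 * Real.pi))) := fun t ht h1 =>
    hfi.mul_bdd (c := 1) ht.aestronglyMeasurable (Eventually.of_forall h1)
  have hP := hasSum_sq_fourierCoeffOn two_pi_pos hf.ofReal
  have hz : ∀ n : ℤ, fourierCoeffOn two_pi_pos (fun x => (f x : ℂ)) n = 0 := by
    intro n
    rw [fourierCoeffOn_eq_integral, intervalIntegral.integral_of_le two_pi_pos.le]
    have e : ∀ x : ℝ, (fourier (-n) (x : AddCircle (2 * Real.pi - 0)) : ℂ) • (f x : ℂ)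
        = ((f x * Real.cos (n * x) : ℝ) : ℂ) - Complex.I * ((f x * Real.sin (n * x) : ℝ) : ℂ) := by
      intro x
      have h1 : 2 * Real.pi * Complex.I * ((-n : ℤ) : ℂ) * x / ((2 * Real.pi - 0 : ℝ) : ℂ)
          = ((-(n * x) : ℝ) : ℂ) * Complex.I := by
        have : (Real.pi : ℂ) ≠ 0 := by exact_mod_cast Real.pi_ne_zero
        push_cast
        field_simp
        simp
        ring
      rw [fourier_coe_apply, h1, Complex.exp_mul_I, ← Complex.ofReal_cos, ← Complex.ofReal_sin,
        Real.cos_neg, Real.sin_neg, smul_eq_mul]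
      push_cast
      ring
    simp_rw [e]
    rw [integral_sub, integral_const_mul, integral_complex_ofReal, integral_complex_ofReal, hc', hs']
    · simp
    · exact (hbd _ (by fun_prop) fun x => Real.abs_cos_le_one _).ofReal
    · exact (hbd _ (by fun_prop) fun x => Real.abs_sin_le_one _).ofReal.const_mul _
  simp only [RCLike.ofReal_eq_complex_ofReal, hz] at hP
  have h0 := hP.tsum_eq
  rw [norm_zero, zero_pow two_ne_zero, tsum_zero, eq_comm] at h0
  rw [intervalIntegral.integral_of_le two_pi_pos.le, smul_eq_mul, mul_eq_zero] at h0
  rcases h0 with h0 | h0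
  · exact absurd h0 (by rw [sub_zero]; exact inv_ne_zero two_pi_pos.ne')
  · simpa using h0

/-- A function in `L²` all of whose Fourier coefficients vanish is zero. -/
lemma eq_zero_of_coeffMap {g : L2Cyl} (h : ∀ l, coeffMap l g = 0) : g = 0 := by
  have hL : MemLp g 2 cyl := Lp.memLp g
  have hint : Integrable (fun p => g p ^ 2) cyl := (memLp_two_iff_integrable_sq hL.1).1 hL
  have hc := ae_all_iff.2 fun l => ae_integral_wave_eq_zero (h l) 1
  have hs := ae_all_iff.2 fun l => ae_integral_wave_eq_zero (h l) Complex.I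
  have hm := hL.1.prodMk_right
  rw [← norm_eq_zero, ← sq_eq_zero_iff, ← real_inner_self_eq_norm_sq, cyl_inner_def]
  simp only [← sq]
  rw [integral_cyl hint]
  refine integral_eq_zero_of_ae ?_
  filter_upwards [hc, hs, hm, hint.prod_left_ae] with y hc hs hm hi
  refine integral_sq_eq_zero_of_fourier ((memLp_two_iff_integrable_sq hm).2 hi) (fun l => ?_)
    fun l => ?_
  · simpa using hc l
  · simpa [integral_neg] using hs l

/-! ### Weak derivatives on the cylinder -/

lemma memLp_of_continuous {h : ℝ × ℝ → ℝ} (hc : Continuous h)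
    (hs : ∃ R : ℝ, ∀ x y : ℝ, R < |y| → h (x, y) = 0) : MemLp h 2 cyl := by
  obtain ⟨R, hR⟩ := hs
  obtain ⟨C, hC⟩ := ((isCompact_Icc (a := (0 : ℝ)) (b := 2 * Real.pi)).prod
    (isCompact_Icc (a := -R) (b := R))).exists_bound_of_continuousOn hc.continuousOn
  have hfin : MemLp ((Icc (-R) R).indicator fun _ => C) 2 (volume : Measure ℝ) :=
    memLp_indicator_const 2 measurableSet_Icc C (Or.inr isCompact_Icc.measure_lt_top.ne)
  have hfin' : MemLp (fun p : ℝ × ℝ => (Icc (-R) R).indicator (fun _ => C) p.2) 2 cyl :=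
    hfin.comp_snd _
  have h1 : ∀ᵐ p ∂cyl, p.1 ∈ Ioc 0 (2 * Real.pi) :=
    Measure.quasiMeasurePreserving_fst.ae (ae_restrict_mem measurableSet_Ioc)
  refine hfin'.mono' hc.aestronglyMeasurable ?_
  filter_upwards [h1] with p hp
  by_cases hy : p.2 ∈ Icc (-R) R
  · rw [indicator_of_mem hy]
    exact hC p ⟨Ioc_subset_Icc_self hp, hy⟩
  · rw [indicator_of_notMem hy]
    have := hR p.1 p.2 (by
      by_contra! h
      exact hy (abs_le.1 h))
    simp [this]

lemma hasDerivAt_slice_fst {φ : ℝ × ℝ → ℝ} (hφ : Differentiable ℝ φ) (x y : ℝ) :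
    HasDerivAt (fun t => φ (t, y)) (fderiv ℝ φ (x, y) eX) x :=
  (hφ (x, y)).hasFDerivAt.comp_hasDerivAt x ((hasDerivAt_id x).prodMk (hasDerivAt_const x y))

lemma hasDerivAt_slice_snd {φ : ℝ × ℝ → ℝ} (hφ : Differentiable ℝ φ) (x y : ℝ) :
    HasDerivAt (fun t => φ (x, t)) (fderiv ℝ φ (x, y) eY) y :=
  (hφ (x, y)).hasFDerivAt.comp_hasDerivAt y ((hasDerivAt_const y x).prodMk (hasDerivAt_id y))

namespace IsTest

variable {φ : ℝ × ℝ → ℝ}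

lemma differentiable (h : IsTest φ) : Differentiable ℝ φ := h.1.differentiable (by norm_num)

lemma memLp (h : IsTest φ) : MemLp φ 2 cyl := memLp_of_continuous h.1.continuous h.2.2

lemma continuous_fderiv (h : IsTest φ) (v : ℝ × ℝ) : Continuous fun p => fderiv ℝ φ p v :=
  (h.1.continuous_fderiv (by norm_num)).clm_apply continuous_const

lemma memLp_fderiv (h : IsTest φ) (v : ℝ × ℝ) : MemLp (fun p => fderiv ℝ φ p v) 2 cyl := by
  refine memLp_of_continuous (h.continuous_fderiv v) ?_
  obtain ⟨R, hR⟩ := h.2.2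
  refine ⟨R, fun x y hy => ?_⟩
  have : φ =ᶠ[𝓝 (x, y)] fun _ => 0 := by
    have ho : IsOpen {p : ℝ × ℝ | R < |p.2|} := isOpen_lt continuous_const (by fun_prop)
    filter_upwards [ho.mem_nhds hy] with p hp
    exact hR p.1 p.2 hp
  rw [this.fderiv_eq]
  simp

end IsTest

lemma lift_add_two_pi (l : ℕ) (a : ℝ → ℂ) (x y : ℝ) :
    lift l a (x + 2 * Real.pi, y) = lift l a (x, y) := by
  simp only [lift, mul_add, Real.cos_add_nat_mul_two_pi, Real.sin_add_nat_mul_two_pi]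

lemma continuous_lift_slice (l : ℕ) (a : ℝ → ℂ) (y : ℝ) : Continuous fun x => lift l a (x, y) := by
  have h1 : Continuous fun x : ℝ => Real.cos (l * x) * (a y).re := by fun_prop
  have h2 : Continuous fun x : ℝ => Real.sin (l * x) * (a y).im := by fun_prop
  exact h1.sub h2

lemma isTest_lift (l : ℕ) (χ : testSpace) : IsTest (lift l χ) := by
  refine ⟨?_, lift_add_two_pi l χ, ?_⟩
  · have h1 : ContDiff ℝ ((⊤ : ℕ∞) : WithTop ℕ∞) fun p : ℝ × ℝ => ((χ : ℝ → ℂ) p.2).re :=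
      Complex.reCLM.contDiff.comp (χ.2.1.comp contDiff_snd)
    have h2 : ContDiff ℝ ((⊤ : ℕ∞) : WithTop ℕ∞) fun p : ℝ × ℝ => ((χ : ℝ → ℂ) p.2).im :=
      Complex.imCLM.contDiff.comp (χ.2.1.comp contDiff_snd)
    have h3 : ContDiff ℝ ((⊤ : ℕ∞) : WithTop ℕ∞) fun p : ℝ × ℝ => Real.cos (l * p.1) :=
      Real.contDiff_cos.comp (contDiff_const.mul contDiff_fst)
    have h4 : ContDiff ℝ ((⊤ : ℕ∞) : WithTop ℕ∞) fun p : ℝ × ℝ => Real.sin (l * p.1) :=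
      Real.contDiff_sin.comp (contDiff_const.mul contDiff_fst)
    exact (h3.mul h1).sub (h4.mul h2)
  · obtain ⟨R, hR⟩ := χ.2.2.isCompact.isBounded.exists_norm_le
    refine ⟨R, fun x y hy => ?_⟩
    have : (χ : ℝ → ℂ) y = 0 := by
      by_contra h
      exact absurd (hR y (subset_tsupport _ h)) (not_le.2 hy)
    simp [lift, this]

lemma hasDerivAt_lift_fst (l : ℕ) (a : ℝ → ℂ) (x y : ℝ) :
    HasDerivAt (fun t => lift l a (t, y)) (lift l (fun y => (l : ℝ) • (Complex.I • a y)) (x, y)) x := by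
  have h : HasDerivAt (fun t : ℝ => (l : ℝ) * t) (l : ℝ) x := by
    simpa using (hasDerivAt_id x).const_mul (l : ℝ)
  have := (h.cos.mul_const (a y).re).sub (h.sin.mul_const (a y).im)
  refine this.congr_deriv ?_
  simp [lift]
  ring

lemma hasDerivAt_lift_snd (l : ℕ) (χ : testSpace) (x y : ℝ) :
    HasDerivAt (fun t => lift l χ (x, t)) (lift l (testDeriv χ) (x, y)) y := by
  have h := testSpace_hasDerivAt χ y
  have h1 := Complex.reCLM.hasFDerivAt.comp_hasDerivAt y h
  have h2 := Complex.imCLM.hasFDerivAt.comp_hasDerivAt y h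
  exact (h1.const_mul (Real.cos (l * x))).sub (h2.const_mul (Real.sin (l * x)))

lemma fderiv_lift_eX (l : ℕ) (χ : testSpace) (p : ℝ × ℝ) :
    fderiv ℝ (lift l χ) p eX = lift l ((l : ℝ) • testMulI χ : testSpace) p :=
  (hasDerivAt_slice_fst (isTest_lift l χ).differentiable p.1 p.2).unique
    (hasDerivAt_lift_fst l χ p.1 p.2)

lemma fderiv_lift_eY (l : ℕ) (χ : testSpace) (p : ℝ × ℝ) :
    fderiv ℝ (lift l χ) p eY = lift l (testDeriv χ) p :=
  (hasDerivAt_slice_snd (isTest_lift l χ).differentiable p.1 p.2).unique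
    (hasDerivAt_lift_snd l χ p.1 p.2)

section WeakDeriv

variable {v : ℝ × ℝ} {f f' g g' : ℝ × ℝ → ℝ}

lemma IsWeakDeriv.congr (h : IsWeakDeriv v f g) (hf : f =ᵐ[cyl] f') (hg : g =ᵐ[cyl] g') :
    IsWeakDeriv v f' g' := by
  refine ⟨h.1.ae_eq hg, fun φ hφ => ?_⟩
  have e1 : ∫ p, f p * fderiv ℝ φ p v ∂cyl = ∫ p, f' p * fderiv ℝ φ p v ∂cyl :=
    integral_congr_ae (hf.mul (ae_eq_refl fun p => fderiv ℝ φ p v))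
  have e2 : ∫ p, g p * φ p ∂cyl = ∫ p, g' p * φ p ∂cyl :=
    integral_congr_ae (hg.mul (ae_eq_refl φ))
  rw [← e1, ← e2]
  exact h.2 φ hφ

lemma inner_liftMap_test (f : L2Cyl) (l : ℕ) (χ : testSpace) :
    ⟪f, liftMap l (testToLp χ)⟫ = ∫ p, f p * lift l χ p ∂cyl := by
  rw [cyl_inner_def]
  refine integral_congr_ae ?_
  filter_upwards [coeFn_liftMap l (testToLp χ), lift_congr l (coeFn_testToLp χ)] with p h1 h2
  rw [h1, h2]

/-- Differentiation in `y` acts on every Fourier coefficient. -/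
lemma IsWeakDeriv.coeffMap_eY {f g : L2Cyl} (h : IsWeakDeriv eY f g) (l : ℕ) :
    WeakD (coeffMap l f) (coeffMap l g) := by
  intro χ
  have h1 := h.2 _ (isTest_lift l χ)
  simp only [fderiv_lift_eY] at h1
  rwa [inner_coeffMap, inner_coeffMap, inner_liftMap_test, inner_liftMap_test]

/-- Differentiation in `x` multiplies the Fourier coefficient of frequency `l` by `i l`. -/
lemma IsWeakDeriv.coeffMap_eX {f g : L2Cyl} (h : IsWeakDeriv eX f g) (l : ℕ) :
    coeffMap l g = (l : ℝ) • (Complex.I • coeffMap l f) := by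
  refine denseRange_testToLp.eq_of_inner_left ℝ fun χ => ?_
  have h1 := h.2 _ (isTest_lift l χ)
  simp only [fderiv_lift_eX] at h1
  rw [← inner_liftMap_test, ← inner_liftMap_test, ← inner_coeffMap, ← inner_coeffMap, map_smul,
    testToLp_mulI, real_inner_smul_right] at h1
  rw [real_inner_smul_left, line_inner_I_left]
  linarith

/-- Weak derivatives are unique, since the tests `lift l χ` determine all Fourier coefficients. -/
lemma IsWeakDeriv.unique (h : IsWeakDeriv v f g) (h' : IsWeakDeriv v f g') : g =ᵐ[cyl] g' := by
  have key : h.1.toLp g - h'.1.toLp g' = 0 := by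
    refine eq_zero_of_coeffMap fun l => ?_
    refine denseRange_testToLp.eq_of_inner_left ℝ fun χ => ?_
    have h1 := h.2 _ (isTest_lift l χ)
    rw [h'.2 _ (isTest_lift l χ)] at h1
    have e : ∀ {g : ℝ × ℝ → ℝ} (hg : MemLp g 2 cyl),
        ⟪hg.toLp g, liftMap l (testToLp χ)⟫ = ∫ p, g p * lift l χ p ∂cyl := fun hg => by
      rw [inner_liftMap_test]
      exact integral_congr_ae (hg.coeFn_toLp.mul (ae_eq_refl _))
    rw [inner_coeffMap, inner_sub_left, e h.1, e h'.1, inner_zero_left]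
    linarith
  rw [sub_eq_zero] at key
  exact (MemLp.toLp_eq_toLp_iff h.1 h'.1).1 key

lemma isWeakDeriv_weakDeriv (h : HasL2Deriv v f) : IsWeakDeriv v f (weakDeriv v f) := by
  rw [weakDeriv, dif_pos h]
  exact h.choose_spec

lemma IsWeakDeriv.weakDeriv_ae_eq (h : IsWeakDeriv v f g) : weakDeriv v f =ᵐ[cyl] g :=
  (isWeakDeriv_weakDeriv ⟨g, h⟩).unique h

end WeakDeriv

lemma isWeakDeriv_lift_eX (k : ℕ) (a : L2Line) :
    IsWeakDeriv eX (lift k a) (lift k ((k : ℝ) • (Complex.I • a) : L2Line)) := by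
  have hb : (((k : ℝ) • (Complex.I • a) : L2Line) : ℝ → ℂ) =ᵐ[volume]
      fun y => (k : ℝ) • (Complex.I • a y) := by
    filter_upwards [Lp.coeFn_smul (k : ℝ) (Complex.I • a), Lp.coeFn_smul Complex.I a] with y h1 h2
    rw [h1, Pi.smul_apply, h2, Pi.smul_apply]
  have hbm := (memLp_congr_ae hb).1 (Lp.memLp _)
  refine IsWeakDeriv.congr (f := lift k a) (g := lift k fun y => (k : ℝ) • (Complex.I • a y))
    ⟨memLp_lift k hbm, fun φ hφ => ?_⟩ (ae_eq_refl _) (lift_congr k hb.symm)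
  have i1 : Integrable (fun p => lift k a p * fderiv ℝ φ p eX) cyl :=
    (memLp_lift k (Lp.memLp a)).integrable_mul (hφ.memLp_fderiv eX)
  have i2 : Integrable (fun p => lift k (fun y => (k : ℝ) • (Complex.I • a y)) p * φ p) cyl :=
    (memLp_lift k hbm).integrable_mul hφ.memLp
  rw [integral_cyl i1, integral_cyl i2, ← integral_neg]
  refine integral_congr_ae (Eventually.of_forall fun y => ?_)
  dsimp only
  rw [← intervalIntegral.integral_of_le two_pi_pos.le,
    ← intervalIntegral.integral_of_le two_pi_pos.le]
  have hc1 := continuous_lift_slice k (fun y => (k : ℝ) • (Complex.I • a y)) y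
  have hc2 : Continuous fun x => fderiv ℝ φ (x, y) eX :=
    (hφ.continuous_fderiv eX).comp (by fun_prop)
  rw [intervalIntegral.integral_mul_deriv_eq_deriv_mul
    (fun x _ => hasDerivAt_lift_fst k a x y) (fun x _ => hasDerivAt_slice_fst hφ.differentiable x y)
    (hc1.intervalIntegrable _ _) (hc2.intervalIntegrable _ _)]
  have e1 : φ (2 * Real.pi, y) = φ (0, y) := by simpa using hφ.2.1 0 y
  have e2 : lift k a (2 * Real.pi, y) = lift k a (0, y) := by
    simpa using lift_add_two_pi k a 0 y
  rw [e1, e2]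
  ring

/-- The test function `φ` on the cylinder is used on each line `x = const`, as the test function
`φ(x, ·) exp(- i k x)`. -/
lemma isWeakDeriv_lift_eY (k : ℕ) {a b : L2Line} (h : WeakD a b) :
    IsWeakDeriv eY (lift k a) (lift k b) := by
  refine ⟨memLp_lift k (Lp.memLp b), fun φ hφ => ?_⟩
  have i1 : Integrable (fun p => lift k a p * fderiv ℝ φ p eY) cyl :=
    (memLp_lift k (Lp.memLp a)).integrable_mul (hφ.memLp_fderiv eY)
  have i2 : Integrable (fun p => lift k b p * φ p) cyl :=
    (memLp_lift k (Lp.memLp b)).integrable_mul hφ.memLp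
  rw [cyl, integral_prod _ i1, integral_prod _ i2, ← integral_neg]
  refine integral_congr_ae (Eventually.of_forall fun x => ?_)
  dsimp only
  set z : ℂ := ⟨Real.cos (k * x), -Real.sin (k * x)⟩ with hz
  have hinner : ∀ (c : L2Line) (r y : ℝ), ⟪c y, r • z⟫ = lift k c (x, y) * r := by
    intro c r y
    rw [real_inner_smul_right, complex_inner_eq, lift, hz]
    ring
  obtain ⟨R, hR⟩ := hφ.2.2
  let χ : testSpace := ⟨fun y => φ (x, y) • z,
    (hφ.1.comp (contDiff_const.prodMk contDiff_id)).smul contDiff_const,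
    HasCompactSupport.intro (isCompact_Icc (a := -R) (b := R)) fun y hy => by
      rw [hR x y (by
        by_contra! h
        exact hy (abs_le.1 h)), zero_smul]⟩
  have hχ : ∀ y, (testDeriv χ : ℝ → ℂ) y = fderiv ℝ φ (x, y) eY • z := fun y =>
    ((hasDerivAt_slice_snd hφ.differentiable x y).smul_const z).deriv
  have h1 := h χ
  rw [line_inner_def, line_inner_def] at h1
  have e1 : ∫ y, ⟪a y, testToLp (testDeriv χ) y⟫ = ∫ y, lift k a (x, y) * fderiv ℝ φ (x, y) eY := by
    refine integral_congr_ae ?_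
    filter_upwards [coeFn_testToLp (testDeriv χ)] with y hy
    rw [hy, hχ, hinner]
  have e2 : ∫ y, ⟪b y, testToLp χ y⟫ = ∫ y, lift k b (x, y) * φ (x, y) := by
    refine integral_congr_ae ?_
    filter_upwards [coeFn_testToLp χ] with y hy
    rw [hy]
    exact hinner b _ y
  rw [← e1, ← e2]
  exact h1

/-! ### From the cylinder to amplitudes -/

/-- `f(x, y) = Re (a(y) exp(i k x))` almost everywhere. -/
def HasAmp (k : ℕ) (f : ℝ × ℝ → ℝ) (a : L2Line) : Prop := f =ᵐ[cyl] lift k a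

lemma aestronglyMeasurable_fourierX (f : L2Cyl) (l : ℤ) :
    AEStronglyMeasurable (fourierX f l) volume := by
  have h1 : AEStronglyMeasurable (fun p : ℝ × ℝ => (f p : ℂ)) cyl :=
    Complex.continuous_ofReal.comp_aestronglyMeasurable (Lp.aestronglyMeasurable f)
  have h2 : Continuous fun p : ℝ × ℝ => Complex.exp (-(Complex.I * l * p.1)) := by fun_prop
  have h3 : AEStronglyMeasurable
      (fun p : ℝ × ℝ => (f p : ℂ) * Complex.exp (-(Complex.I * l * p.1))) cyl :=
    h1.mul h2.aestronglyMeasurable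
  exact h3.prod_swap.integral_prod_right'.const_mul _

/-- The amplitude is `a_k + conj a_{-k}`; the reality of `f` enters only through taking real
parts. -/
lemma exists_hasAmp_of_isBand {k : ℕ} (hk : 1 ≤ k) {f : L2Cyl} (h : IsBand k f) :
    ∃ a, HasAmp k f a := by
  set a : ℝ → ℂ := fun y => fourierX f k y + (starRingEnd ℂ) (fourierX f (-k) y) with ha
  have hfa : f =ᵐ[cyl] lift k a := by
    filter_upwards [h] with p hp
    have hne : (k : ℤ) ≠ -(k : ℤ) := by omega
    rw [bandPart, Finset.sum_pair hne] at hp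
    have e1 : Complex.exp (Complex.I * ((k : ℤ) : ℂ) * p.1)
        = ⟨Real.cos (k * p.1), Real.sin (k * p.1)⟩ := by
      rw [show Complex.I * ((k : ℤ) : ℂ) * p.1 = ((k * p.1 : ℝ) : ℂ) * Complex.I by push_cast; ring]
      exact Complex.ext (Complex.exp_ofReal_mul_I_re _) (Complex.exp_ofReal_mul_I_im _)
    have e2 : Complex.exp (Complex.I * ((-(k : ℤ) : ℤ) : ℂ) * p.1)
        = ⟨Real.cos (k * p.1), -Real.sin (k * p.1)⟩ := by
      rw [show Complex.I * ((-(k : ℤ) : ℤ) : ℂ) * p.1 = ((-(k * p.1) : ℝ) : ℂ) * Complex.I by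
        push_cast; ring, ← Real.cos_neg, ← Real.sin_neg]
      exact Complex.ext (Complex.exp_ofReal_mul_I_re _) (Complex.exp_ofReal_mul_I_im _)
    have := congrArg Complex.re hp
    rw [e1, e2, Complex.ofReal_re, Complex.add_re, Complex.mul_re, Complex.mul_re] at this
    rw [this, lift, ha]
    simp only [Complex.add_re, Complex.add_im, Complex.conj_re, Complex.conj_im]
    ring
  have hm : AEStronglyMeasurable a volume :=
    (aestronglyMeasurable_fourierX f k).add
      (Complex.continuous_conj.comp_aestronglyMeasurable (aestronglyMeasurable_fourierX f (-k)))
  have hL : MemLp a 2 volume := memLp_of_memLp_lift hk hm ((Lp.memLp f).ae_eq hfa)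
  exact ⟨hL.toLp a, hfa.trans (lift_congr k hL.coeFn_toLp.symm)⟩

namespace HasAmp

variable {k : ℕ} {f g : ℝ × ℝ → ℝ} {a b : L2Line}

lemma memLp (h : HasAmp k f a) : MemLp f 2 cyl := (memLp_lift k (Lp.memLp a)).ae_eq h.symm

lemma eq_liftMap {f : L2Cyl} (h : HasAmp k f a) : f = liftMap k a :=
  Lp.ext (h.trans (coeFn_liftMap k a).symm)

lemma coeffMap_eq {f : L2Cyl} (hk : 1 ≤ k) (h : HasAmp k f a) : Real.pi⁻¹ • coeffMap k f = a := by
  rw [h.eq_liftMap, coeffMap_liftMap_self hk]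

lemma add (h : HasAmp k f a) (h' : HasAmp k g b) : HasAmp k (fun p => f p + g p) (a + b) := by
  filter_upwards [h, h', ae_cyl_of_ae (Lp.coeFn_add a b)] with p h1 h2 h3
  rw [h1, h2]
  simp only [lift, h3, Pi.add_apply, Complex.add_re, Complex.add_im]
  ring

lemma smul (r : ℝ) (h : HasAmp k f a) : HasAmp k (fun p => r * f p) (r • a) := by
  filter_upwards [h, ae_cyl_of_ae (Lp.coeFn_smul r a)] with p h1 h3
  rw [h1]
  simp only [lift, h3, Pi.smul_apply, Complex.smul_re, Complex.smul_im, smul_eq_mul]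
  ring

lemma mulY {m : L2Line} (h : HasAmp k f a) (hm : IsMulY a m) : HasAmp k (mulY f) m := by
  filter_upwards [h, ae_cyl_of_ae hm] with p h1 h2
  rw [Poiseuille.mulY, h1, lift, lift, h2]
  simp only [Complex.smul_re, Complex.smul_im, smul_eq_mul]
  ring

lemma isWeakDeriv_eX (h : HasAmp k f a) :
    IsWeakDeriv eX f (lift k ((k : ℝ) • (Complex.I • a) : L2Line)) :=
  (isWeakDeriv_lift_eX k a).congr h.symm (ae_eq_refl _)

lemma isWeakDeriv_eY (h : HasAmp k f a) (hab : WeakD a b) : IsWeakDeriv eY f (lift k b) :=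
  (isWeakDeriv_lift_eY k hab).congr h.symm (ae_eq_refl _)

lemma dX (h : HasAmp k f a) : HasAmp k (dX f) ((k : ℝ) • (Complex.I • a)) :=
  h.isWeakDeriv_eX.weakDeriv_ae_eq

lemma dY (h : HasAmp k f a) (hab : WeakD a b) : HasAmp k (dY f) b :=
  (h.isWeakDeriv_eY hab).weakDeriv_ae_eq

lemma exists_weakD (hk : 1 ≤ k) (h : HasAmp k f a) (hf : HasL2Deriv eY f) : ∃ b, WeakD a b := by
  obtain ⟨g, hg⟩ := hf
  have h1 : IsWeakDeriv eY (liftMap k a) (hg.1.toLp g) :=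
    hg.congr (h.trans (coeFn_liftMap k a).symm) hg.1.coeFn_toLp.symm
  have h2 := (h1.coeffMap_eY k).smul Real.pi⁻¹
  rw [coeffMap_liftMap_self hk] at h2
  exact ⟨_, h2⟩

lemma memH1 (h : HasAmp k f a) (hab : WeakD a b) : MemH1 f :=
  ⟨h.memLp, ⟨_, h.isWeakDeriv_eX⟩, ⟨_, h.isWeakDeriv_eY hab⟩⟩

lemma _root_.Poiseuille.WeakD.dX {a b : L2Line} (h : WeakD a b) (r : ℝ) :
    WeakD (r • (Complex.I • a)) (r • (Complex.I • b)) := h.mulI.smul r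

lemma _root_.Poiseuille.IsMulY.dX {a b : L2Line} (h : IsMulY a b) (r : ℝ) :
    IsMulY (r • (Complex.I • a)) (r • (Complex.I • b)) := h.mulI.smul r

lemma memH2 {c : L2Line} (h : HasAmp k f a) (hab : WeakD a b) (hbc : WeakD b c) : MemH2 f :=
  ⟨h.memH1 hab, h.dX.memH1 (hab.dX k), (h.dY hab).memH1 hbc⟩

lemma lap {c : L2Line} (h : HasAmp k f a) (hab : WeakD a b) (hbc : WeakD b c) :
    HasAmp k (lap f) (c - (k : ℝ) ^ 2 • a) := by
  have h1 := h.dX.dX.add ((h.dY hab).dY hbc)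
  have e : (k : ℝ) • (Complex.I • ((k : ℝ) • (Complex.I • a))) + c = c - (k : ℝ) ^ 2 • a := by
    rw [smul_comm Complex.I (k : ℝ), smul_smul Complex.I, Complex.I_mul_I, neg_one_smul, smul_neg,
      smul_neg, smul_smul, ← sq]
    abel
  rwa [e] at h1

/-- A function of `y` can be multiplied into the amplitude when the product is in `L²`. -/
lemma exists_weight (hk : 1 ≤ k) (h : HasAmp k f a) {w : ℝ → ℝ} (hw : Continuous w)
    (hm : MemLp (fun p => w p.2 * f p) 2 cyl) : ∃ d : L2Line, ∀ᵐ y, d y = w y • a y := by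
  have h1 : (fun p => w p.2 * f p) =ᵐ[cyl] lift k fun y => w y • a y := by
    filter_upwards [h] with p hp
    rw [hp, lift, lift]
    simp only [Complex.smul_re, Complex.smul_im, smul_eq_mul]
    ring
  have h2 := memLp_of_memLp_lift hk
    (hw.aestronglyMeasurable.smul (Lp.aestronglyMeasurable a)) (hm.ae_eq h1)
  exact exists_line_of_memLp h2

lemma scal (hk : 1 ≤ k) (h : HasAmp k f a) (h' : HasAmp k g b) :
    scal f g = Real.pi * ⟪a, b⟫ := by
  have h1 := integral_lift_mul_lift k hk (Lp.memLp a) (Lp.memLp b)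
  rw [if_pos rfl, ← line_inner_def] at h1
  rw [Poiseuille.scal, ← h1]
  exact integral_congr_ae (EventuallyEq.mul h h')

lemma normSq (hk : 1 ≤ k) (h : HasAmp k f a) : normSq f = Real.pi * ‖a‖ ^ 2 := by
  have := h.scal hk h
  rw [real_inner_self_eq_norm_sq] at this
  rw [← this, Poiseuille.scal, Poiseuille.normSq]
  simp only [sq]

end HasAmp

lemma eq_inv_smul_I {k : ℝ} (hk : k ≠ 0) (a : L2Line) :
    (-k⁻¹) • (Complex.I • (k • (Complex.I • a))) = a := by
  rw [smul_comm Complex.I k, smul_smul Complex.I, Complex.I_mul_I, neg_one_smul, smul_smul]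
  simp [hk]

/-- The amplitude of `∂ₓ f` is `i k a`, so integrability of `y ∂ₓ f` gives that of `y a`. -/
lemma HasAmp.exists_isMulY {k : ℕ} (hk : 1 ≤ k) {f : ℝ × ℝ → ℝ} {a : L2Line} (h : HasAmp k f a)
    (hm : MemLp (Poiseuille.mulY (Poiseuille.dX f)) 2 cyl) : ∃ m, IsMulY a m := by
  have hk0 : (k : ℝ) ≠ 0 := by positivity
  obtain ⟨d, hd⟩ := h.dX.exists_weight hk continuous_id hm
  have h1 : IsMulY ((k : ℝ) • (Complex.I • a)) d := hd
  have h2 := h1.mulI.smul (-(k : ℝ)⁻¹)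
  rw [eq_inv_smul_I hk0] at h2
  exact ⟨_, h2⟩

lemma HasAmp.exists_isMulY_isMulY {k : ℕ} (hk : 1 ≤ k) {f : ℝ × ℝ → ℝ} {a : L2Line}
    (h : HasAmp k f a) (hm : MemLp (Poiseuille.mulY (Poiseuille.mulY (Poiseuille.dX f))) 2 cyl) :
    ∃ m d, IsMulY a m ∧ IsMulY m d := by
  have hk0 : (k : ℝ) ≠ 0 := by positivity
  obtain ⟨d, hd⟩ := h.dX.exists_weight hk (w := fun y => y ^ 2) (by fun_prop)
    (by refine hm.ae_eq (Eventually.of_forall fun p => ?_)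
        simp only [Poiseuille.mulY]
        ring)
  obtain ⟨m, h1, h2⟩ := exists_mulY_of_sq hd
  have h3 := h1.mulI.smul (-(k : ℝ)⁻¹)
  rw [eq_inv_smul_I hk0] at h3
  exact ⟨_, _, h3, h2.mulI.smul _⟩

section Stream

/-- The only square integrable solution of `φ'' = l² φ` is zero. -/
lemma IsAmpStream.eq_zero {l : ℕ} {φ φ₁ : L2Line} (h : IsAmpStream l 0 φ φ₁) : φ = 0 := by
  rcases Nat.eq_zero_or_pos l with rfl | hl
  · have h1 := h.inner_eq h
    have h2 : φ₁ = 0 := by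
      rw [inner_zero_left, real_inner_self_eq_norm_sq] at h1
      rw [← norm_eq_zero, ← sq_eq_zero_iff]
      simp at h1
      simp [h1]
    have h3 := h.deriv
    rw [h2] at h3
    obtain ⟨A, hA, hA1, hA2⟩ := h3.exists_prim
    have hconst : ∀ y, A y = A 0 := fun y => by
      have e : ∀ y, (A y).re = (A 0).re ∧ (A y).im = (A 0).im := fun y => by
        have z := Lp.coeFn_zero ℂ 2 (volume : Measure ℝ)
        have p1 := ((hA1.congr (z.fun_comp Complex.re)) 0 y).2
        have p2 := ((hA2.congr (z.fun_comp Complex.im)) 0 y).2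
        simp at p1 p2
        exact ⟨by linarith, by linarith⟩
      exact Complex.ext (e y).1 (e y).2
    have hm : MemLp (fun _ : ℝ => A 0) 2 volume := by
      refine (Lp.memLp φ).ae_eq (hA.trans (Eventually.of_forall hconst))
    rw [memLp_const_iff (by norm_num) (by norm_num)] at hm
    have h0 : A 0 = 0 := by simpa using hm
    refine Lp.ext ?_
    filter_upwards [hA, Lp.coeFn_zero ℂ 2 (volume : Measure ℝ)] with y h1 h2
    rw [h1, h2, hconst, h0]
    rfl
  · have h1 := h.norm_le
    rw [norm_zero] at h1
    have h2 : (0 : ℝ) < (l : ℝ) ^ 2 := by positivity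
    exact norm_eq_zero.1 (le_antisymm (nonpos_of_mul_nonpos_right h1 h2) (norm_nonneg _))

/-- On every frequency, the Fourier coefficients of stream function and vorticity are related by
`φ'' - l² φ = a`. -/
lemma IsStream.exists_isAmpStream {ψ ω : L2Cyl} (h : IsStream ψ ω) (l : ℕ) :
    ∃ φ₁, IsAmpStream l (coeffMap l ω) (coeffMap l ψ) φ₁ := by
  obtain ⟨⟨⟨-, hX, hY⟩, ⟨-, hXX, -⟩, ⟨-, -, hYY⟩⟩, hlap⟩ := h
  have wX := isWeakDeriv_weakDeriv hX
  have wY := isWeakDeriv_weakDeriv hY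
  have wXX := isWeakDeriv_weakDeriv hXX
  have wYY := isWeakDeriv_weakDeriv hYY
  have cX := (wX.congr (ae_eq_refl _) wX.1.coeFn_toLp.symm).coeffMap_eX l
  have cY := (wY.congr (ae_eq_refl _) wY.1.coeFn_toLp.symm).coeffMap_eY l
  have cXX := (wXX.congr wX.1.coeFn_toLp.symm wXX.1.coeFn_toLp.symm).coeffMap_eX l
  have cYY := (wYY.congr wY.1.coeFn_toLp.symm wYY.1.coeFn_toLp.symm).coeffMap_eY l
  have hω : ω = wXX.1.toLp _ + wYY.1.toLp _ := by
    refine Lp.ext ?_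
    filter_upwards [hlap, Lp.coeFn_add (wXX.1.toLp _) (wYY.1.toLp _), wXX.1.coeFn_toLp,
      wYY.1.coeFn_toLp] with p h1 h2 h3 h4
    rw [h2, Pi.add_apply, h3, h4, ← h1]
    rfl
  refine ⟨_, cY, ?_⟩
  have e : (l : ℝ) ^ 2 • coeffMap l ψ + coeffMap l ω = coeffMap l (wYY.1.toLp _) := by
    rw [hω, map_add, cXX, cX, smul_comm Complex.I (l : ℝ), smul_smul Complex.I, Complex.I_mul_I,
      neg_one_smul, smul_neg, smul_neg, smul_smul, ← sq]
    abel
  rw [e]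
  exact cYY

/-- The stream function of a vorticity with frequency `k` has frequency `k`, and its amplitude
solves `φ'' - k² φ = a`. -/
lemma IsStream.exists_hasAmp {k : ℕ} (hk : 1 ≤ k) {ψ ω : L2Cyl} (h : IsStream ψ ω) {a : L2Line}
    (ha : HasAmp k ω a) : ∃ φ φ₁, HasAmp k ψ φ ∧ IsAmpStream k a φ φ₁ := by
  obtain ⟨φ₁, hφ⟩ := h.exists_isAmpStream k
  have hφ' := hφ.smul Real.pi⁻¹
  rw [ha.coeffMap_eq hk] at hφ'
  refine ⟨_, _, ?_, hφ'⟩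
  have key : ψ - liftMap k (Real.pi⁻¹ • coeffMap k ψ) = 0 := by
    refine eq_zero_of_coeffMap fun l => ?_
    rw [map_sub, coeffMap_liftMap l hk]
    split_ifs with hl
    · rw [hl, smul_smul, mul_inv_cancel₀ Real.pi_ne_zero, one_smul, sub_self]
    · obtain ⟨θ, hθ⟩ := h.exists_isAmpStream l
      rw [ha.eq_liftMap, coeffMap_liftMap l hk, if_neg hl] at hθ
      rw [hθ.eq_zero, sub_zero]
  have h1 := coeFn_liftMap k (Real.pi⁻¹ • coeffMap k ψ)
  rw [← sub_eq_zero.1 key] at h1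
  exact h1

end Stream

/-- A function of frequency `k` in the domain of the linear operator has an amplitude in the domain
of the amplitude operators. -/
lemma InDomain.exists_isAmpDomain {k : ℕ} (hk : 1 ≤ k) {ω ψ : L2Cyl} (hω : InDomain ω)
    (hψ : IsStream ψ ω) {a : L2Line} (ha : HasAmp k ω a) :
    ∃ b c m e d φ φ₁, IsAmpDomain k a b c m e d φ φ₁ ∧ HasAmp k ψ φ := by
  obtain ⟨b, hb⟩ := ha.exists_weakD hk hω.1.1.2.2
  obtain ⟨c, hc⟩ := (ha.dY hb).exists_weakD hk hω.1.2.2.2.2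
  obtain ⟨m, d, hm, hd⟩ := ha.exists_isMulY_isMulY hk hω.2
  obtain ⟨e, he⟩ := exists_mulY_deriv hb hc hm hd
  obtain ⟨φ, φ₁, h1, h2⟩ := hψ.exists_hasAmp hk ha
  exact ⟨b, c, m, e, d, φ, φ₁, ⟨hb, hc, hm, he, hd, h2⟩, h1⟩

section Norms

variable {k : ℕ} {ω ψ : ℝ × ℝ → ℝ} {a b c m e d φ φ₁ : L2Line}

lemma IsAmpDomain.finiteNorms (h : IsAmpDomain k a b c m e d φ φ₁) (hω : HasAmp k ω a)
    (hψ : HasAmp k ψ φ) : FiniteNorms ω ψ :=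
  ⟨hω.memH2 h.deriv h.deriv_deriv, hψ.memH2 h.stream.deriv h.stream.deriv_deriv,
    (hω.dX.mulY (h.mulY.dX k)).memLp, (hω.dX.dX.mulY ((h.mulY.dX k).dX k)).memLp,
    ((hω.dY h.deriv).dX.mulY (h.mulY_deriv.dX k)).memLp⟩

/-! Viscosity and frequency enter through `n = ν^{1/2}` and `q = k^{1/2}`, which makes all powers
integral. -/

lemma rpow_half_eq {x n : ℝ} (hn : 0 ≤ n) (h : n ^ 2 = x) : x ^ (1 / 2 : ℝ) = n := by
  rw [← Real.sqrt_eq_rpow, ← h, Real.sqrt_sq hn]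

lemma rpow_three_half_eq {x n : ℝ} (hn : 0 ≤ n) (h : n ^ 2 = x) : x ^ (3 / 2 : ℝ) = n ^ 3 := by
  rw [← h, ← Real.rpow_natCast n 2, ← Real.rpow_natCast n 3, ← Real.rpow_mul hn]
  norm_num

lemma norm_smul_I_sq (r : ℝ) (x : L2Line) : ‖r • (Complex.I • x)‖ ^ 2 = r ^ 2 * ‖x‖ ^ 2 := by
  rw [norm_smul, norm_I_smul, mul_pow, Real.norm_eq_abs, sq_abs]

variable {ν n q : ℝ}

lemma IsAmpEnergy.phi_eq (hk : 1 ≤ k) (hn : 0 < n) (hν : n ^ 2 = ν) (hq : 0 < q)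
    (hqk : q ^ 2 = k) (α β γ : ℝ) (h : IsAmpEnergy (q ^ 2) a b m φ φ₁) (hω : HasAmp k ω a)
    (hψ : HasAmp k ψ φ) : Phi α β γ ν k ω ψ = Real.pi / 2 *
      energyForm (α * (n / q)) (4 * β) (γ * (q / n)) (q ^ 2) a b m φ φ₁ a b m φ φ₁ := by
  have n1 := hω.normSq hk
  have n2 := hω.dX.normSq hk
  have n3 := (hω.dY h.deriv).normSq hk
  have n4 := (hω.dX.mulY (h.mulY.dX k)).scal hk (hω.dY h.deriv)
  have n5 := (hω.dX.mulY (h.mulY.dX k)).normSq hk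
  have n6 := hψ.dX.dX.normSq hk
  have n7 := (hψ.dX.dY (h.stream.deriv.dX k)).normSq hk
  rw [norm_smul_I_sq] at n2 n5 n7
  rw [norm_smul_I_sq, norm_smul_I_sq] at n6
  rw [real_inner_smul_left] at n4
  rw [Phi, gradSq, gradSq, n1, n2, n3, n4, n5, n6, n7, rpow_half_eq hn.le hν,
    rpow_half_eq hq.le hqk, rpow_three_half_eq hq.le hqk, ← hqk, energyForm_self]
  field_simp
  ring

lemma IsAmpDomain.dissip_eq (hk : 1 ≤ k) (hn : 0 < n) (hν : n ^ 2 = ν) (hq : 0 < q)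
    (hqk : q ^ 2 = k) (ε α β γ : ℝ) (h : IsAmpDomain (q ^ 2) a b c m e d φ φ₁)
    (hω : HasAmp k ω a) (hψ : HasAmp k ψ φ) : dissip ε α β γ ν k ω ψ = Real.pi *
      (ε * n * q *
          energyForm (α * (n / q)) (4 * β) (γ * (q / n)) (q ^ 2) a b m φ φ₁ a b m φ φ₁
        + α * n ^ 3 / (2 * q) * ‖c - (q ^ 2) ^ 2 • a‖ ^ 2
        + γ * n * q * (7 / 8 * ((q ^ 2) ^ 2 * ‖m‖ ^ 2 + ‖e‖ ^ 2) + ‖a‖ ^ 2)) := by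
  have n1 := (hω.lap h.deriv h.deriv_deriv).normSq hk
  have n2 := hω.dX.normSq hk
  have n3 := (hω.dX.dX.mulY ((h.mulY.dX k).dX k)).normSq hk
  have n4 := ((hω.dY h.deriv).dX.mulY (h.mulY_deriv.dX k)).normSq hk
  rw [norm_smul_I_sq] at n2 n4
  rw [norm_smul_I_sq, norm_smul_I_sq] at n3
  rw [dissip, h.energy.phi_eq hk hn hν hq hqk α β γ hω hψ, n1, n2, n3, n4, rpow_half_eq hn.le hν,
    rpow_three_half_eq hn.le hν, rpow_half_eq hq.le hqk, rpow_three_half_eq hq.le hqk, ← hqk]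
  field_simp

end Norms

/-! ### The evolution of the amplitude -/

lemma IsAmpStream.unique {k : ℝ} (hk : 0 < k) {a φ φ₁ φ' φ₁' : L2Line} (h : IsAmpStream k a φ φ₁)
    (h' : IsAmpStream k a φ' φ₁') : φ = φ' := by
  have h1 := (h.add (h'.smul (-1))).norm_le
  rw [neg_one_smul, neg_one_smul, add_neg_cancel, norm_zero, ← sub_eq_add_neg] at h1
  have h2 : 0 < k ^ 2 := by positivity
  exact sub_eq_zero.1 (norm_eq_zero.1
    (le_antisymm (nonpos_of_mul_nonpos_right h1 h2) (norm_nonneg _)))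

/-- The right-hand side of the vorticity equation has amplitude `ampL`. -/
lemma HasAmp.ampL_of_equation {k : ℕ} {ν : ℝ} {ω ψ w : ℝ × ℝ → ℝ} {a b c m e d φ φ₁ : L2Line}
    (hω : HasAmp k ω a) (hψ : HasAmp k ψ φ) (h : IsAmpDomain k a b c m e d φ φ₁)
    (heq : ∀ᵐ p ∂cyl, w p + p.2 ^ 2 * Poiseuille.dX ω p - 2 * Poiseuille.dX ψ p
      = ν * Poiseuille.lap ω p) : HasAmp k w (ampL ν k a c d φ) := by
  have h1 := (((hω.lap h.deriv h.deriv_deriv).smul ν).add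
    (((hω.dX.mulY (h.mulY.dX k)).mulY (h.mulY_mulY.dX k)).smul (-1))).add (hψ.dX.smul 2)
  have e : ampL ν k a c d φ = ν • (c - (k : ℝ) ^ 2 • a)
      + (-1 : ℝ) • ((k : ℝ) • (Complex.I • d)) + (2 : ℝ) • ((k : ℝ) • (Complex.I • φ)) := by
    rw [ampL, neg_one_smul, smul_smul 2, sub_eq_add_neg]
  rw [e]
  refine EventuallyEq.trans ?_ h1
  filter_upwards [heq] with p hp
  simp only [Poiseuille.mulY]
  linarith

/-- The amplitude of frequency `k` of a function, for `k ≥ 1`. -/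
def amplitude (k : ℕ) : L2Cyl →L[ℝ] L2Line := Real.pi⁻¹ • coeffMap k

lemma hasAmp_amplitude {k : ℕ} (hk : 1 ≤ k) {f : L2Cyl} (h : IsBand k f) :
    HasAmp k f (amplitude k f) := by
  obtain ⟨a, ha⟩ := exists_hasAmp_of_isBand hk h
  rwa [amplitude, _root_.smul_apply, ha.coeffMap_eq hk]

section Solution

variable {ν n q : ℝ} {k : ℕ} {ω ψ : ℝ → L2Cyl}

lemma exists_mem_ampGraph {A B G : ℝ} (hk : 1 ≤ k) {ω ψ : L2Cyl} (hω : InDomain ω)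
    (hψ : IsStream ψ ω) (hb : IsBand k ω) : ∃ b c m e d φ φ₁,
      IsAmpDomain k (amplitude k ω) b c m e d φ φ₁ ∧ HasAmp k ψ φ ∧
      (amplitude k ω, ampL ν k (amplitude k ω) c d φ, ampP A B G k (amplitude k ω) c e d φ)
        ∈ ampGraph ν k A B G := by
  obtain ⟨b, c, m, e, d, φ, φ₁, h, h'⟩ := hω.exists_isAmpDomain hk hψ (hasAmp_amplitude hk hb)
  exact ⟨b, c, m, e, d, φ, φ₁, h, h', b, c, m, e, d, φ, φ₁, h, rfl, rfl⟩

lemma IsLinearSolution.hasDerivAt_amplitude (hk : 1 ≤ k) (h : IsLinearSolution ν ω ψ) {t : ℝ}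
    (ht : 0 < t) (hb : IsBand k (ω t)) {b c m e d φ φ₁ : L2Line}
    (hD : IsAmpDomain k (amplitude k (ω t)) b c m e d φ φ₁) (hφ : HasAmp k (ψ t) φ) :
    HasDerivAt (fun s => amplitude k (ω s)) (ampL ν k (amplitude k (ω t)) c d φ) t := by
  obtain ⟨w, hw, heq⟩ := h.equation t ht
  have h1 := (hasAmp_amplitude hk hb).ampL_of_equation hφ hD heq
  rw [← h1.coeffMap_eq hk]
  exact (amplitude k).hasFDerivAt.comp_hasDerivAt t hw

/-- Along a solution the amplitude solves the abstract evolution equation. -/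
lemma IsLinearSolution.solves {A B G : ℝ} (hk : 1 ≤ k) (h : IsLinearSolution ν ω ψ)
    (hb : ∀ t, 0 ≤ t → IsBand k (ω t)) :
    IsHypocoercive.Solves (ampGraph ν k A B G) fun t => amplitude k (ω t) := by
  intro t ht
  obtain ⟨b, c, m, e, d, φ, φ₁, hD, hφ, hm⟩ :=
    exists_mem_ampGraph (ν := ν) (A := A) (B := B) (G := G) hk (h.domain t ht) (h.stream t ht.le)
      (hb t ht.le)
  exact ⟨_, _, hm, h.hasDerivAt_amplitude hk ht (hb t ht.le) hD hφ⟩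

/-- `Φ_k` is the quadratic form of `ampP`, whichever stream function amplitude the graph provides. -/
lemma phi_eq_inner {ω ψ : L2Cyl} (hk : 1 ≤ k) (hn : 0 < n) (hν : n ^ 2 = ν) (hq : 0 < q)
    (hqk : q ^ 2 = k) (α β γ : ℝ) (hψ : IsStream ψ ω) (hb : IsBand k ω) {l p : L2Line}
    (hm : (amplitude k ω, l, p) ∈ ampGraph (n ^ 2) (q ^ 2) (α * (n / q)) (4 * β) (γ * (q / n))) :
    Phi α β γ ν k ω ψ = Real.pi / 2 * ⟪p, amplitude k ω⟫ := by
  obtain ⟨b, c, m, e, d, φ, φ₁, hD, -, hp⟩ := hm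
  dsimp only at hD hp
  have ha := hasAmp_amplitude hk hb
  obtain ⟨φ', φ₁', h1, h2⟩ := hψ.exists_hasAmp hk ha
  rw [← hqk] at h2
  rw [h2.unique (by positivity) hD.stream] at h1
  rw [hp, inner_ampP hD hD.energy, hD.energy.phi_eq hk hn hν hq hqk α β γ ha h1]

/-- The inequality `d/dt Φ_k + dissip ≤ 0`, where `d/dt Φ_k = (π / 2) · 2 ⟨P a, L a⟩`. -/
lemma add_dissip_le {ω ψ : L2Cyl} (hk : 1 ≤ k) (hn : 0 < n) (hν : n ^ 2 = ν) (hq : 0 < q)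
    (hqk : q ^ 2 = k) {a b c m e d φ φ₁ : L2Line} (hD : IsAmpDomain (q ^ 2) a b c m e d φ φ₁)
    (hω : HasAmp k ω a) (hψ : HasAmp k ψ φ) :
    Real.pi / 2 * (2 * ⟪ampP (1 / 10 * (n / q)) (4 * (1 / 50)) (32 / 125 * (q / n)) (q ^ 2) a c e d φ,
        ampL (n ^ 2) (q ^ 2) a c d φ⟫)
      + dissip (1 / 20) (1 / 10) (1 / 50) (32 / 125) ν k ω ψ ≤ 0 := by
  rw [hD.dissip_eq hk hn hν hq hqk _ _ _ _ hω hψ]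
  have h1 := amp_differential_inequality hn hq hD
  rw [show (4 * (1 / 50) : ℝ) = 4 / 50 by norm_num]
  have h2 := mul_nonpos_of_nonneg_of_nonpos Real.pi_pos.le h1
  linarith

end Solution

end Poiseuille

end

theorem theorem2p1 :
    ∃ ε₀ : ℝ, 1 / 20 ≤ ε₀ ∧ ∃ α₀ β₀ γ₀ : ℝ, 0 < α₀ ∧ 0 < β₀ ∧ 0 < γ₀ ∧
      ∀ (ν : ℝ) (k : ℕ) (ω ψ : ℝ → L2Cyl), 0 < ν → 1 ≤ k →
        IsLinearSolution ν ω ψ → (∀ t, 0 ≤ t → IsBand k (ω t)) →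
        -- the differential inequality for positive times
        (∀ t, 0 < t → FiniteNorms (ω t) (ψ t) ∧
          ∃ d : ℝ, HasDerivAt (fun s => Phi α₀ β₀ γ₀ ν k (ω s) (ψ s)) d t ∧
            d + dissip ε₀ α₀ β₀ γ₀ ν k (ω t) (ψ t) ≤ 0) ∧
        -- the differential inequality at the initial time
        (InDomain (ω 0) → FiniteNorms (ω 0) (ψ 0) ∧
          ∃ d : ℝ,
            HasDerivWithinAt (fun s => Phi α₀ β₀ γ₀ ν k (ω s) (ψ s)) d (Set.Ici 0) 0 ∧
            d + dissip ε₀ α₀ β₀ γ₀ ν k (ω 0) (ψ 0) ≤ 0) ∧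
        -- exponential decay
        (HasL2Deriv eX (ω 0) → HasL2Deriv eY (ω 0) →
          MeasureTheory.MemLp (mulY (dX (ω 0))) 2 cyl →
          ∀ t, 0 ≤ t → Phi α₀ β₀ γ₀ ν k (ω t) (ψ t) ≤
            Real.exp (-(2 * ε₀ * ν ^ (1 / 2 : ℝ) * (k : ℝ) ^ (1 / 2 : ℝ) * t)) *
              Phi α₀ β₀ γ₀ ν k (ω 0) (ψ 0)) := by
  refine ⟨1 / 20, le_rfl, 1 / 10, 1 / 50, 32 / 125, by norm_num, by norm_num, by norm_num, ?_⟩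
  intro ν k ω ψ hν hk h hb
  obtain ⟨n, hn, hnν⟩ : ∃ n : ℝ, 0 < n ∧ n ^ 2 = ν := ⟨√ν, Real.sqrt_pos.2 hν, Real.sq_sqrt hν.le⟩
  have hk0 : (0 : ℝ) < k := by exact_mod_cast hk
  obtain ⟨q, hq, hqk⟩ : ∃ q : ℝ, 0 < q ∧ q ^ 2 = k :=
    ⟨√(k : ℝ), Real.sqrt_pos.2 hk0, Real.sq_sqrt hk0.le⟩
  have hR := isHypocoercive_ampGraph hn hq
  rw [show (4 / 50 : ℝ) = 4 * (1 / 50) by norm_num] at hR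
  set R := ampGraph (n ^ 2) (q ^ 2) (1 / 10 * (n / q)) (4 * (1 / 50)) (32 / 125 * (q / n)) with hRdef
  set u : ℝ → L2Line := fun t => amplitude k (ω t) with hu
  have hS : IsHypocoercive.Solves R u := by
    have := h.solves (A := 1 / 10 * (n / q)) (B := 4 * (1 / 50)) (G := 32 / 125 * (q / n)) hk hb
    rwa [← hqk, ← hnν] at this
  have hc : ContinuousOn u (Set.Ici 0) := (amplitude k).continuous.comp_continuousOn h.continuousOn
  have hdata : ∀ t, 0 ≤ t → InDomain (ω t) → ∃ b c m e d φ φ₁,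
      IsAmpDomain (q ^ 2) (u t) b c m e d φ φ₁ ∧ HasAmp k (ψ t) φ ∧
      (u t, ampL (n ^ 2) (q ^ 2) (u t) c d φ, ampP (1 / 10 * (n / q)) (4 * (1 / 50))
        (32 / 125 * (q / n)) (q ^ 2) (u t) c e d φ) ∈ R := fun t ht hD => by
    have := exists_mem_ampGraph (ν := ν) (A := 1 / 10 * (n / q)) (B := 4 * (1 / 50))
      (G := 32 / 125 * (q / n)) hk hD (h.stream t ht) (hb t ht)
    rwa [← hqk, ← hnν] at this
  have hΦ : ∀ s, 0 ≤ s → ∀ l p, (u s, l, p) ∈ R →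
      Phi (1 / 10) (1 / 50) (32 / 125) ν k (ω s) (ψ s) = Real.pi / 2 * inner ℝ p (u s) :=
    fun s hs l p hm => phi_eq_inner hk hn hnν hq hqk _ _ _ (h.stream s hs) (hb s hs) hm
  have hΨ : ∀ s, 0 ≤ s → ∀ l p, (u s, l, p) ∈ R →
      2 / Real.pi * Phi (1 / 10) (1 / 50) (32 / 125) ν k (ω s) (ψ s) = inner ℝ p (u s) :=
    fun s hs l p hm => by
      rw [hΦ s hs l p hm]
      field_simp
  -- the abstract results concern the form `⟨P u, u⟩`, of which `Φ_k` is `π / 2` times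
  have hscale : (fun s => Phi (1 / 10) (1 / 50) (32 / 125) ν k (ω s) (ψ s)) = fun s =>
      Real.pi / 2 * (2 / Real.pi * Phi (1 / 10) (1 / 50) (32 / 125) ν k (ω s) (ψ s)) := by
    funext s
    field_simp
  refine ⟨fun t ht => ?_, fun h0 => ?_, fun _ hY hyX t ht => ?_⟩
  · obtain ⟨b, c, m, e, d, φ, φ₁, hD, hφ, hm⟩ := hdata t ht.le (h.domain t ht)
    have hω := hasAmp_amplitude hk (hb t ht.le)
    have hDk := hD
    rw [hqk] at hDk
    refine ⟨hDk.finiteNorms hω hφ, _, ?_, add_dissip_le hk hn hnν hq hqk hD hω hφ⟩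
    have hl := h.hasDerivAt_amplitude hk ht (hb t ht.le) hDk hφ
    rw [← hqk, ← hnν] at hl
    rw [hscale]
    exact (hR.hasDerivAt_form hS ht hm hl fun s hs => hΨ s hs.le).const_mul _
  · obtain ⟨b, c, m, e, d, φ, φ₁, hD, hφ, hm⟩ := hdata 0 le_rfl h0
    have hω := hasAmp_amplitude hk (hb 0 le_rfl)
    have hDk := hD
    rw [hqk] at hDk
    refine ⟨hDk.finiteNorms hω hφ, _, ?_, add_dissip_le hk hn hnν hq hqk hD hω hφ⟩
    rw [hscale]
    exact (hR.hasDerivWithinAt_form_zero hS hc hm hΨ).const_mul _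
  · rcases ht.eq_or_lt with rfl | ht
    · simp
    have hω := hasAmp_amplitude hk (hb 0 le_rfl)
    obtain ⟨b, hab⟩ := hω.exists_weakD hk hY
    obtain ⟨m, ham⟩ := hω.exists_isMulY hk hyX
    obtain ⟨φ, φ₁, hφ, hst⟩ := (h.stream 0 le_rfl).exists_hasAmp hk hω
    rw [← hqk] at hst
    have hE : IsAmpEnergy (q ^ 2) (u 0) b m φ φ₁ := ⟨hab, ham, hst⟩
    obtain ⟨b', c', m', e', d', φ', φ₁', hD, hφ', hm⟩ := hdata t ht.le (h.domain t ht)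
    have hA : 0 ≤ 1 / 10 * (n / q) := by positivity
    have hG : 0 ≤ 32 / 125 * (q / n) := by positivity
    have hB : (4 * (1 / 50) : ℝ) ^ 2 ≤ 4 * (1 / 10 * (n / q)) * (32 / 125 * (q / n)) := by
      have : 4 * (1 / 10 * (n / q)) * (32 / 125 * (q / n)) = 4 * (1 / 10) * (32 / 125) := by
        field_simp
      rw [this]
      norm_num
    -- `ω 0` has finite energy only, so the form at time `0` enters through Cauchy--Schwarz
    have hdecay := hR.form_decay_initial hS (by positivity) hc (Φ₀ := energyForm (1 / 10 * (n / q))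
      (4 * (1 / 50)) (32 / 125 * (q / n)) (q ^ 2) (u 0) b m φ φ₁ (u 0) b m φ φ₁) (by
        rintro a l p ⟨b'', c'', m'', e'', d'', φ'', φ₁'', hD'', -, hp⟩
        dsimp only at hD'' hp
        rw [hp, inner_ampP hD'' hE, inner_ampP hD'' hD''.energy]
        exact two_energyForm_le hA hG hB) ht hm
    rw [hΦ t ht.le _ _ hm, hE.phi_eq hk hn hnν hq hqk _ _ _ hω hφ, rpow_half_eq hn.le hnν,
      rpow_half_eq hq.le hqk, mul_left_comm]
    exact mul_le_mul_of_nonneg_left hdecay (by positivity)
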